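/- All theories are theories of classical first-order logic with identity in a finite signature, given by a set of axioms; RE means that this set is recursively enumerable (w.r.t. a standard Gödel numbering). $V$ *extends* $U$ if they have the same language and $V$ proves every theorem of $U$. A *translation* $\tau$ of one language in another commutes with the propositional connectives, relativises quantifiers to a definable domain, and translates identity and the atomic formulas (terms being unravelled into relational form) by given formulas; $V$ *interprets* $U$, $V\rhd U$, if for some translation $\tau$, $U\vdash\varphi$ implies $V\vdash\varphi^\tau$ for all sentences $\varphi$. Optionally translations may be more-dimensional, properly relativised, piecewise (the domain is built from finitely many pieces of possibly different dimensions), may translate identity to a formula other than identity, and may have parameters $\vec p$ from a parameter domain $\alpha$ (then $V\vdash\exists\vec p\,\alpha(\vec p)$ and $V\vdash\forall\vec p\,(\alpha(\vec p)\to\varphi^{\tau,\vec p})$ are required). For sets of theories $\mathcal X,\mathcal Y$, write $\mathcal X\blacktriangleright\mathcal Y$ if for every $U\in\mathcal X$ and every consistent RE extension $U'$ of $U$ there are a consistent RE extension $U''$ of $U'$ and a $V\in\mathcal Y$ with $U''\rhd V$; a single theory is identified with its singleton. Let $\mathbb A$ be the language with $0,\mathsf S,+,\times,<$; $x\le y$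 abbreviates $x<y\vee x=y$. The theory $\mathsf R$ has the axioms $\underline m+\underline n=\underline{m+n}$; $\underline m\times\underline n=\underline{m\times n}$; $\underline m\ne\underline n$ for $m\neq n$; $\forall x\,(x<\underline n\to\bigvee_{i<n}x=\underline i)$; $\forall x\,(x<\underline n\vee x=\underline n\vee\underline n<x)$, for all $m,n\in\mathbb N$. The finite theory $\mathsf{TN}$ has as axioms the universal closures of: $x\not<0$; $(x<y\wedge y<z)\to x<z$; $x<y\vee x=y\vee y<x$; $x=0\vee\exists y\,x=\mathsf Sy$; $\mathsf Sx\not<x$; $x<y\to(x<\mathsf Sx\wedge y\not<\mathsf Sx)$; $x+0=x$; $x+\mathsf Sy=\mathsf S(x+y)$; $x\times0=0$; $x\times\mathsf Sy=x\times y+x$. *Pure* $\Delta_0$-formulas are built from $\bot$, $\top$, $u<v$, $0=u$, $\mathsf Su=v$, $u+v=w$, $u\times v=w$ ($u,v,w$ variables) by $\neg,\wedge,\vee,\to$ and the bounded quantifiers $\forall u<v$, $\exists u<v$, $\forall u\le v$, $\exists u\le v$. A *pure* $\Sigma^0_1$-sentence is $\sigma=\exists x_0\dots\exists x_{n-1}\,\delta$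 with $\delta$ pure $\Delta_0$ with at most $x_0,\dots,x_{n-1}$ free. For a sentence $\varphi$ of $\mathbb A$, $z\models\varphi$ denotes the translation of $\varphi$ with parameter $z$ in which the domain is $\{x: x\le z\}$, $<$ and $=$ are unchanged, and $0,\mathsf S,+,\times$ are translated by their graphs cut off at $z$: the graph of $0$ is $w=0$, and a value $t$ (one of $\mathsf Sx$, $x+y$, $x\times y$) is replaced by the $w$ with $(t\le z\wedge w=t)\vee(t\not\le z\wedge w=z)$. Put $$\sigma^{\mathsf q}:=\exists z\;\,z\models\Bigl(\bigwedge\mathsf{TN}\wedge\exists x_0\dots\exists x_{n-1}\bigl(\delta\wedge\bigwedge_{i<n}\mathsf Sx_i\neq x_i\bigr)\Bigr),$$ identified with the theory axiomatised by it. Let $\mathcal S$ be the set of all consistent $\sigma^{\mathsf q}$, for $\sigma$ a pure $\Sigma^0_1$-sentence that is false in $\mathbb N$. **Theorem.** $\mathsf R$ and $\mathcal S$ are mutually lax interpretable: $\mathsf R\blacktriangleright\mathcal S$ and $\mathcal S\blacktriangleright\mathsf R$. That is, every consistent RE extension $U'$ of $\mathsf R$ has a consistent RE extension that interprets some $\sigma^{\mathsf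 q}\in\mathcal S$, and every consistent RE extension of a $\sigma^{\mathsf q}\in\mathcal S$ has a consistent RE extension that interprets $\mathsf R$. Moreover, each $\sigma^{\mathsf q}\in\mathcal S$ itself interprets $\mathsf R$. All this holds for every choice of which of the optional features of translations are allowed. -/

import Mathlib

namespace LaxInterp

open FirstOrder FirstOrder.Language

noncomputable section

/-! ## Recursively enumerable theories

A theory in a language `L` is a set of axioms (`L.Theory`).  Consistency and provability are
Mathlib's `Theory.IsSatisfiable` and `T ⊨ᵇ φ`. -/

section Coding

variable {L : FirstOrder.Language.{0, 0}} [Encodable (Σ n, L.Functions n)] [Encodable (Σ n, L.Relations n)]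

/-- Gödel numbers of terms. -/
def termCode {α : Type} [Encodable α] : L.Term α → ℕ
  | .var x => 2 * Encodable.encode x
  | .func (l := l) f ts =>
      2 * Nat.pair (Encodable.encode (⟨l, f⟩ : Σ n, L.Functions n))
        (Encodable.encode (List.ofFn fun i => termCode (ts i))) + 1

/-- Gödel numbers of formulas; injective on the formulas with a given number of variables in scope,
in particular on sentences. -/
def formulaCode {α : Type} [Encodable α] : ∀ {n : ℕ}, L.BoundedFormula α n → ℕ
  | _, .falsum => 0
  | _, .equal t₁ t₂ => 4 * Nat.pair (termCode t₁) (termCode t₂) + 1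
  | _, .rel (l := l) R ts =>
      4 * Nat.pair (Encodable.encode (⟨l, R⟩ : Σ n, L.Relations n))
        (Encodable.encode (List.ofFn fun i => termCode (ts i))) + 2
  | _, .imp φ ψ => 4 * Nat.pair (formulaCode φ) (formulaCode ψ) + 3
  | _, .all φ => 4 * formulaCode φ + 4

/-- The axiom set `T` is recursively enumerable. -/
def IsRE (T : L.Theory) : Prop :=
  REPred fun c : ℕ => ∃ φ ∈ T, formulaCode φ = c

end Coding

/-- `V` extends `U` (same language): every theorem of `U` is a theorem of `V`. -/
def Extends {L : FirstOrder.Language.{0, 0}} (V U : L.Theory) : Prop :=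
  ∀ φ : L.Sentence, U ⊨ᵇ φ → V ⊨ᵇ φ

/-! ## Translations and interpretations -/

/-- A translation of the language `L` in the language `L'`, with parameters, and with a domain that
is built up from finitely many pieces; an object of piece `i` is represented by a `dim i`-tuple.
Formulas have the parameters as free variables `Sum.inl _`.  A function symbol is treated as a
relation symbol for its graph. -/
structure Translation (L L' : FirstOrder.Language.{0, 0}) where
  /-- number of parameters -/
  numParams : ℕ
  /-- the parameter domain -/
  paramDom : L'.Formula (Fin numParams)
  /-- number of pieces -/
  numPieces : ℕ
  /-- dimension of a piece -/
  dim : Fin numPieces → ℕ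
  /-- domain formula of a piece -/
  dom : ∀ i, L'.Formula (Fin numParams ⊕ Fin (dim i))
  /-- translation of identity, between pieces `i` and `j` -/
  eq : ∀ i j, L'.Formula (Fin numParams ⊕ (Fin (dim i) ⊕ Fin (dim j)))
  /-- translation of a relation symbol, for arguments in the pieces `c` -/
  rel : ∀ {n : ℕ} (_ : L.Relations n) (c : Fin n → Fin numPieces),
    L'.Formula (Fin numParams ⊕ (Σ k : Fin n, Fin (dim (c k))))
  /-- translation of the graph of a function symbol, for arguments in the pieces `c` and a value in
  the piece `b` -/
  func : ∀ {n : ℕ} (_ : L.Functions n) (c : Fin n → Fin numPieces) (b : Fin numPieces),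
    L'.Formula (Fin numParams ⊕ ((Σ k : Fin n, Fin (dim (c k))) ⊕ Fin (dim b)))

namespace Translation

variable {L L' : FirstOrder.Language.{0, 0}} (τ : Translation L L')

/-- The variables that replace the variables in `β`, where `x` ranges over the piece `a x`. -/
abbrev Vars {β : Type} (a : β → Fin τ.numPieces) : Type := Σ x : β, Fin (τ.dim (a x))

/-- The translation of `t = y`, for a term `t` whose variables range over the pieces `a` and a
variable `y` that ranges over the piece `b`: for `t = f (t₁, …, tₗ)` it is
`∃ y₁ … yₗ (t₁ = y₁ ∧ … ∧ tₗ = yₗ ∧ f (y₁, …, yₗ) = y)`. -/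
def trTerm {β : Type} (a : β → Fin τ.numPieces) :
    L.Term β → ∀ b : Fin τ.numPieces, L'.Formula (Fin τ.numParams ⊕ (τ.Vars a ⊕ Fin (τ.dim b)))
  | .var x, b => (τ.eq (a x) b).relabel (Sum.map id (Sum.map (Sigma.mk x) id))
  | .func (l := l) f ts, b =>
      Formula.iSup fun c : Fin l → Fin τ.numPieces =>
        Formula.iExs (τ.Vars c)
          ((Formula.iInf fun k : Fin l =>
              ((τ.dom (c k)).relabel
                  (Sum.elim (fun p => .inl (.inl p)) (fun j => .inr ⟨k, j⟩)) ⊓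
                (trTerm a (ts k) (c k)).relabel
                  (Sum.elim (fun p => .inl (.inl p))
                    (Sum.elim (fun x => .inl (.inr (.inl x))) (fun j => .inr ⟨k, j⟩))))) ⊓
            (τ.func f c b).relabel
              (Sum.elim (fun p => .inl (.inl p))
                (Sum.elim (fun y => .inr y) (fun j => .inl (.inr (.inr j))))))

/-- The translation of `∃ y₁ … yₗ (t₁ = y₁ ∧ … ∧ tₗ = yₗ ∧ θ (y₁, …, yₗ))`, where `θ` is already
translated, for each choice of pieces for its arguments. -/
def trAtom {β : Type} (a : β → Fin τ.numPieces) {l : ℕ} (ts : Fin l → L.Term β)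
    (θ : ∀ c : Fin l → Fin τ.numPieces, L'.Formula (Fin τ.numParams ⊕ τ.Vars c)) :
    L'.Formula (Fin τ.numParams ⊕ τ.Vars a) :=
  Formula.iSup fun c : Fin l → Fin τ.numPieces =>
    Formula.iExs (τ.Vars c)
      ((Formula.iInf fun k : Fin l =>
          ((τ.dom (c k)).relabel
              (Sum.elim (fun p => .inl (.inl p)) (fun j => .inr ⟨k, j⟩)) ⊓
            (τ.trTerm a (ts k) (c k)).relabel
              (Sum.elim (fun p => .inl (.inl p))
                (Sum.elim (fun x => .inl (.inr x)) (fun j => .inr ⟨k, j⟩))))) ⊓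
        (θ c).relabel (Sum.elim (fun p => .inl (.inl p)) (fun y => .inr y)))

/-- Extend a choice of pieces to one more bound variable. -/
def snocPiece {α : Type} {n : ℕ} (a : α ⊕ Fin n → Fin τ.numPieces) (b : Fin τ.numPieces) :
    α ⊕ Fin (n + 1) → Fin τ.numPieces :=
  Sum.elim (fun x => a (.inl x)) (Fin.snoc (α := fun _ => Fin τ.numPieces) (fun m => a (.inr m)) b)

/-- Split off the variables that replace the last bound variable. -/
def splitLast {α : Type} {n : ℕ} (a : α ⊕ Fin n → Fin τ.numPieces) (b : Fin τ.numPieces) :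
    τ.Vars (τ.snocPiece a b) → τ.Vars a ⊕ Fin (τ.dim b)
  | ⟨.inl x, j⟩ => .inl ⟨.inl x, j⟩
  | ⟨.inr m, j⟩ =>
      if h : m.val < n then
        .inl ⟨.inr (m.castLT h), Fin.cast (by simp [snocPiece, Fin.snoc, h]) j⟩
      else .inr (Fin.cast (by simp [snocPiece, Fin.snoc, h]) j)

/-- The translation `φ^τ` of a formula whose variables range over the pieces `a`.  It commutes with
the propositional connectives, and quantifiers are relativised to the domain of `τ`, piece by
piece. -/
def tr {α : Type} : ∀ {n : ℕ}, L.BoundedFormula α n → ∀ a : α ⊕ Fin n → Fin τ.numPieces,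
    L'.Formula (Fin τ.numParams ⊕ τ.Vars a)
  | _, .falsum, _ => ⊥
  | _, .equal t₁ t₂, a =>
      τ.trAtom a ![t₁, t₂] fun c =>
        (τ.eq (c 0) (c 1)).relabel (Sum.map id (Sum.elim (Sigma.mk 0) (Sigma.mk 1)))
  | _, .rel R ts, a => τ.trAtom a ts fun c => τ.rel R c
  | _, .imp φ ψ, a => (tr φ a).imp (tr ψ a)
  | _, .all φ, a =>
      Formula.iInf fun b : Fin τ.numPieces =>
        Formula.iAlls (Fin (τ.dim b))
          (((τ.dom b).relabel (Sum.map (fun p => .inl p) id)).imp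
            ((tr φ (τ.snocPiece a b)).relabel
              (Sum.elim (fun p => .inl (.inl p))
                (fun x => Sum.map (fun y => .inr y) id (τ.splitLast a b x)))))

/-- The translation of a sentence; only the parameters are free. -/
def trSentence (φ : L.Sentence) : L'.Formula (Fin τ.numParams) :=
  (τ.tr φ (fun x => isEmptyElim x)).relabel (Sum.elim id (fun x => isEmptyElim x.1))

/-- `τ` gives an interpretation of `U` in `V`: `V` proves that the parameter domain is non-empty,
and, for every theorem `φ` of `U`, that `φ^τ` holds for all parameters in the parameter domain. -/
def IsInterpretation (V : L'.Theory) (U : L.Theory) : Prop :=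
  (V ⊨ᵇ Formula.iExs (α := Empty) (Fin τ.numParams) (τ.paramDom.relabel Sum.inr)) ∧
    ∀ φ : L.Sentence, U ⊨ᵇ φ →
      V ⊨ᵇ Formula.iAlls (α := Empty) (Fin τ.numParams)
        ((τ.paramDom.imp (τ.trSentence φ)).relabel Sum.inr)

/-- The formula expressing that two tuples are literally the same object; it is `⊥` for tuples of
different pieces. -/
def identity (i j : Fin τ.numPieces) :
    L'.Formula (Fin τ.numParams ⊕ (Fin (τ.dim i) ⊕ Fin (τ.dim j))) :=
  if h : i = j then
    Formula.iInf fun k : Fin (τ.dim i) =>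
      Term.equal (.var (.inr (.inl k))) (.var (.inr (.inr (Fin.cast (by rw [h]) k))))
  else ⊥

end Translation

/-- The optional features of translations.  Each choice gives one notion of interpretation. -/
structure Features where
  /-- objects may be represented by sequences of any length, not only of length one -/
  multidimensional : Prop
  /-- quantifiers may be relativised to a definable domain -/
  relativised : Prop
  /-- the domain may be built up from several pieces -/
  piecewise : Prop
  /-- identity need not be translated to identity -/
  nonidentity : Prop
  /-- parameters are allowed -/
  parametric : Prop

/-- `τ` uses only the features allowed by `F`. -/
def Translation.Admissible {L L' : FirstOrder.Language.{0, 0}} (τ : Translation L L') (F : Features) : Prop :=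
  (¬F.multidimensional → ∀ i, τ.dim i = 1) ∧
  (¬F.relativised → ∀ i, τ.dom i = ⊤) ∧
  (¬F.piecewise → τ.numPieces = 1) ∧
  (¬F.nonidentity → ∀ i j, τ.eq i j = τ.identity i j) ∧
  (¬F.parametric → τ.numParams = 0 ∧ τ.paramDom = ⊤)

/-- `V ▷ U`: the theory `V` interprets the theory `U`. -/
def Interprets (F : Features) {L L' : FirstOrder.Language.{0, 0}} (V : L'.Theory) (U : L.Theory) : Prop :=
  ∃ τ : Translation L L', τ.Admissible F ∧ τ.IsInterpretation V U

/-- Essential tolerance, the converse of lax interpretability, between sets of theories: every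
consistent RE extension `U'` of an element of `X` has a consistent RE extension `U''` that
interprets an element of `Y`.  The signature of the elements of `X` is finite. -/
def EssentiallyTolerates (F : Features) {L L' : FirstOrder.Language.{0, 0}}
    [Encodable (Σ n, L.Functions n)] [Encodable (Σ n, L.Relations n)]
    [Finite (Σ n, L.Functions n)] [Finite (Σ n, L.Relations n)]
    (X : Set L.Theory) (Y : Set L'.Theory) : Prop :=
  ∀ U ∈ X, ∀ U' : L.Theory, IsRE U' → U'.IsSatisfiable → Extends U' U →
    ∃ U'' : L.Theory, IsRE U'' ∧ U''.IsSatisfiable ∧ Extends U'' U' ∧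
      ∃ V ∈ Y, Interprets F U'' V

/-! ## The language of arithmetic -/

/-- The function symbols `0`, `S`, `+`, `×`. -/
inductive ArithFunc : ℕ → Type
  | zero : ArithFunc 0
  | succ : ArithFunc 1
  | add : ArithFunc 2
  | mul : ArithFunc 2

/-- The relation symbol `<`. -/
inductive ArithRel : ℕ → Type
  | lt : ArithRel 2

/-- The arithmetical language. -/
abbrev arith : FirstOrder.Language.{0, 0} := ⟨ArithFunc, ArithRel⟩

instance : Encodable (Σ n, arith.Functions n) where
  encode f := match f with
    | ⟨_, ArithFunc.zero⟩ => 0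
    | ⟨_, ArithFunc.succ⟩ => 1
    | ⟨_, ArithFunc.add⟩ => 2
    | ⟨_, ArithFunc.mul⟩ => 3
  decode n := match n with
    | 0 => some ⟨_, ArithFunc.zero⟩
    | 1 => some ⟨_, ArithFunc.succ⟩
    | 2 => some ⟨_, ArithFunc.add⟩
    | 3 => some ⟨_, ArithFunc.mul⟩
    | _ => none
  encodek := by rintro ⟨_, _ | _⟩ <;> rfl

instance : Encodable (Σ n, arith.Relations n) where
  encode _ := 0
  decode _ := some ⟨_, ArithRel.lt⟩
  encodek := by rintro ⟨_, _ | _⟩; rfl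

instance : Finite (Σ n, arith.Functions n) :=
  Finite.of_injective (β := Fin 4)
    (fun f => match f with
      | ⟨_, ArithFunc.zero⟩ => 0
      | ⟨_, ArithFunc.succ⟩ => 1
      | ⟨_, ArithFunc.add⟩ => 2
      | ⟨_, ArithFunc.mul⟩ => 3)
    (by rintro ⟨_, _ | _⟩ ⟨_, _ | _⟩ h <;> simp_all)

instance : Finite (Σ n, arith.Relations n) :=
  Finite.of_injective (β := Fin 1) (fun _ => 0) (by rintro ⟨_, _ | _⟩ ⟨_, _ | _⟩ _; rfl)

/-- The standard model. -/
instance : arith.Structure ℕ where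
  funMap f := match f with
    | ArithFunc.zero => fun _ => 0
    | ArithFunc.succ => fun x => x 0 + 1
    | ArithFunc.add => fun x => x 0 + x 1
    | ArithFunc.mul => fun x => x 0 * x 1
  RelMap r := match r with
    | ArithRel.lt => fun x => x 0 < x 1

section Syntactic

variable {α : Type} {n : ℕ}

def zeroT : arith.Term α := Term.func ArithFunc.zero ![]
def succT (t : arith.Term α) : arith.Term α := Term.func ArithFunc.succ ![t]
def addT (t s : arith.Term α) : arith.Term α := Term.func ArithFunc.add ![t, s]
def mulT (t s : arith.Term α) : arith.Term α := Term.func ArithFunc.mul ![t, s]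

/-- The unary numeral of a natural number. -/
def num : ℕ → arith.Term α
  | 0 => zeroT
  | k + 1 => succT (num k)

def ltF (t s : arith.Term (α ⊕ Fin n)) : arith.BoundedFormula α n :=
  BoundedFormula.rel ArithRel.lt ![t, s]

/-- `t ≤ s` abbreviates `t < s ∨ t = s`. -/
def leF (t s : arith.Term (α ⊕ Fin n)) : arith.BoundedFormula α n :=
  ltF t s ⊔ (t =' s)

def conj (l : List (arith.BoundedFormula α n)) : arith.BoundedFormula α n := l.foldr (· ⊓ ·) ⊤
def disj (l : List (arith.BoundedFormula α n)) : arith.BoundedFormula α n := l.foldr (· ⊔ ·) ⊥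

end Syntactic

/-- The axioms of the theory `R`. -/
inductive RAxiom : arith.Sentence → Prop
  | r1 (m n : ℕ) : RAxiom (addT (num m) (num n) =' num (m + n))
  | r2 (m n : ℕ) : RAxiom (mulT (num m) (num n) =' num (m * n))
  | r3 (m n : ℕ) (h : m ≠ n) : RAxiom (∼(num m =' num n))
  | r4 (n : ℕ) :
      RAxiom (∀' (ltF (&0) (num n) ⟹ disj ((List.range n).map fun i => &0 =' num i)))
  | r5 (n : ℕ) : RAxiom (∀' (ltF (&0) (num n) ⊔ ((&0 =' num n) ⊔ ltF (num n) (&0))))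

/-- The theory `R`. -/
def R : arith.Theory := {φ | RAxiom φ}

/-- The conjunction of the axioms of the theory `TN` of a number. -/
def TN : arith.Sentence :=
  conj [
    ∀' ∼(ltF (&0) zeroT),
    ∀' ∀' ∀' ((ltF (&0) (&1) ⊓ ltF (&1) (&2)) ⟹ ltF (&0) (&2)),
    ∀' ∀' (ltF (&0) (&1) ⊔ ((&0 =' &1) ⊔ ltF (&1) (&0))),
    ∀' ((&0 =' zeroT) ⊔ ∃' (&0 =' succT (&1))),
    ∀' ∼(ltF (succT (&0)) (&0)),
    ∀' ∀' (ltF (&0) (&1) ⟹ (ltF (&0) (succT (&0)) ⊓ ∼(ltF (&1) (succT (&0))))),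
    ∀' (addT (&0) zeroT =' &0),
    ∀' ∀' (addT (&0) (succT (&1)) =' succT (addT (&0) (&1))),
    ∀' (mulT (&0) zeroT =' zeroT),
    ∀' ∀' (mulT (&0) (succT (&1)) =' addT (mulT (&0) (&1)) (&0))]

/-- Pure `Δ₀`-formulas in the variables `&0, …, &(n-1)`.  In a bounded quantifier the bound
variable is `&n`, and the bound is one of `&0, …, &(n-1)`. -/
inductive IsPureDelta0 : ∀ {n : ℕ}, arith.BoundedFormula Empty n → Prop
  | falsum {n : ℕ} : IsPureDelta0 (⊥ : arith.BoundedFormula Empty n)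
  | verum {n : ℕ} : IsPureDelta0 (⊤ : arith.BoundedFormula Empty n)
  | lt {n : ℕ} (u v : Fin n) : IsPureDelta0 (ltF (&u) (&v))
  | zero {n : ℕ} (u : Fin n) : IsPureDelta0 (zeroT =' &u)
  | succ {n : ℕ} (u v : Fin n) : IsPureDelta0 (succT (&u) =' &v)
  | add {n : ℕ} (u v w : Fin n) : IsPureDelta0 (addT (&u) (&v) =' &w)
  | mul {n : ℕ} (u v w : Fin n) : IsPureDelta0 (mulT (&u) (&v) =' &w)
  | not {n : ℕ} {δ : arith.BoundedFormula Empty n} : IsPureDelta0 δ → IsPureDelta0 (∼δ)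
  | and {n : ℕ} {δ ε : arith.BoundedFormula Empty n} :
      IsPureDelta0 δ → IsPureDelta0 ε → IsPureDelta0 (δ ⊓ ε)
  | or {n : ℕ} {δ ε : arith.BoundedFormula Empty n} :
      IsPureDelta0 δ → IsPureDelta0 ε → IsPureDelta0 (δ ⊔ ε)
  | imp {n : ℕ} {δ ε : arith.BoundedFormula Empty n} :
      IsPureDelta0 δ → IsPureDelta0 ε → IsPureDelta0 (δ ⟹ ε)
  | allLt {n : ℕ} (v : Fin n) {δ : arith.BoundedFormula Empty (n + 1)} :
      IsPureDelta0 δ → IsPureDelta0 (∀' (ltF (&(Fin.last n)) (&v.castSucc) ⟹ δ))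
  | exLt {n : ℕ} (v : Fin n) {δ : arith.BoundedFormula Empty (n + 1)} :
      IsPureDelta0 δ → IsPureDelta0 (∃' (ltF (&(Fin.last n)) (&v.castSucc) ⊓ δ))
  | allLe {n : ℕ} (v : Fin n) {δ : arith.BoundedFormula Empty (n + 1)} :
      IsPureDelta0 δ → IsPureDelta0 (∀' (leF (&(Fin.last n)) (&v.castSucc) ⟹ δ))
  | exLe {n : ℕ} (v : Fin n) {δ : arith.BoundedFormula Empty (n + 1)} :
      IsPureDelta0 δ → IsPureDelta0 (∃' (leF (&(Fin.last n)) (&v.castSucc) ⊓ δ))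

/-! ## The sentences `σ^q` -/

/-- The formula `(t ≤ z ∧ w = t) ∨ (t ≰ z ∧ w = z)`. -/
def cutoff {α : Type} (z w t : arith.Term (α ⊕ Fin 0)) : arith.Formula α :=
  (leF t z ⊓ (w =' t)) ⊔ (∼(leF t z) ⊓ (w =' z))

/-- The parametric translation `tr(z)`, where `z` is the parameter: the domain is `x ≤ z` and the
arithmetical operations are cut off at `z`. -/
abbrev cutTr : Translation arith arith where
  numParams := 1
  paramDom := ⊤
  numPieces := 1
  dim _ := 1
  dom _ := leF (.var (.inl (.inr 0))) (.var (.inl (.inl 0)))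
  eq _ _ := Term.bdEqual (.var (.inl (.inr (.inl 0)))) (.var (.inl (.inr (.inr 0))))
  rel r _ := match r with
    | ArithRel.lt => ltF (.var (.inl (.inr ⟨0, 0⟩))) (.var (.inl (.inr ⟨1, 0⟩)))
  func f _ _ := match f with
    | ArithFunc.zero => Term.bdEqual (.var (.inl (.inr (.inr 0)))) zeroT
    | ArithFunc.succ =>
        cutoff (.var (.inl (.inl 0))) (.var (.inl (.inr (.inr 0))))
          (succT (.var (.inl (.inr (.inl ⟨0, 0⟩)))))
    | ArithFunc.add =>
        cutoff (.var (.inl (.inl 0))) (.var (.inl (.inr (.inr 0))))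
          (addT (.var (.inl (.inr (.inl ⟨0, 0⟩)))) (.var (.inl (.inr (.inl ⟨1, 0⟩)))))
    | ArithFunc.mul =>
        cutoff (.var (.inl (.inl 0))) (.var (.inl (.inr (.inr 0))))
          (mulT (.var (.inl (.inr (.inl ⟨0, 0⟩)))) (.var (.inl (.inr (.inl ⟨1, 0⟩)))))

/-- `z ⊨ φ`, for a sentence `φ`, as a formula with the free variable `z`. -/
def satAt (φ : arith.Sentence) : arith.Formula (Fin 1) := cutTr.trSentence φ

/-- For `σ = ∃ x₀ … xₙ₋₁ δ`, the sentence
`σ^q = ∃ z, z ⊨ (⋀ TN ∧ ∃ x₀ … xₙ₋₁ (δ ∧ S x₀ ≠ x₀ ∧ … ∧ S xₙ₋₁ ≠ xₙ₋₁))`. -/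
def sigmaQ {n : ℕ} (δ : arith.BoundedFormula Empty n) : arith.Sentence :=
  Formula.iExs (α := Empty) (Fin 1)
    ((satAt (TN ⊓
      (δ ⊓ conj ((List.finRange n).map fun i => ∼(succT (&i) =' &i))).exs)).relabel Sum.inr)

/-- The consistent theories `σ^q`, where `σ = ∃ x₀ … xₙ₋₁ δ` is a false pure `Σ⁰₁`-sentence. -/
def S : Set arith.Theory :=
  {T | ∃ (n : ℕ) (δ : arith.BoundedFormula Empty n), IsPureDelta0 δ ∧
    ¬ Sentence.Realize ℕ δ.exs ∧ T = {sigmaQ δ} ∧ T.IsSatisfiable}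

end

end LaxInterp

/-!
The argument is semantic: by `Translation.Represents.realize_tr` a translated formula `φ^τ` holds
in a structure exactly when `φ` holds in the structure that `τ` defines there. In particular
`z ⊨ φ` says that `φ` holds in `Cut M z`, the segment below `z` with operations cut off at `z`
(`realize_satAt`), and `σ^q` says that some such segment is a model of `TN` and contains witnesses
for `δ` different from its largest element (`realize_sigmaQ`).

**A false `σ^q` interprets `R`.** If a witness `z` of `σ^q` were not above all numerals, the
segment below it would be a finite initial segment of `ℕ`, and by absoluteness of pure
`Δ₀`-formulas (`IsPureDelta0.realize_cutNat`) the sentence `σ` would be true; see `IsGood.lt_nm`.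
So all numerals lie strictly below `z`, and `TN` computes their sums and products correctly. Only
the order has to be redefined, by `goodLt`, to handle the elements that are not below `z`
(`isR_withLt`). This changes nothing but the formula for `<`, so no optional feature of
translations is used. An interpretation in a theory is also one in its extensions, hence `S`
essentially tolerates `R`.

**`R` essentially tolerates `S`.** Let `U` be a consistent RE extension of `R`, let `A` be RE with
a complement that is not RE, and let `∃ y δ(x, y)` be a pure `Σ₁`-definition of `A`
(`exists_delta0_of_re`). Let `θ(x)` say that some segment whose bound is above `x` is a model of
`TN` and contains a witness for `∃ y δ(x, y)`. For `n ∈ A` the theory `R` proves `θ(n)`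
(`IsR.exists_wit`), so `n` is not in the set `B` of all `n` such that `U` refutes `θ(n)`. As `B`
is RE and disjoint from `A`, there is an `n` outside both. For this `n` the pure `Σ₁`-sentence `σ`
that expresses `∃ y δ(n, y)` is false, while `U` with `σ^q` is consistent, because `σ^q` follows
from `U` with `θ(n)` (`IsR.realize_sigmaQ`). This theory interprets `σ^q` by the identity.

That `B` is RE needs an effective completeness theorem, for provability is given as semantic
consequence (`rePred_not_exists_model`). Existence of a model is reduced to satisfiability of a
primitive recursive set of propositional clauses that describes a Henkin model on a domain of
names; unsatisfiability of such a set is RE by compactness of the Cantor space (`rePred_unsat`).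
-/

namespace LaxInterp

open FirstOrder FirstOrder.Language

/-! ### Semantics of translations -/

namespace Translation

variable {L L' : FirstOrder.Language.{0, 0}}

/-- In the structure `M`, with the parameters `p`, the translation `τ` defines the structure `N`:
the tuple `u` in the domain of the piece `b` denotes the element `π b u` of `N`. Since `τ` may
translate identity to another formula, `π b` need not be injective. -/
structure Represents (τ : Translation L L') {M N : Type} [L'.Structure M] [L.Structure N]
    (p : Fin τ.numParams → M) (π : ∀ b, (Fin (τ.dim b) → M) → N) : Prop where
  surj : ∀ y, ∃ b u, (τ.dom b).Realize (Sum.elim p u) ∧ π b u = y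
  eq : ∀ i j u v, (τ.dom i).Realize (Sum.elim p u) → (τ.dom j).Realize (Sum.elim p v) →
    ((τ.eq i j).Realize (Sum.elim p (Sum.elim u v)) ↔ π i u = π j v)
  rel : ∀ {n : ℕ} (R : L.Relations n) (c : Fin n → Fin τ.numPieces)
    (u : ∀ k, Fin (τ.dim (c k)) → M), (∀ k, (τ.dom (c k)).Realize (Sum.elim p (u k))) →
    ((τ.rel R c).Realize (Sum.elim p fun x => u x.1 x.2) ↔
      Structure.RelMap R fun k => π (c k) (u k))
  func : ∀ {n : ℕ} (f : L.Functions n) (c : Fin n → Fin τ.numPieces) (b : Fin τ.numPieces)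
    (u : ∀ k, Fin (τ.dim (c k)) → M) (w : Fin (τ.dim b) → M),
    (∀ k, (τ.dom (c k)).Realize (Sum.elim p (u k))) → (τ.dom b).Realize (Sum.elim p w) →
    ((τ.func f c b).Realize (Sum.elim p (Sum.elim (fun x => u x.1 x.2) w)) ↔
      Structure.funMap f (fun k => π (c k) (u k)) = π b w)

variable {τ : Translation L L'} {M N : Type} [L'.Structure M] [L.Structure N]
  {p : Fin τ.numParams → M} {π : ∀ b, (Fin (τ.dim b) → M) → N}

theorem Represents.realize_trTerm (h : τ.Represents p π) {β : Type} {a : β → Fin τ.numPieces}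
    (u : ∀ x, Fin (τ.dim (a x)) → M) (hu : ∀ x, (τ.dom (a x)).Realize (Sum.elim p (u x)))
    (t : L.Term β) (b : Fin τ.numPieces) (w : Fin (τ.dim b) → M)
    (hw : (τ.dom b).Realize (Sum.elim p w)) :
    (τ.trTerm a t b).Realize (Sum.elim p (Sum.elim (fun x => u x.1 x.2) w)) ↔
      t.realize (fun x => π (a x) (u x)) = π b w := by
  induction t generalizing b w with
  | var x =>
    rw [trTerm, Formula.realize_relabel, Term.realize_var, ← h.eq _ _ _ _ (hu x) hw]
    refine iff_of_eq (congrArg _ (funext ?_))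
    rintro (_ | _ | _) <;> rfl
  | func f ts ih =>
    simp only [trTerm, Formula.realize_iSup, Formula.realize_iExs, Formula.realize_inf,
      Formula.realize_iInf, Formula.realize_relabel, Term.realize_func]
    have key : ∀ (c : _ → Fin τ.numPieces) (v : τ.Vars c → M),
        ((∀ k, (τ.dom (c k)).Realize (Sum.elim p fun j => v ⟨k, j⟩) ∧
          (τ.trTerm a (ts k) (c k)).Realize
            (Sum.elim p (Sum.elim (fun x => u x.1 x.2) fun j => v ⟨k, j⟩))) ∧
          (τ.func f c b).Realize (Sum.elim p (Sum.elim v w))) ↔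
        (∀ k, (τ.dom (c k)).Realize (Sum.elim p fun j => v ⟨k, j⟩) ∧
          (ts k).realize (fun x => π (a x) (u x)) = π (c k) fun j => v ⟨k, j⟩) ∧
        Structure.funMap f (fun k => π (c k) fun j => v ⟨k, j⟩) = π b w := by
      intro c v
      constructor
      · rintro ⟨h1, h2⟩
        exact ⟨fun k => ⟨(h1 k).1, (ih k _ _ (h1 k).1).1 (h1 k).2⟩,
          (h.func f c b (fun k j => v ⟨k, j⟩) w (fun k => (h1 k).1) hw).1 h2⟩
      · rintro ⟨h1, h2⟩
        exact ⟨fun k => ⟨(h1 k).1, (ih k _ _ (h1 k).1).2 (h1 k).2⟩,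
          (h.func f c b (fun k j => v ⟨k, j⟩) w (fun k => (h1 k).1) hw).2 h2⟩
    constructor
    · rintro ⟨c, v, h1, h2⟩
      have := (key c v).1 ⟨fun k => ⟨?_, ?_⟩, ?_⟩
      · rw [← this.2]
        congr 1
        funext k
        exact (this.1 k).2
      · convert (h1 k).1 using 1
        funext x; rcases x with _ | _ <;> rfl
      · convert (h1 k).2 using 1
        funext x; rcases x with _ | _ | _ <;> rfl
      · convert h2 using 1
        funext x; rcases x with _ | _ | _ <;> rfl
    · intro e
      choose c v hv hc using fun k => h.surj ((ts k).realize (fun x => π (a x) (u x)))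
      have := (key c (fun x => v x.1 x.2)).2 ⟨fun k => ⟨hv k, (hc k).symm⟩, by
        rw [← e]; congr 1; funext k; exact hc k⟩
      refine ⟨c, fun x => v x.1 x.2, fun k => ⟨?_, ?_⟩, ?_⟩
      · convert (this.1 k).1 using 1
        funext x; rcases x with _ | _ <;> rfl
      · convert (this.1 k).2 using 1
        funext x; rcases x with _ | _ | _ <;> rfl
      · convert this.2 using 1
        funext x; rcases x with _ | _ | _ <;> rfl

theorem Represents.realize_trAtom (h : τ.Represents p π) {β : Type} {a : β → Fin τ.numPieces}
    (u : ∀ x, Fin (τ.dim (a x)) → M) (hu : ∀ x, (τ.dom (a x)).Realize (Sum.elim p (u x)))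
    {l : ℕ} (ts : Fin l → L.Term β)
    (θ : ∀ c : Fin l → Fin τ.numPieces, L'.Formula (Fin τ.numParams ⊕ τ.Vars c))
    (P : (Fin l → N) → Prop)
    (hθ : ∀ (c : Fin l → Fin τ.numPieces) (v : ∀ k, Fin (τ.dim (c k)) → M),
      (∀ k, (τ.dom (c k)).Realize (Sum.elim p (v k))) →
      ((θ c).Realize (Sum.elim p fun x => v x.1 x.2) ↔ P fun k => π (c k) (v k))) :
    (τ.trAtom a ts θ).Realize (Sum.elim p fun x => u x.1 x.2) ↔
      P fun k => (ts k).realize fun x => π (a x) (u x) := by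
  simp only [trAtom, Formula.realize_iSup, Formula.realize_iExs, Formula.realize_inf,
      Formula.realize_iInf, Formula.realize_relabel]
  constructor
  · rintro ⟨c, v, h1, h2⟩
    have hd : ∀ k, (τ.dom (c k)).Realize (Sum.elim p fun j => v ⟨k, j⟩) := fun k => by
      convert (h1 k).1 using 1
      funext x; rcases x with _ | _ <;> rfl
    have ht : ∀ k, (ts k).realize (fun x => π (a x) (u x)) = π (c k) fun j => v ⟨k, j⟩ :=
      fun k => (h.realize_trTerm u hu (ts k) (c k) _ (hd k)).1 (by
        convert (h1 k).2 using 1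
        funext x; rcases x with _ | _ | _ <;> rfl)
    simp only [ht]
    refine (hθ c (fun k j => v ⟨k, j⟩) hd).1 ?_
    convert h2 using 1
    funext x; rcases x with _ | _ <;> rfl
  · intro e
    choose c v hv hc using fun k => h.surj ((ts k).realize (fun x => π (a x) (u x)))
    refine ⟨c, fun x => v x.1 x.2, fun k => ⟨?_, ?_⟩, ?_⟩
    · convert hv k using 1
      funext x; rcases x with _ | _ <;> rfl
    · convert (h.realize_trTerm u hu (ts k) (c k) _ (hv k)).2 (hc k).symm using 1
      funext x; rcases x with _ | _ | _ <;> rfl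
    · simp only [← hc] at e
      convert (hθ c v hv).2 e using 1
      funext x; rcases x with _ | _ <;> rfl

/-- Transport of a tuple along an equality of pieces, as it is done by `Translation.splitLast`. -/
theorem piece_cast {τ : Translation L L'} {M N : Type} [L'.Structure M]
    {p : Fin τ.numParams → M} {π : ∀ b, (Fin (τ.dim b) → M) → N} {i j : Fin τ.numPieces}
    (e : i = j) (w : Fin (τ.dim j) → M) {e' : τ.dim i = τ.dim j} :
    π i (fun k => w (Fin.cast e' k)) = π j w ∧
      ((τ.dom i).Realize (Sum.elim p fun k => w (Fin.cast e' k)) ↔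
        (τ.dom j).Realize (Sum.elim p w)) := by
  subst e
  exact ⟨rfl, Iff.rfl⟩

/-- The semantic meaning of a translation: `φ^τ` holds in `M` exactly when `φ` holds in the
structure that `τ` defines in `M`. -/
theorem Represents.realize_tr (h : τ.Represents p π) {α : Type} {n : ℕ} (φ : L.BoundedFormula α n)
    (a : α ⊕ Fin n → Fin τ.numPieces)
    (u : ∀ x, Fin (τ.dim (a x)) → M) (hu : ∀ x, (τ.dom (a x)).Realize (Sum.elim p (u x))) :
    (τ.tr φ a).Realize (Sum.elim p fun x => u x.1 x.2) ↔
      φ.Realize (fun x => π (a (.inl x)) (u (.inl x))) (fun m => π (a (.inr m)) (u (.inr m))) := by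
  have hs : ∀ {n : ℕ} (a : α ⊕ Fin n → Fin τ.numPieces) (u : ∀ x, Fin (τ.dim (a x)) → M),
      (fun x => π (a x) (u x)) = Sum.elim (fun x => π (a (.inl x)) (u (.inl x)))
        (fun m => π (a (.inr m)) (u (.inr m))) := by
    intro n a u; funext x; rcases x with _ | _ <;> rfl
  induction φ with
  | falsum => exact Iff.rfl
  | equal t₁ t₂ =>
    rw [tr, h.realize_trAtom u hu _ _ (fun y => y 0 = y 1), hs]
    · rfl
    · intro c v hv
      rw [← h.eq _ _ _ _ (hv 0) (hv 1), Formula.realize_relabel]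
      refine iff_of_eq (congrArg _ (funext ?_))
      rintro (_ | _ | _) <;> rfl
  | rel R ts =>
    rw [tr, h.realize_trAtom u hu _ _ (fun y => Structure.RelMap R y), hs]
    · rfl
    · exact h.rel R
  | imp φ ψ ih1 ih2 =>
    exact Formula.realize_imp.trans (imp_congr (ih1 a u hu) (ih2 a u hu))
  | all φ ih =>
    rw [tr, BoundedFormula.realize_all]
    simp only [Formula.realize_iInf, Formula.realize_iAlls, Formula.realize_imp,
      Formula.realize_relabel]
    have key : ∀ b (w : Fin (τ.dim b) → M), (τ.dom b).Realize (Sum.elim p w) →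
        ((τ.tr φ (τ.snocPiece a b)).Realize
          (Sum.elim p fun x => Sum.elim (fun y => u y.1 y.2) w (τ.splitLast a b x)) ↔
        φ.Realize (fun x => π (a (.inl x)) (u (.inl x)))
          (Fin.snoc (α := fun _ => N) (fun m => π (a (.inr m)) (u (.inr m))) (π b w))) := by
      intro b w hw
      let u' : ∀ x, Fin (τ.dim (τ.snocPiece a b x)) → M :=
        fun x j => Sum.elim (fun y => u y.1 y.2) w (τ.splitLast a b ⟨x, j⟩)
      have hc : ∀ m : Fin _, τ.snocPiece a b (.inr m.castSucc) = a (.inr m) := by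
        intro m; simp [snocPiece]
      have hl : τ.snocPiece a b (.inr (Fin.last _)) = b := by simp [snocPiece]
      have uc : ∀ m : Fin _, u' (.inr m.castSucc) =
          fun j => u (.inr m) (Fin.cast (by rw [hc]) j) := by
        intro m; funext j
        simp only [u', splitLast]
        rw [dif_pos (by simp)]
        rfl
      have ul : u' (.inr (Fin.last _)) = fun j => w (Fin.cast (by rw [hl]) j) := by
        funext j
        simp only [u', splitLast]
        rw [dif_neg (by simp)]
        rfl
      have hu' : ∀ x, (τ.dom (τ.snocPiece a b x)).Realize (Sum.elim p (u' x)) := by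
        rintro (x | m)
        · exact hu (.inl x)
        · refine Fin.lastCases ?_ (fun m => ?_) m
          · rw [ul]; exact (piece_cast (π := π) hl w).2.2 hw
          · rw [uc]; exact (piece_cast (π := π) (hc m) _).2.2 (hu _)
      have := ih (τ.snocPiece a b) u' hu'
      refine this.trans (iff_of_eq ?_)
      congr 1
      funext m
      refine Fin.lastCases ?_ (fun m => ?_) m
      · rw [ul, Fin.snoc_last]; exact (piece_cast (p := p) hl w).1
      · rw [uc, Fin.snoc_castSucc]; exact (piece_cast (p := p) (hc m) _).1
    have e1 : ∀ b (w : Fin (τ.dim b) → M),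
        (Sum.elim (Sum.elim p fun x : τ.Vars a => u x.1 x.2) w ∘ Sum.map (fun p => Sum.inl p) id) =
          Sum.elim p w := by
      intro b w; funext x; rcases x with _ | _ <;> rfl
    have e2 : ∀ b (w : Fin (τ.dim b) → M),
        (Sum.elim (Sum.elim p fun x : τ.Vars a => u x.1 x.2) w ∘
          Sum.elim (fun p => Sum.inl (Sum.inl p))
            (fun x => Sum.map (fun y => Sum.inr y) id (τ.splitLast a b x))) =
        (Sum.elim p fun x => Sum.elim (fun y => u y.1 y.2) w (τ.splitLast a b x)) := by
      intro b w; funext x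
      rcases x with _ | x
      · rfl
      · simp only [Function.comp, Sum.elim_inr]
        rcases τ.splitLast a b x with _ | _ <;> rfl
    simp only [e1, e2]
    constructor
    · intro H y
      obtain ⟨b, w, hw, rfl⟩ := h.surj y
      exact (key b w hw).1 (H b w hw)
    · intro H b w hw
      exact (key b w hw).2 (H _)

theorem Represents.realize_trSentence (h : τ.Represents p π) (φ : L.Sentence) :
    (τ.trSentence φ).Realize p ↔ N ⊨ φ := by
  rw [trSentence, Formula.realize_relabel]
  have := h.realize_tr φ (fun x => isEmptyElim x) (fun x => isEmptyElim x)
    (fun x => isEmptyElim x)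
  refine Iff.trans (iff_of_eq (congrArg _ ?_)) (this.trans (iff_of_eq ?_))
  · funext x
    rcases x with x | x
    · rfl
    · exact isEmptyElim x.1
  · rw [Sentence.Realize, Formula.Realize]
    congr 1 <;> funext x <;> exact isEmptyElim x

theorem realize_identity (τ : Translation L L') {M : Type} [L'.Structure M]
    {i : Fin τ.numPieces} {v : Fin τ.numParams ⊕ (Fin (τ.dim i) ⊕ Fin (τ.dim i)) → M} :
    (τ.identity i i).Realize v ↔ ∀ k, v (.inr (.inl k)) = v (.inr (.inr k)) := by
  rw [identity, dif_pos rfl, Formula.realize_iInf]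
  exact forall_congr' fun k => Formula.realize_equal

/-- Translations commute with conjunction; no assumption on the structure is needed. -/
theorem realize_tr_inf (τ : Translation L L') {M : Type} [L'.Structure M] {α : Type} {n : ℕ}
    (φ ψ : L.BoundedFormula α n) (a : α ⊕ Fin n → Fin τ.numPieces)
    (v : Fin τ.numParams ⊕ τ.Vars a → M) :
    (τ.tr (φ ⊓ ψ) a).Realize v ↔ (τ.tr φ a).Realize v ∧ (τ.tr ψ a).Realize v := by
  have : τ.tr (φ ⊓ ψ) a = ((τ.tr φ a).imp ((τ.tr ψ a).imp ⊥)).imp ⊥ := rfl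
  rw [this]
  simp only [Formula.realize_imp, Formula.realize_bot]
  tauto

end Translation

/-! ### Arithmetical structures -/

section Operations

variable {M : Type} [arith.Structure M]

/-- The element of `M` denoted by `0`. -/
def zr (M : Type) [arith.Structure M] : M := Structure.funMap (L := arith) ArithFunc.zero ![]
/-- The successor operation of `M`. -/
def sc (x : M) : M := Structure.funMap (L := arith) ArithFunc.succ ![x]
/-- The addition of `M`. -/
def ad (x y : M) : M := Structure.funMap (L := arith) ArithFunc.add ![x, y]
/-- The multiplication of `M`. -/
def ml (x y : M) : M := Structure.funMap (L := arith) ArithFunc.mul ![x, y]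
/-- The relation of `M` denoted by `<`. -/
def Lt (x y : M) : Prop := Structure.RelMap (L := arith) ArithRel.lt ![x, y]
/-- The relation that the abbreviation `x ≤ y` stands for. -/
def Le (x y : M) : Prop := Lt x y ∨ x = y
theorem Le.refl (x : M) : Le x x := Or.inr rfl
/-- The element of `M` denoted by the numeral of a natural number. -/
def nm (M : Type) [arith.Structure M] : ℕ → M
  | 0 => zr M
  | k + 1 => sc (nm M k)

variable {α : Type} {n : ℕ}

@[simp] theorem realize_zeroT (v : α → M) : (zeroT : arith.Term α).realize v = zr M := by
  rw [zeroT, Term.realize_func, zr]; congr 1; exact Subsingleton.elim _ _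

@[simp] theorem realize_succT (t : arith.Term α) (v : α → M) :
    (succT t).realize v = sc (t.realize v) := by
  rw [succT, Term.realize_func, sc]; congr 1; funext i; fin_cases i; rfl

@[simp] theorem realize_addT (t s : arith.Term α) (v : α → M) :
    (addT t s).realize v = ad (t.realize v) (s.realize v) := by
  rw [addT, Term.realize_func, ad]; congr 1; funext i; fin_cases i <;> rfl

@[simp] theorem realize_mulT (t s : arith.Term α) (v : α → M) :
    (mulT t s).realize v = ml (t.realize v) (s.realize v) := by
  rw [mulT, Term.realize_func, ml]; congr 1; funext i; fin_cases i <;> rfl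

@[simp] theorem realize_num (k : ℕ) (v : α → M) : (num k : arith.Term α).realize v = nm M k := by
  induction k with
  | zero => simp [num, nm]
  | succ k ih => simp [num, nm, ih]

@[simp] theorem realize_ltF (t s : arith.Term (α ⊕ Fin n)) (v : α → M) (xs : Fin n → M) :
    (ltF t s).Realize v xs ↔ Lt (t.realize (Sum.elim v xs)) (s.realize (Sum.elim v xs)) := by
  change Structure.RelMap _ _ ↔ Structure.RelMap _ _
  refine iff_of_eq (congrArg _ ?_)
  funext i; fin_cases i <;> rfl

@[simp] theorem realize_leF (t s : arith.Term (α ⊕ Fin n)) (v : α → M) (xs : Fin n → M) :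
    (leF t s).Realize v xs ↔ Le (t.realize (Sum.elim v xs)) (s.realize (Sum.elim v xs)) := by
  rw [leF, BoundedFormula.realize_sup, realize_ltF, BoundedFormula.realize_bdEqual, Le]

@[simp] theorem realize_conj (l : List (arith.BoundedFormula α n)) (v : α → M) (xs : Fin n → M) :
    (conj l).Realize v xs ↔ ∀ φ ∈ l, φ.Realize v xs := by
  simp [conj]

@[simp] theorem realize_disj (l : List (arith.BoundedFormula α n)) (v : α → M) (xs : Fin n → M) :
    (disj l).Realize v xs ↔ ∃ φ ∈ l, φ.Realize v xs := by
  simp [disj]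

theorem nat_zr : zr ℕ = 0 := rfl
theorem nat_sc (x : ℕ) : sc x = x + 1 := rfl
theorem nat_ad (x y : ℕ) : ad x y = x + y := rfl
theorem nat_ml (x y : ℕ) : ml x y = x * y := rfl
theorem nat_Lt (x y : ℕ) : Lt x y ↔ x < y := Iff.rfl
theorem nat_Le (x y : ℕ) : Le x y ↔ x ≤ y := le_iff_lt_or_eq.symm

end Operations

/-- The arithmetical structure with the given operations and the given order. -/
abbrev mkStructure {M : Type} (z : M) (s : M → M) (a m : M → M → M) (r : M → M → Prop) :
    arith.Structure M where
  funMap f := match f with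
    | ArithFunc.zero => fun _ => z
    | ArithFunc.succ => fun x => s (x 0)
    | ArithFunc.add => fun x => a (x 0) (x 1)
    | ArithFunc.mul => fun x => m (x 0) (x 1)
  RelMap R := match R with
    | ArithRel.lt => fun x => r (x 0) (x 1)

/-! ### Cut structures -/

/-- The initial segment of `M` below `z`.  With operations cut off at `z` it is the structure that
`cutTr` defines in `M` for the parameter `z`. -/
@[ext]
structure Cut (M : Type) [arith.Structure M] (z : M) where
  val : M
  le : Le val z

section Cut

variable {M : Type} [arith.Structure M]

open Classical in
/-- The value `t`, cut off at `z`. -/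
noncomputable def cutAt (z t : M) : Cut M z := if h : Le t z then ⟨t, h⟩ else ⟨z, Le.refl z⟩

theorem cutAt_pos {z t : M} (h : Le t z) : cutAt z t = ⟨t, h⟩ := dif_pos h
theorem cutAt_neg {z t : M} (h : ¬ Le t z) : cutAt z t = ⟨z, Le.refl z⟩ := dif_neg h

@[simp] theorem cutAt_coe {z : M} (x : Cut M z) : cutAt z x.1 = x := cutAt_pos x.2

noncomputable instance (z : M) : arith.Structure (Cut M z) :=
  mkStructure (cutAt z (zr M)) (fun x => cutAt z (sc x.1)) (fun x y => cutAt z (ad x.1 y.1))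
    (fun x y => cutAt z (ml x.1 y.1)) (fun x y => Lt x.1 y.1)

theorem cut_zr (z : M) : zr (Cut M z) = cutAt z (zr M) := rfl
theorem cut_sc {z : M} (x : Cut M z) : sc x = cutAt z (sc x.1) := rfl
theorem cut_ad {z : M} (x y : Cut M z) : ad x y = cutAt z (ad x.1 y.1) := rfl
theorem cut_ml {z : M} (x y : Cut M z) : ml x y = cutAt z (ml x.1 y.1) := rfl
theorem cut_Lt {z : M} (x y : Cut M z) : Lt x y ↔ Lt x.1 y.1 := Iff.rfl

theorem cutAt_eq_iff {z t w : M} (hw : Le w z) :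
    cutAt z t = ⟨w, hw⟩ ↔ (Le t z ∧ w = t) ∨ (¬Le t z ∧ w = z) := by
  by_cases h : Le t z
  · rw [cutAt_pos h, Cut.mk.injEq]; simp [h, eq_comm]
  · rw [cutAt_neg h, Cut.mk.injEq]; simp [h, eq_comm]

theorem realize_cutoff {α : Type} (z w t : arith.Term (α ⊕ Fin 0)) (v : α → M) :
    (cutoff z w t).Realize v ↔
      (Le (t.realize (Sum.elim v default)) (z.realize (Sum.elim v default)) ∧
        w.realize (Sum.elim v default) = t.realize (Sum.elim v default)) ∨
      (¬Le (t.realize (Sum.elim v default)) (z.realize (Sum.elim v default)) ∧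
        w.realize (Sum.elim v default) = z.realize (Sum.elim v default)) := by
  rw [cutoff, Formula.realize_sup, Formula.realize_inf, Formula.realize_inf, Formula.realize_not]
  simp only [Formula.Realize, realize_leF, BoundedFormula.realize_bdEqual]

/-- The hypothesis is needed because the graph of `0` is translated by `w = 0`: without `0 ≤ z` the
symbol `0` would have no value in the domain. -/
theorem cutTr_represents {z : M} (h0 : Le (zr M) z) :
    cutTr.Represents (fun _ => z) (fun _ u => cutAt z (u 0)) where
  surj y := ⟨0, fun _ => y.1, by
    simpa [Formula.Realize, cutTr] using y.2, cutAt_coe y⟩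
  eq i j u v hu hv := by
    simp only [Formula.Realize, cutTr, realize_leF, Term.realize_var, Sum.elim_inl,
      Sum.elim_inr] at hu hv
    simp [Formula.Realize, cutTr, cutAt_pos hu, cutAt_pos hv]
  rel R c u hu := by
    cases R
    simp only [Formula.Realize, cutTr, realize_leF, Term.realize_var, Sum.elim_inl,
      Sum.elim_inr] at hu
    simp only [Formula.Realize, cutTr, realize_ltF, Term.realize_var, Sum.elim_inl,
      Sum.elim_inr, cutAt_pos (hu _)]
    rfl
  func f c b u w hu hw := by
    have hw' : Le (w 0) z := by simpa [Formula.Realize, cutTr] using hw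
    have hu' : ∀ k, Le (u k 0) z := fun k => by
      simpa [Formula.Realize, cutTr] using hu k
    have e : ∀ k, cutAt z (u k 0) = ⟨u k 0, hu' k⟩ := fun k => cutAt_pos (hu' k)
    cases f with
    | zero =>
      change (Term.bdEqual _ _).Realize _ _ ↔ zr (Cut M z) = _
      rw [cut_zr, cutAt_pos hw', cutAt_pos h0, Cut.mk.injEq, BoundedFormula.realize_bdEqual,
        realize_zeroT]
      exact eq_comm
    | succ =>
      change (cutoff _ _ _).Realize _ ↔ sc (cutAt z (u 0 0)) = _
      rw [realize_cutoff, e, cut_sc, cutAt_pos hw', cutAt_eq_iff]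
      simp
    | add =>
      change (cutoff _ _ _).Realize _ ↔ ad (cutAt z (u 0 0)) (cutAt z (u 1 0)) = _
      rw [realize_cutoff, e, e, cut_ad, cutAt_pos hw', cutAt_eq_iff]
      simp
    | mul =>
      change (cutoff _ _ _).Realize _ ↔ ml (cutAt z (u 0 0)) (cutAt z (u 1 0)) = _
      rw [realize_cutoff, e, e, cut_ml, cutAt_pos hw', cutAt_eq_iff]
      simp

theorem realize_satAt {z : M} (h0 : Le (zr M) z) (φ : arith.Sentence) :
    (satAt φ).Realize (fun _ => z) ↔ Cut M z ⊨ φ :=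
  (cutTr_represents h0).realize_trSentence φ

end Cut

/-! ### Models of `TN` -/

/-- `N` is a model of `TN`. -/
structure IsTN (N : Type) [arith.Structure N] : Prop where
  not_lt_zero : ∀ x : N, ¬Lt x (zr N)
  trans : ∀ x y z : N, Lt x y → Lt y z → Lt x z
  tri : ∀ x y : N, Lt x y ∨ x = y ∨ Lt y x
  pred : ∀ x : N, x = zr N ∨ ∃ y, x = sc y
  not_succ_lt : ∀ x : N, ¬Lt (sc x) x
  succ : ∀ x y : N, Lt x y → Lt x (sc x) ∧ ¬Lt y (sc x)
  add_zero : ∀ x : N, ad x (zr N) = x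
  add_succ : ∀ x y : N, ad x (sc y) = sc (ad x y)
  mul_zero : ∀ x : N, ml x (zr N) = zr N
  mul_succ : ∀ x y : N, ml x (sc y) = ad (ml x y) x

section Snoc

variable {N : Type}

theorem snoc1 (a : N) (xs : Fin 0 → N) : Fin.snoc (α := fun _ => N) xs a = ![a] := by
  funext i; fin_cases i; rfl
theorem snoc2 (a b : N) : Fin.snoc (α := fun _ => N) ![a] b = ![a, b] := by
  funext i; fin_cases i <;> rfl
theorem snoc3 (a b c : N) : Fin.snoc (α := fun _ => N) ![a, b] c = ![a, b, c] := by
  funext i; fin_cases i <;> rfl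

end Snoc

section Axioms

variable {N : Type} [arith.Structure N]

theorem realize_TN : N ⊨ TN ↔ IsTN N := by
  have : (N ⊨ TN) ↔ BoundedFormula.Realize TN (default : Empty → N) default := Iff.rfl
  rw [this, TN, realize_conj]
  simp only [List.forall_mem_cons, List.not_mem_nil, false_imp_iff, implies_true, and_true,
    BoundedFormula.realize_all, BoundedFormula.realize_not, BoundedFormula.realize_imp,
    BoundedFormula.realize_inf, BoundedFormula.realize_sup, BoundedFormula.realize_ex,
    BoundedFormula.realize_bdEqual, realize_ltF, realize_zeroT, realize_succT, realize_addT,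
    realize_mulT, Term.realize_var, Sum.elim_inr, snoc1, snoc2, snoc3, Function.comp]
  constructor
  · rintro ⟨h1, h2, h3, h4, h5, h6, h7, h8, h9, h10⟩
    exact ⟨h1, fun x y z a b => h2 x y z ⟨a, b⟩, h3, h4, h5, h6, h7, h8, h9, h10⟩
  · rintro ⟨h1, h2, h3, h4, h5, h6, h7, h8, h9, h10⟩
    exact ⟨h1, fun x y z a => h2 x y z a.1 a.2, h3, h4, h5, h6, h7, h8, h9, h10⟩

theorem realize_R : N ⊨ R ↔ (∀ m n, ad (nm N m) (nm N n) = nm N (m + n)) ∧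
    (∀ m n, ml (nm N m) (nm N n) = nm N (m * n)) ∧ (∀ m n, m ≠ n → nm N m ≠ nm N n) ∧
    (∀ n x, Lt x (nm N n) → ∃ i < n, x = nm N i) ∧
    (∀ n x, Lt x (nm N n) ∨ x = nm N n ∨ Lt (nm N n) x) := by
  have hs : ∀ φ : arith.Sentence, N ⊨ φ ↔ BoundedFormula.Realize φ (default : Empty → N) default :=
    fun _ => Iff.rfl
  rw [Theory.model_iff]
  constructor
  · intro h
    refine ⟨fun m n => ?_, fun m n => ?_, fun m n hmn => ?_, fun n x => ?_, fun n x => ?_⟩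
    · simpa [hs] using h _ (RAxiom.r1 m n)
    · simpa [hs] using h _ (RAxiom.r2 m n)
    · simpa [hs] using h _ (RAxiom.r3 m n hmn)
    · simpa [hs, snoc1] using (hs _).1 (h _ (RAxiom.r4 n)) x
    · have := (hs _).1 (h _ (RAxiom.r5 n)) x
      simpa [snoc1] using this
  · rintro ⟨h1, h2, h3, h4, h5⟩ φ hφ
    cases hφ with
    | r1 m n => simpa [hs] using h1 m n
    | r2 m n => simpa [hs] using h2 m n
    | r3 m n h => simpa [hs] using h3 m n h
    | r4 n =>
      rw [hs]; intro x
      simpa [snoc1] using h4 n x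
    | r5 n =>
      rw [hs]; intro x
      simpa [snoc1] using h5 n x

end Axioms

theorem cutNat_val {n : ℕ} (x : Cut ℕ n) : x.1 ≤ n := (nat_Le _ _).1 x.2

theorem cutNat_cutAt (n t : ℕ) : (cutAt n t).1 = min t n := by
  by_cases h : Le t n
  · rw [cutAt_pos h]; rw [nat_Le] at h; exact (min_eq_left h).symm
  · rw [cutAt_neg h]; rw [nat_Le] at h; change n = _; omega

/-- The finite initial segments of `ℕ`, with operations cut off at the largest element, are models
of `TN`. -/
theorem isTN_cutNat (n : ℕ) : IsTN (Cut ℕ n) := by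
  have hz : (zr (Cut ℕ n)).1 = 0 := by rw [cut_zr, cutNat_cutAt, nat_zr, Nat.zero_min]
  have hs : ∀ x : Cut ℕ n, (sc x).1 = min (x.1 + 1) n := fun x => by
    rw [cut_sc, cutNat_cutAt, nat_sc]
  have ha : ∀ x y : Cut ℕ n, (ad x y).1 = min (x.1 + y.1) n := fun x y => by
    rw [cut_ad, cutNat_cutAt, nat_ad]
  have hm : ∀ x y : Cut ℕ n, (ml x y).1 = min (x.1 * y.1) n := fun x y => by
    rw [cut_ml, cutNat_cutAt, nat_ml]
  constructor <;>
    simp only [cut_Lt, nat_Lt, Cut.ext_iff, hz, hs, ha, hm, Nat.mul_zero]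
  · omega
  · omega
  · omega
  · intro x
    rcases Nat.eq_zero_or_pos x.1 with h | h
    · exact Or.inl h
    · have := cutNat_val x
      refine Or.inr ⟨⟨x.1 - 1, (nat_Le _ _).2 (by omega)⟩, ?_⟩
      simp only; omega
  · intro x; have := cutNat_val x; omega
  · intro x y; have := cutNat_val y; omega
  · intro x; have := cutNat_val x; omega
  · intro x y; omega
  · omega
  · intro x y
    have hx := cutNat_val x
    have hy := cutNat_val y
    rcases Nat.lt_or_ge y.1 n with h | h
    · rw [Nat.min_eq_left (show y.1 + 1 ≤ n by omega), Nat.mul_add_one]; omega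
    · have : y.1 = n := by omega
      rw [this, Nat.min_eq_right (Nat.le_succ n)]
      rcases Nat.eq_zero_or_pos x.1 with h0 | h0
      · simp [h0]
      · have := Nat.le_mul_of_pos_left n h0
        omega

/-- Pure `Δ₀`-formulas are absolute between `ℕ` and its initial segment up to `n`, for arguments
below `n`. At `n` itself absoluteness fails, since the operations are cut off there. -/
theorem IsPureDelta0.realize_cutNat {n k : ℕ} {δ : arith.BoundedFormula Empty k}
    (hδ : IsPureDelta0 δ) (w : Fin k → Cut ℕ n) (hw : ∀ i, (w i).1 < n) :
    δ.Realize default w ↔ δ.Realize default fun i => (w i).1 := by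
  have hval : ∀ (c : ℕ) (w : ℕ), w < n → ((cutAt n c).1 = w ↔ c = w) := by
    intro c w h; rw [cutNat_cutAt]; omega
  have hsn : ∀ {k : ℕ} (w : Fin k → Cut ℕ n) (a : Cut ℕ n),
      (fun i => (Fin.snoc (α := fun _ => Cut ℕ n) w a i).1) =
        Fin.snoc (α := fun _ => ℕ) (fun i => (w i).1) a.1 := by
    intro k w a; funext i
    refine Fin.lastCases ?_ (fun i => ?_) i <;> simp
  have hlt : ∀ {k : ℕ} (w : Fin k → Cut ℕ n) (a : Cut ℕ n), (∀ i, (w i).1 < n) → a.1 < n →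
      ∀ i, (Fin.snoc (α := fun _ => Cut ℕ n) w a i).1 < n := by
    intro k w a h1 h2 i
    refine Fin.lastCases ?_ (fun i => ?_) i <;> simp [h1, h2]
  induction hδ with
  | falsum => rfl
  | verum => simp
  | lt u v => simp [cut_Lt]
  | zero u => simp [cut_zr, Cut.ext_iff, hval _ _ (hw u)]
  | succ u v => simp [cut_sc, Cut.ext_iff, hval _ _ (hw v)]
  | add u v x => simp [cut_ad, Cut.ext_iff, hval _ _ (hw x)]
  | mul u v x => simp [cut_ml, Cut.ext_iff, hval _ _ (hw x)]
  | not _ ih => simp [ih w hw]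
  | and _ _ ih1 ih2 => simp [ih1 w hw, ih2 w hw]
  | or _ _ ih1 ih2 => simp [ih1 w hw, ih2 w hw]
  | imp _ _ ih1 ih2 => simp [ih1 w hw, ih2 w hw]
  | allLt v _ ih =>
    simp only [BoundedFormula.realize_all, BoundedFormula.realize_imp, realize_ltF,
      Term.realize_var, Sum.elim_inr, Function.comp, Fin.snoc_last, Fin.snoc_castSucc, cut_Lt]
    constructor
    · intro H a ha
      have ha' : a < n := ha.trans (hw v)
      have := (ih _ (hlt w ⟨a, (nat_Le _ _).2 ha'.le⟩ hw ha')).1 (H ⟨a, _⟩ ha)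
      rwa [hsn] at this
    · intro H a ha
      refine (ih _ (hlt w a hw (lt_trans ha (hw v)))).2 ?_
      rw [hsn]; exact H _ ha
  | exLt v _ ih =>
    simp only [BoundedFormula.realize_ex, BoundedFormula.realize_inf, realize_ltF,
      Term.realize_var, Sum.elim_inr, Function.comp, Fin.snoc_last, Fin.snoc_castSucc, cut_Lt]
    constructor
    · rintro ⟨a, ha, H⟩
      refine ⟨a.1, ha, ?_⟩
      rw [← hsn]; exact (ih _ (hlt w a hw (lt_trans ha (hw v)))).1 H
    · rintro ⟨a, ha, H⟩
      have ha' : a < n := ha.trans (hw v)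
      refine ⟨⟨a, (nat_Le _ _).2 ha'.le⟩, ha, ?_⟩
      refine (ih _ (hlt w _ hw ha')).2 ?_
      rw [hsn]; exact H
  | allLe v _ ih =>
    simp only [BoundedFormula.realize_all, BoundedFormula.realize_imp, realize_leF,
      Term.realize_var, Sum.elim_inr, Function.comp, Fin.snoc_last, Fin.snoc_castSucc]
    have hle : ∀ a : Cut ℕ n, Le a (w v) ↔ Le a.1 (w v).1 := fun a => by
      simp only [Le, cut_Lt, Cut.ext_iff]
    simp only [hle, nat_Le]
    constructor
    · intro H a ha
      have ha' : a < n := ha.trans_lt (hw v)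
      have := (ih _ (hlt w ⟨a, (nat_Le _ _).2 ha'.le⟩ hw ha')).1 (H ⟨a, _⟩ ha)
      rwa [hsn] at this
    · intro H a ha
      refine (ih _ (hlt w a hw (lt_of_le_of_lt ha (hw v)))).2 ?_
      rw [hsn]; exact H _ ha
  | exLe v _ ih =>
    simp only [BoundedFormula.realize_ex, BoundedFormula.realize_inf, realize_leF,
      Term.realize_var, Sum.elim_inr, Function.comp, Fin.snoc_last, Fin.snoc_castSucc]
    have hle : ∀ a : Cut ℕ n, Le a (w v) ↔ Le a.1 (w v).1 := fun a => by
      simp only [Le, cut_Lt, Cut.ext_iff]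
    simp only [hle, nat_Le]
    constructor
    · rintro ⟨a, ha, H⟩
      refine ⟨a.1, ha, ?_⟩
      rw [← hsn]; exact (ih _ (hlt w a hw (lt_of_le_of_lt ha (hw v)))).1 H
    · rintro ⟨a, ha, H⟩
      have ha' : a < n := ha.trans_lt (hw v)
      refine ⟨⟨a, (nat_Le _ _).2 ha'.le⟩, ha, ?_⟩
      refine (ih _ (hlt w _ hw ha')).2 ?_
      rw [hsn]; exact H

/-- A structure that is enumerated, in its order, by `f 0, …, f n`, with operations cut off at
`f n`, is isomorphic to the initial segment of `ℕ` up to `n`. -/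
theorem exists_equiv_cutNat {N : Type} [arith.Structure N] (n : ℕ) (f : ℕ → N)
    (hsurj : ∀ y, ∃ i ≤ n, f i = y) (hlt : ∀ i ≤ n, ∀ j ≤ n, (Lt (f i) (f j) ↔ i < j))
    (hz : zr N = f 0) (hs : ∀ i ≤ n, sc (f i) = f (min (i + 1) n))
    (ha : ∀ i ≤ n, ∀ j ≤ n, ad (f i) (f j) = f (min (i + j) n))
    (hm : ∀ i ≤ n, ∀ j ≤ n, ml (f i) (f j) = f (min (i * j) n)) :
    ∃ e : arith.Equiv (Cut ℕ n) N, ∀ x, e x = f x.1 := by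
  have hinj : ∀ i ≤ n, ∀ j ≤ n, f i = f j → i = j := by
    intro i hi j hj h
    by_contra hne
    rcases Nat.lt_or_gt_of_ne hne with h' | h'
    · have := (hlt i hi j hj).2 h'
      rw [h] at this
      exact absurd ((hlt j hj j hj).1 this) (lt_irrefl _)
    · have := (hlt j hj i hi).2 h'
      rw [h] at this
      exact absurd ((hlt j hj j hj).1 this) (lt_irrefl _)
  let e0 : Cut ℕ n ≃ N := Equiv.ofBijective (fun x => f x.1)
    ⟨fun x y h => Cut.ext (hinj _ (cutNat_val x) _ (cutNat_val y) h), fun y => by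
      obtain ⟨i, hi, rfl⟩ := hsurj y
      exact ⟨⟨i, (nat_Le _ _).2 hi⟩, rfl⟩⟩
  refine ⟨⟨e0, ?_, ?_⟩, fun x => rfl⟩
  · intro k g x
    cases g with
    | zero =>
      change f (zr (Cut ℕ n)).1 = Structure.funMap (L := arith) ArithFunc.zero _
      rw [cut_zr, cutNat_cutAt, nat_zr, Nat.zero_min, ← hz, zr]
      congr 1; exact Subsingleton.elim _ _
    | succ =>
      change f (sc (x 0)).1 = Structure.funMap (L := arith) ArithFunc.succ _
      rw [cut_sc, cutNat_cutAt, nat_sc, ← hs _ (cutNat_val _), sc]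
      congr 1; funext i; fin_cases i; rfl
    | add =>
      change f (ad (x 0) (x 1)).1 = Structure.funMap (L := arith) ArithFunc.add _
      rw [cut_ad, cutNat_cutAt, nat_ad, ← ha _ (cutNat_val _) _ (cutNat_val _), ad]
      congr 1; funext i; fin_cases i <;> rfl
    | mul =>
      change f (ml (x 0) (x 1)).1 = Structure.funMap (L := arith) ArithFunc.mul _
      rw [cut_ml, cutNat_cutAt, nat_ml, ← hm _ (cutNat_val _) _ (cutNat_val _), ml]
      congr 1; funext i; fin_cases i <;> rfl
  · intro k r x
    cases r
    change Structure.RelMap (L := arith) ArithRel.lt _ ↔ (x 0).1 < (x 1).1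
    rw [← hlt _ (cutNat_val _) _ (cutNat_val _), Lt]
    refine iff_of_eq (congrArg _ ?_)
    funext i; fin_cases i <;> rfl

namespace IsTN

variable {N : Type} [arith.Structure N] (h : IsTN N)
include h

theorem irrefl (x : N) : ¬Lt x x := fun hx => (h.succ x x hx).2 (h.succ x x hx).1

theorem lt_nm {n : ℕ} (hn : ∀ i < n, Lt (nm N i) (nm N (i + 1))) {i j : ℕ} (hij : i < j)
    (hj : j ≤ n) : Lt (nm N i) (nm N j) := by
  induction j with
  | zero => omega
  | succ j ih =>
    rcases Nat.lt_or_ge i j with h' | h'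
    · exact h.trans _ _ _ (ih h' (by omega)) (hn j (by omega))
    · obtain rfl : i = j := by omega
      exact hn i (by omega)

/-- As long as the numerals increase strictly, there is nothing between them. -/
theorem exists_eq_nm {n : ℕ} (hn : ∀ i < n, Lt (nm N i) (nm N (i + 1))) {x : N}
    (hx : Lt x (nm N n)) : ∃ i < n, x = nm N i := by
  induction n with
  | zero => exact absurd hx (h.not_lt_zero x)
  | succ n ih =>
    rcases h.tri x (nm N n) with h' | h' | h'
    · obtain ⟨i, hi, e⟩ := ih (fun i hi => hn i (by omega)) h'
      exact ⟨i, by omega, e⟩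
    · exact ⟨n, by omega, h'⟩
    · exact absurd hx (h.succ _ _ h').2

theorem ad_nm (i j : ℕ) : ad (nm N i) (nm N j) = nm N (i + j) := by
  induction j with
  | zero => exact h.add_zero _
  | succ j ih =>
    rw [show nm N (j + 1) = sc (nm N j) from rfl, h.add_succ, ih]
    rfl

theorem ml_nm (i j : ℕ) : ml (nm N i) (nm N j) = nm N (i * j) := by
  induction j with
  | zero => exact h.mul_zero _
  | succ j ih =>
    rw [show nm N (j + 1) = sc (nm N j) from rfl, h.mul_succ, ih, h.ad_nm, Nat.mul_succ]

/-- A model of `TN` in which the numerals increase strictly up to `n` and no further is isomorphic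
to the initial segment of `ℕ` up to `n`. -/
theorem exists_equiv {n : ℕ} (hn : ∀ i < n, Lt (nm N i) (nm N (i + 1)))
    (htop : ¬Lt (nm N n) (nm N (n + 1))) :
    ∃ e : arith.Equiv (Cut ℕ n) N, ∀ x, e x = nm N x.1 := by
  have hmax : ∀ x, ¬Lt (nm N n) x := fun x hx => htop (h.succ _ _ hx).1
  have hfix : sc (nm N n) = nm N n := by
    rcases h.tri (sc (nm N n)) (nm N n) with h' | h' | h'
    · exact absurd h' (h.not_succ_lt _)
    · exact h'
    · exact absurd h' htop
  have hmin : ∀ k, nm N k = nm N (min k n) := by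
    intro k
    rcases le_total k n with h' | h'
    · rw [min_eq_left h']
    · rw [min_eq_right h']
      induction k, h' using Nat.le_induction with
      | base => rfl
      | succ k _ ih => change sc (nm N k) = _; rw [ih, hfix]
  refine exists_equiv_cutNat n (nm N) ?_ ?_ rfl ?_ ?_ ?_
  · intro y
    rcases h.tri y (nm N n) with h' | h' | h'
    · obtain ⟨i, hi, e⟩ := h.exists_eq_nm hn h'
      exact ⟨i, hi.le, e.symm⟩
    · exact ⟨n, le_rfl, h'.symm⟩
    · exact absurd h' (hmax _)
  · intro i hi j hj
    refine ⟨fun hl => ?_, fun hl => h.lt_nm hn hl hj⟩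
    by_contra hc
    rcases Nat.lt_or_ge j i with h' | h'
    · exact h.irrefl _ (h.trans _ _ _ hl (h.lt_nm hn h' hi))
    · obtain rfl : i = j := by omega
      exact h.irrefl _ hl
  · intro i _
    exact hmin (i + 1)
  · intro i _ j _
    rw [h.ad_nm]; exact hmin _
  · intro i _ j _
    rw [h.ml_nm]; exact hmin _

end IsTN

/-! ### Models of `R` -/

/-- `M` is a model of `R`. -/
structure IsR (M : Type) [arith.Structure M] : Prop where
  add : ∀ m n, ad (nm M m) (nm M n) = nm M (m + n)
  mul : ∀ m n, ml (nm M m) (nm M n) = nm M (m * n)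
  ne : ∀ m n, m ≠ n → nm M m ≠ nm M n
  lt : ∀ n x, Lt x (nm M n) → ∃ i < n, x = nm M i
  tri : ∀ n x, Lt x (nm M n) ∨ x = nm M n ∨ Lt (nm M n) x

section
variable {M : Type} [arith.Structure M]

theorem isR_iff : M ⊨ R ↔ IsR M :=
  realize_R.trans ⟨fun ⟨a, b, c, d, e⟩ => ⟨a, b, c, d, e⟩, fun ⟨a, b, c, d, e⟩ => ⟨a, b, c, d, e⟩⟩

namespace IsR
variable (h : IsR M)
include h

theorem inj {i j : ℕ} (e : nm M i = nm M j) : i = j := by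
  by_contra hne; exact h.ne i j hne e

theorem lt_iff {i j : ℕ} : Lt (nm M i) (nm M j) ↔ i < j := by
  constructor
  · intro hl
    obtain ⟨k, hk, e⟩ := h.lt j _ hl
    rwa [h.inj e]
  · intro hij
    rcases h.tri j (nm M i) with h' | h' | h'
    · exact h'
    · exact absurd (h.inj h') hij.ne
    · obtain ⟨k, hk, e⟩ := h.lt i _ h'
      have := h.inj e
      omega

theorem le_iff {i j : ℕ} : Le (nm M i) (nm M j) ↔ i ≤ j := by
  rw [Le, h.lt_iff, Nat.le_iff_lt_or_eq]
  exact or_congr_right ⟨h.inj, fun e => by rw [e]⟩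

theorem nm_lt_of_lt {i n : ℕ} {x : M} (hin : i ≤ n) (hx : Lt (nm M n) x) : Lt (nm M i) x := by
  rcases h.tri i x with h' | h' | h'
  · obtain ⟨k, hk, rfl⟩ := h.lt i _ h'
    have := h.lt_iff.1 hx
    omega
  · subst h'
    have := h.lt_iff.1 hx
    omega
  · exact h'

/-- In a model of `R` the initial segment below a numeral is standard. -/
theorem exists_equiv (n : ℕ) :
    ∃ e : arith.Equiv (Cut ℕ n) (Cut M (nm M n)), ∀ x, (e x).1 = nm M x.1 := by
  have hc : ∀ i, cutAt (nm M n) (nm M i) = cutAt (nm M n) (nm M (min i n)) := by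
    intro i
    rcases le_total i n with h' | h'
    · rw [min_eq_left h']
    · rw [min_eq_right h', cutAt_pos (Le.refl _)]
      rcases h'.eq_or_lt with rfl | h''
      · rw [cutAt_pos (Le.refl _)]
      · rw [cutAt_neg]; rw [h.le_iff]; omega
  have hv : ∀ i ≤ n, (cutAt (nm M n) (nm M i)).1 = nm M i := fun i hi => by
    rw [cutAt_pos (h.le_iff.2 hi)]
  suffices H : ∃ e : arith.Equiv (Cut ℕ n) (Cut M (nm M n)),
      ∀ x, e x = cutAt (nm M n) (nm M x.1) by
    obtain ⟨e, he⟩ := H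
    exact ⟨e, fun x => by rw [he, hv _ (cutNat_val x)]⟩
  refine exists_equiv_cutNat n (fun i => cutAt (nm M n) (nm M i)) ?_ ?_ rfl ?_ ?_ ?_
  · rintro ⟨y, hy⟩
    have : ∃ i ≤ n, y = nm M i := by
      rcases hy with hy | hy
      · obtain ⟨i, hi, e⟩ := h.lt n _ hy
        exact ⟨i, hi.le, e⟩
      · exact ⟨n, le_rfl, hy⟩
    obtain ⟨i, hi, rfl⟩ := this
    exact ⟨i, hi, cutAt_pos hy⟩
  · intro i hi j hj
    simp only [cut_Lt]
    rw [hv i hi, hv j hj, h.lt_iff]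
  · intro i hi
    simp only [cut_sc]
    rw [hv i hi]; exact hc (i + 1)
  · intro i hi j hj
    simp only [cut_ad]
    rw [hv i hi, hv j hj, h.add]; exact hc _
  · intro i hi j hj
    simp only [cut_ml]
    rw [hv i hi, hv j hj, h.mul]; exact hc _

end IsR

/-! ### The sentences `σ^q` in a structure -/

/-- The translation of an equation in which `0` occurs asserts that `0` has a value in the domain.
-/
theorem le_zero_of_realize_tr {n : ℕ} {t s : arith.Term (Empty ⊕ Fin n)}
    {a : Empty ⊕ Fin n → Fin cutTr.numPieces} {v : Fin cutTr.numParams ⊕ cutTr.Vars a → M}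
    (h : (cutTr.tr (addT t zeroT =' s) a).Realize v) : Le (zr M) (v (.inl 0)) := by
  replace h : (cutTr.trAtom a ![addT t zeroT, s] fun c => (cutTr.eq (c 0) (c 1)).relabel
    (Sum.map id (Sum.elim (Sigma.mk 0) (Sigma.mk 1)))).Realize v := h
  rw [Translation.trAtom, Formula.realize_iSup] at h
  obtain ⟨c, h⟩ := h
  rw [Formula.realize_iExs] at h
  obtain ⟨w, h⟩ := h
  rw [Formula.realize_inf, Formula.realize_iInf] at h
  have h := (Formula.realize_inf.1 (h.1 0)).2
  rw [Formula.realize_relabel] at h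
  change (cutTr.trTerm a (addT t zeroT) (c 0)).Realize _ at h
  rw [addT, Translation.trTerm, Formula.realize_iSup] at h
  obtain ⟨c', h⟩ := h
  rw [Formula.realize_iExs] at h
  obtain ⟨w', h⟩ := h
  rw [Formula.realize_inf, Formula.realize_iInf] at h
  obtain ⟨hd, h⟩ := Formula.realize_inf.1 (h.1 1)
  rw [Formula.realize_relabel] at h hd
  change (cutTr.trTerm a zeroT (c' 1)).Realize _ at h
  rw [zeroT, Translation.trTerm, Formula.realize_iSup] at h
  obtain ⟨c'', h⟩ := h
  rw [Formula.realize_iExs] at h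
  obtain ⟨w'', h⟩ := h
  rw [Formula.realize_inf, Formula.realize_relabel] at h
  replace h := h.2
  change _ = _ at h
  simp at h
  simp [Formula.Realize] at hd
  rw [h] at hd
  exact hd

/-- The axiom `x + 0 = x` of `TN`, read with unravelled terms, forces `0 ≤ z`. -/
theorem le_zero_of_satAt_TN {z : M} (h : (satAt TN).Realize fun _ => z) : Le (zr M) z := by
  rw [satAt, Translation.trSentence, Formula.realize_relabel, TN, conj] at h
  simp only [List.foldr_cons, List.foldr_nil] at h
  iterate 6 replace h := ((Translation.realize_tr_inf cutTr _ _ _ _).1 h).2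
  replace h := ((Translation.realize_tr_inf cutTr _ _ _ _).1 h).1
  replace h := Formula.realize_iAlls.1 (Formula.realize_iInf.1 h 0) fun _ => z
  rw [Formula.realize_imp, Formula.realize_relabel, Formula.realize_relabel] at h
  exact le_zero_of_realize_tr (h (by simp [Formula.Realize, Le.refl]))

theorem realize_satAt_TN {z : M} :
    ((satAt TN).Realize fun _ => z) ↔ Le (zr M) z ∧ IsTN (Cut M z) := by
  constructor
  · intro h
    have h0 := le_zero_of_satAt_TN h
    exact ⟨h0, realize_TN.1 ((realize_satAt h0 _).1 h)⟩
  · rintro ⟨h0, h⟩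
    exact (realize_satAt h0 _).2 (realize_TN.2 h)

/-- The element `z` witnesses the sentence `sigmaQ δ`. -/
def IsGood {n : ℕ} (δ : arith.BoundedFormula Empty n) (z : M) : Prop :=
  Le (zr M) z ∧ IsTN (Cut M z) ∧
    ∃ xs : Fin n → Cut M z, δ.Realize default xs ∧ ∀ i, sc (xs i) ≠ xs i

/-- The formula that defines `IsGood δ`; `sigmaQ δ` is its existential closure. -/
noncomputable def goodF {n : ℕ} (δ : arith.BoundedFormula Empty n) : arith.Formula (Fin 1) :=
  satAt (TN ⊓ (δ ⊓ conj ((List.finRange n).map fun i => ∼(succT (&i) =' &i))).exs)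

theorem realize_goodF {n : ℕ} (δ : arith.BoundedFormula Empty n) (z : M) :
    ((goodF δ).Realize fun _ => z) ↔ IsGood δ z := by
  have h1 : ∀ χ, ((satAt (TN ⊓ χ)).Realize fun _ => z) ↔
      ((satAt TN).Realize fun _ => z) ∧ (satAt χ).Realize fun _ => z := by
    intro χ
    simp only [satAt, Translation.trSentence, Formula.realize_relabel]
    exact Translation.realize_tr_inf cutTr TN χ _ _
  rw [goodF, h1, realize_satAt_TN, IsGood, and_assoc]
  refine and_congr_right fun h0 => and_congr_right fun _ => ?_
  rw [realize_satAt h0, Sentence.Realize, BoundedFormula.realize_exs]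
  refine exists_congr fun xs => ?_
  simp

theorem realize_sigmaQ {n : ℕ} (δ : arith.BoundedFormula Empty n) :
    M ⊨ sigmaQ δ ↔ ∃ z : M, IsGood δ z := by
  rw [sigmaQ, Sentence.Realize, Formula.realize_iExs]
  simp only [Formula.realize_relabel]
  constructor
  · rintro ⟨v, h⟩
    refine ⟨v 0, (realize_goodF δ _).1 ?_⟩
    have e : (fun _ => v 0) = Sum.elim (default : Empty → M) v ∘ Sum.inr := by
      funext i; fin_cases i; rfl
    rw [e]
    exact h
  · rintro ⟨z, h⟩
    exact ⟨fun _ => z, (realize_goodF δ z).2 h⟩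

/-- A witness `z` of a false `σ^q` lies above all numerals.  Otherwise `z` would cut off a finite
structure, isomorphic to an initial segment of `ℕ`; there the conditions `S xᵢ ≠ xᵢ` keep the
witnesses for `δ` away from the largest element, so that they are witnesses in `ℕ`. -/
theorem IsGood.lt_nm {n : ℕ} {δ : arith.BoundedFormula Empty n} (hδ : IsPureDelta0 δ)
    (hf : ¬ Sentence.Realize ℕ δ.exs) {z : M} (h : IsGood δ z) (i : ℕ) :
    Lt (nm (Cut M z) i) (nm (Cut M z) (i + 1)) := by
  classical
  obtain ⟨-, hT, xs, hxs, hne⟩ := h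
  by_contra hc
  have hex : ∃ i, ¬Lt (nm (Cut M z) i) (nm (Cut M z) (i + 1)) := ⟨i, hc⟩
  obtain ⟨e, he⟩ := hT.exists_equiv (n := Nat.find hex)
    (fun j hj => not_not.1 (Nat.find_min hex hj)) (Nat.find_spec hex)
  -- The cut structure is the segment of `ℕ` up to the first `n` at which the
  -- numerals stop increasing; its largest element is its own successor, hence
  -- none of the `xs i`.
  have hlt : ∀ i, (e.symm (xs i)).1 < Nat.find hex := by
    intro i
    refine lt_of_le_of_ne (cutNat_val _) fun heq => hne i ?_
    obtain ⟨y, hy⟩ : ∃ y, y = e.symm (xs i) := ⟨_, rfl⟩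
    have hey : e y = xs i := by rw [hy]; exact e.toEquiv.apply_symm_apply _
    rw [← hy] at heq
    rw [he, heq] at hey
    rw [← hey]
    rcases hT.tri (sc (nm (Cut M z) (Nat.find hex))) (nm _ (Nat.find hex)) with h' | h' | h'
    · exact absurd h' (hT.not_succ_lt _)
    · exact h'
    · exact absurd h' (Nat.find_spec hex)
  apply hf
  rw [Sentence.Realize, BoundedFormula.realize_exs]
  refine ⟨fun i => (e.symm (xs i)).1, ?_⟩
  have := (hδ.realize_cutNat (fun i => e.symm (xs i)) hlt).1 ?_
  · convert this using 1
  · rw [← StrongHomClass.realize_boundedFormula e.symm δ] at hxs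
    obtain e1 : (e.symm ∘ default : Empty → Cut ℕ (Nat.find hex)) = default :=
      Subsingleton.elim _ _
    rw [e1] at hxs
    exact hxs

end

/-! ### Translations that only change the order -/

/-- The data of `relTr ψ`, apart from identity. -/
noncomputable def relTrBase (ψ : arith.Formula (Fin 2)) : Translation arith arith where
  numParams := 0
  paramDom := ⊤
  numPieces := 1
  dim _ := 1
  dom _ := ⊤
  eq _ _ := ⊤
  rel r _ := match r with
    | ArithRel.lt => ψ.relabel fun i => .inr ⟨i, 0⟩
  func f _ _ := Term.equal (.func f fun k => .var (.inr (.inl ⟨k, 0⟩))) (.var (.inr (.inr 0)))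

/-- The one-dimensional, unrelativised, parameter-free translation of arithmetic in itself that
translates `<` by `ψ` and all other symbols by themselves. -/
noncomputable def relTr (ψ : arith.Formula (Fin 2)) : Translation arith arith :=
  { relTrBase ψ with eq := (relTrBase ψ).identity }

/-- The translation `relTr ψ` uses no optional feature. -/
theorem relTr_admissible (ψ : arith.Formula (Fin 2)) (F : Features) : (relTr ψ).Admissible F :=
  ⟨fun _ _ => rfl, fun _ _ => rfl, fun _ => rfl, fun _ _ _ => rfl, fun _ => ⟨rfl, rfl⟩⟩

theorem relTr_represents (ψ : arith.Formula (Fin 2)) {M N : Type} [arith.Structure M]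
    [arith.Structure N] (e : M ≃ N)
    (hf : ∀ {n : ℕ} (f : arith.Functions n) (x : Fin n → M),
      e (Structure.funMap f x) = Structure.funMap f fun i => e (x i))
    (hr : ∀ x y : M, ψ.Realize ![x, y] ↔ Lt (e x) (e y)) (p : Fin 0 → M) :
    (relTr ψ).Represents p fun (_ : Fin 1) (u : Fin 1 → M) => e (u 0) where
  surj y := ⟨(0 : Fin 1), fun _ => e.symm y, Formula.realize_top.2 trivial, e.apply_symm_apply y⟩
  eq i j u v hu hv := by
    obtain rfl : i = j := Subsingleton.elim (α := Fin 1) i j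
    refine ((relTrBase ψ).realize_identity (i := i)).trans ?_
    rw [e.apply_eq_iff_eq]
    constructor
    · intro h
      exact h (0 : Fin 1)
    · intro h k
      obtain rfl : k = (0 : Fin 1) := Subsingleton.elim (α := Fin 1) _ _
      exact h
  rel R c u hu := by
    cases R
    refine Formula.realize_relabel.trans ?_
    have h2 : (fun k : Fin 2 => e (u k (0 : Fin 1))) =
        ![e (u 0 (0 : Fin 1)), e (u 1 (0 : Fin 1))] := by
      funext i; fin_cases i <;> rfl
    refine Iff.trans (iff_of_eq (congrArg _ ?_))
      ((hr (u 0 (0 : Fin 1)) (u 1 (0 : Fin 1))).trans (iff_of_eq (congrArg _ h2.symm)))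
    funext i; fin_cases i <;> rfl
  func f c b u w hu hw := by
    refine Formula.realize_equal.trans ?_
    rw [← hf]
    exact e.apply_eq_iff_eq.symm

theorem relTr_isInterpretation (ψ : arith.Formula (Fin 2)) (V U : arith.Theory)
    (h : ∀ (M : Type) [arith.Structure M] [Nonempty M], M ⊨ V →
      ∃ (N : Type) (_ : arith.Structure N) (e : M ≃ N), N ⊨ U ∧
        (∀ {n : ℕ} (f : arith.Functions n) (x : Fin n → M),
          e (Structure.funMap f x) = Structure.funMap f fun i => e (x i)) ∧
        ∀ x y : M, ψ.Realize ![x, y] ↔ Lt (e x) (e y)) :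
    (relTr ψ).IsInterpretation V U := by
  constructor
  · rw [Theory.models_sentence_iff]
    intro M
    rw [Sentence.Realize, Formula.realize_iExs]
    exact ⟨fun i : Fin 0 => i.elim0, Formula.realize_relabel.2 (Formula.realize_top.2 trivial)⟩
  · intro φ hφ
    rw [Theory.models_sentence_iff]
    intro M
    obtain ⟨N, _, e, hN, hf, hr⟩ := h M M.is_model
    rw [Sentence.Realize, Formula.realize_iAlls]
    intro p
    rw [Formula.realize_relabel, Formula.realize_imp]
    intro _
    have : Nonempty N := e.nonempty_congr.1 inferInstance
    have hφN : N ⊨ φ := hφ.realize_sentence N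
    have := ((relTr_represents ψ e hf hr p).realize_trSentence φ).2 hφN
    exact this

theorem interprets_self (F : Features) {V U : arith.Theory} (h : ∀ φ ∈ U, φ ∈ V) :
    Interprets F V U := by
  refine ⟨relTr (ltF (.var (.inl 0)) (.var (.inl 1))), relTr_admissible _ F,
    relTr_isInterpretation _ _ _ fun M _ _ hM => ⟨M, inferInstance, Equiv.refl M, ?_, ?_, ?_⟩⟩
  · exact Theory.model_iff _ |>.2 fun φ hφ => (Theory.model_iff _).1 hM φ (h φ hφ)
  · intro n f x; rfl
  · intro x y; simp [Formula.Realize]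

/-- The structure `M` with its order replaced by a given relation. -/
def WithLt (M : Type) (_ : M → M → Prop) : Type := M

instance (M : Type) [arith.Structure M] (r : M → M → Prop) : arith.Structure (WithLt M r) :=
  mkStructure (zr M) (sc (M := M)) (ad (M := M)) (ml (M := M)) r

/-! ### Interpreting `R` in a false `σ^q` -/

section

variable {M : Type} [arith.Structure M] {n : ℕ} {δ : arith.BoundedFormula Empty n}

/-- Below a witness of a false `σ^q` the numerals of the cut structure are the numerals of `M`,
and no cutting off takes place at them. -/
theorem IsGood.nm_val (hδ : IsPureDelta0 δ) (hf : ¬ Sentence.Realize ℕ δ.exs) {z : M}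
    (h : IsGood δ z) (i : ℕ) : (nm (Cut M z) i).1 = nm M i ∧ nm M i ≠ z := by
  have key : ∀ i, (nm (Cut M z) i).1 ≠ z := by
    intro i hi
    have hT := h.2.1
    have hl := h.lt_nm hδ hf i
    have hle := (nm (Cut M z) (i + 1)).2
    rw [cut_Lt, hi] at hl
    rcases hle with hle | hle
    · exact hT.irrefl _ (hT.trans ⟨z, Le.refl z⟩ (nm (Cut M z) (i + 1)) ⟨z, Le.refl z⟩ hl hle)
    · exact hT.irrefl (⟨z, Le.refl z⟩ : Cut M z) (show Lt z z by rw [hle] at hl; exact hl)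
  have : ∀ i, (nm (Cut M z) i).1 = nm M i := by
    intro i
    induction i with
    | zero => exact congrArg Cut.val (cutAt_pos h.1)
    | succ i ih =>
      have hk := key (i + 1)
      change (cutAt z (sc (nm (Cut M z) i).1)).1 = sc (nm M i)
      change (cutAt z (sc (nm (Cut M z) i).1)).1 ≠ z at hk
      rw [ih] at hk ⊢
      by_cases hle : Le (sc (nm M i)) z
      · rw [cutAt_pos hle]
      · rw [cutAt_neg hle] at hk
        exact absurd rfl hk
  exact ⟨this i, by rw [← this]; exact key i⟩

theorem IsGood.le_nm (hδ : IsPureDelta0 δ) (hf : ¬ Sentence.Realize ℕ δ.exs) {z : M}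
    (h : IsGood δ z) (i : ℕ) : Le (nm M i) z := by
  rw [← (h.nm_val hδ hf i).1]; exact (nm (Cut M z) i).2

theorem IsGood.lt_of_lt (hδ : IsPureDelta0 δ) (hf : ¬ Sentence.Realize ℕ δ.exs) {z : M}
    (h : IsGood δ z) {i j : ℕ} (hij : i < j) : Lt (nm M i) (nm M j) := by
  rw [← (h.nm_val hδ hf i).1, ← (h.nm_val hδ hf j).1]
  exact h.2.1.lt_nm (n := j) (fun i _ => h.lt_nm hδ hf i) hij le_rfl

/-- Every element below a witness and below a numeral is a numeral. -/
theorem IsGood.exists_nm (hδ : IsPureDelta0 δ) (hf : ¬ Sentence.Realize ℕ δ.exs) {z : M}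
    (h : IsGood δ z) {x : M} (hx : Le x z) {j : ℕ} (hj : Lt x (nm M j)) :
    ∃ i < j, x = nm M i := by
  obtain ⟨i, hi, e⟩ := h.2.1.exists_eq_nm (n := j) (x := ⟨x, hx⟩) (fun i _ => h.lt_nm hδ hf i)
    (by rw [cut_Lt, (h.nm_val hδ hf j).1]; exact hj)
  exact ⟨i, hi, by rw [← (h.nm_val hδ hf i).1, ← e]⟩

theorem cutAt_val_eq {z t : M} (h : (cutAt z t).1 ≠ z) : (cutAt z t).1 = t := by
  by_cases hle : Le t z
  · rw [cutAt_pos hle]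
  · rw [cutAt_neg hle] at h; exact absurd rfl h

/-- The order that satisfies the axioms of `R` in every model of a false `σ^q`: `x` is below `y`
if some witness `z` has `x < z`, and either `y` is outside the segment below `z` or `x < y` holds.
-/
def goodLt (δ : arith.BoundedFormula Empty n) (x y : M) : Prop :=
  ∃ z, IsGood δ z ∧ Le x z ∧ x ≠ z ∧ (Le y z → Lt x y)

/-- Only the order of a model of a false `σ^q` has to be changed to obtain a model of `R`: the
numerals lie in the segment below a witness, where sums and products of numerals are computed
correctly. -/
theorem isR_withLt (hδ : IsPureDelta0 δ) (hf : ¬ Sentence.Realize ℕ δ.exs)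
    (hz : ∃ z : M, IsGood δ z) : IsR (WithLt M (goodLt δ)) := by
  obtain ⟨z, h⟩ := hz
  have hnm : ∀ i, nm (WithLt M (goodLt δ)) i = nm M i := by
    intro i
    induction i with
    | zero => rfl
    | succ i ih =>
      change sc (M := M) (nm (WithLt M (goodLt δ)) i) = sc (nm M i)
      rw [ih]
  have hne : ∀ i j, i ≠ j → nm M i ≠ nm M j := by
    have : ∀ i j, i < j → nm M i ≠ nm M j := by
      intro i j hij e
      have hl := h.lt_of_lt hδ hf hij
      rw [e, ← (h.nm_val hδ hf j).1] at hl
      exact h.2.1.irrefl _ hl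
    intro i j hij
    rcases Nat.lt_or_gt_of_ne hij with h' | h'
    · exact this i j h'
    · exact (this j i h').symm
  have hlt : ∀ {i j}, i < j → goodLt δ (nm M i) (nm M j) := fun {i j} hij =>
    ⟨z, h, h.le_nm hδ hf i, (h.nm_val hδ hf i).2, fun _ => h.lt_of_lt hδ hf hij⟩
  constructor
  · intro i j
    rw [hnm, hnm, hnm]
    change ad (nm M i) (nm M j) = _
    have e := congrArg Cut.val (h.2.1.ad_nm i j)
    rw [cut_ad, (h.nm_val hδ hf i).1, (h.nm_val hδ hf j).1, (h.nm_val hδ hf _).1] at e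
    rw [← e]
    exact (cutAt_val_eq (by rw [e]; exact (h.nm_val hδ hf _).2)).symm
  · intro i j
    rw [hnm, hnm, hnm]
    change ml (nm M i) (nm M j) = _
    have e := congrArg Cut.val (h.2.1.ml_nm i j)
    rw [cut_ml, (h.nm_val hδ hf i).1, (h.nm_val hδ hf j).1, (h.nm_val hδ hf _).1] at e
    rw [← e]
    exact (cutAt_val_eq (by rw [e]; exact (h.nm_val hδ hf _).2)).symm
  · intro i j hij
    rw [hnm, hnm]
    exact hne i j hij
  · intro j x hx
    simp only [hnm] at hx ⊢
    obtain ⟨w, hw, hxw, -, himp⟩ : goodLt δ (M := M) x (nm M j) := hx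
    exact hw.exists_nm hδ hf hxw (himp (hw.le_nm hδ hf j))
  · intro j x
    rw [hnm]
    change goodLt δ (M := M) x (nm M j) ∨ (x : M) = nm M j ∨ goodLt δ (nm M j) (x : M)
    by_cases hx : ∃ i, (x : M) = nm M i
    · obtain ⟨i, rfl⟩ := hx
      rcases lt_trichotomy i j with h' | rfl | h'
      · exact Or.inl (hlt h')
      · exact Or.inr (Or.inl rfl)
      · exact Or.inr (Or.inr (hlt h'))
    · refine Or.inr (Or.inr ⟨z, h, h.le_nm hδ hf j, (h.nm_val hδ hf j).2, fun hxz => ?_⟩)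
      rcases h.2.1.tri (nm (Cut M z) j) ⟨x, hxz⟩ with h' | h' | h'
      · rw [cut_Lt, (h.nm_val hδ hf j).1] at h'; exact h'
      · exact absurd ⟨j, by rw [← (h.nm_val hδ hf j).1, h']⟩ hx
      · rw [cut_Lt, (h.nm_val hδ hf j).1] at h'
        obtain ⟨i, -, e⟩ := h.exists_nm hδ hf hxz h'
        exact absurd ⟨i, e⟩ hx

/-- The formula that defines `goodLt δ`. -/
noncomputable def goodLtF (δ : arith.BoundedFormula Empty n) : arith.Formula (Fin 2) :=
  Formula.iExs (Fin 1) ((goodF δ).relabel Sum.inr ⊓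
    (leF (.var (.inl (.inl 0))) (.var (.inl (.inr 0))) ⊓
    (∼(.var (.inl (.inl 0)) =' .var (.inl (.inr 0))) ⊓
    (leF (.var (.inl (.inl 1))) (.var (.inl (.inr 0))) ⟹
      ltF (.var (.inl (.inl 0))) (.var (.inl (.inl 1)))))))

theorem realize_goodLtF (δ : arith.BoundedFormula Empty n) (x y : M) :
    (goodLtF δ).Realize ![x, y] ↔ goodLt δ x y := by
  rw [goodLtF, Formula.realize_iExs, goodLt]
  have key : ∀ w : Fin 1 → M, ((goodF δ).relabel (Sum.inr : Fin 1 → Fin 2 ⊕ Fin 1)).Realize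
      (Sum.elim ![x, y] w) ↔ IsGood δ (w 0) := by
    intro w
    rw [Formula.realize_relabel, ← realize_goodF]
    refine iff_of_eq (congrArg _ ?_)
    funext i; fin_cases i; rfl
  simp only [Formula.realize_inf, key]
  constructor
  · rintro ⟨w, h1, h2⟩
    refine ⟨w 0, h1, ?_⟩
    simpa [Formula.Realize] using h2
  · rintro ⟨z, h1, h2⟩
    refine ⟨fun _ => z, h1, ?_⟩
    simpa [Formula.Realize] using h2

end

theorem interprets_R_of_mem_S (F : Features) {T : arith.Theory} (hT : T ∈ S) :
    Interprets F T R := by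
  obtain ⟨n, δ, hδ, hf, rfl, -⟩ := hT
  refine ⟨relTr (goodLtF δ), relTr_admissible _ F, relTr_isInterpretation _ _ _
    fun M _ _ hM => ⟨WithLt M (goodLt δ), inferInstance, Equiv.refl M, ?_, ?_, ?_⟩⟩
  · exact isR_iff.2 (isR_withLt hδ hf ((realize_sigmaQ δ).1 (Theory.model_singleton_iff.1 hM)))
  · intro n f x
    change Structure.funMap f x = @Structure.funMap arith (WithLt M (goodLt δ)) _ _ f x
    cases f with
    | zero => exact congrArg _ (Subsingleton.elim _ _)
    | succ => exact congrArg _ (by funext i; fin_cases i; rfl)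
    | add => exact congrArg _ (by funext i; fin_cases i <;> rfl)
    | mul => exact congrArg _ (by funext i; fin_cases i <;> rfl)
  · intro x y
    rw [realize_goodLtF]
    rfl

/-! ### `Σ₁`-definable relations -/

/-- The relation `P` on `ℕ` is defined by a pure `Δ₀`-formula. -/
def D0 {k : ℕ} (P : (Fin k → ℕ) → Prop) : Prop :=
  ∃ δ : arith.BoundedFormula Empty k, IsPureDelta0 δ ∧ ∀ v, δ.Realize default v ↔ P v

/-- The relation `P` on `ℕ` is the projection of a pure `Δ₀`-definable relation with one more
argument.  Further existential quantifiers are absorbed into that argument as bounded ones. -/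
def Sig {k : ℕ} (P : (Fin k → ℕ) → Prop) : Prop :=
  ∃ Q : (Fin k → ℕ) → ℕ → Prop,
    D0 (fun w : Fin (k + 1) → ℕ => Q (fun i => w i.castSucc) (w (Fin.last k))) ∧
      ∀ v, P v ↔ ∃ b, Q v b

/-- Pure `Δ₀`-formulas can be substituted into: the variables `&i` may be replaced by `&(g i)`.
The new bound variable is the last one, so `g` is extended by mapping the last variable to the
last one. -/
theorem IsPureDelta0.exists_rename {k : ℕ} {δ : arith.BoundedFormula Empty k}
    (hδ : IsPureDelta0 δ) {m : ℕ} (g : Fin k → Fin m) :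
    ∃ ε : arith.BoundedFormula Empty m, IsPureDelta0 ε ∧
      ∀ v : Fin m → ℕ, ε.Realize default v ↔ δ.Realize default fun i => v (g i) := by
  have hsn : ∀ {k m : ℕ} (g : Fin k → Fin m) (v : Fin m → ℕ) (a : ℕ),
      (fun i => Fin.snoc (α := fun _ => ℕ) v a
        (Fin.snoc (α := fun _ => Fin (m + 1)) (fun i => (g i).castSucc) (Fin.last m) i)) =
        Fin.snoc (α := fun _ => ℕ) (fun i => v (g i)) a := by
    intro k m g v a; funext i
    refine Fin.lastCases ?_ (fun i => ?_) i <;> simp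
  induction hδ generalizing m with
  | falsum => exact ⟨_, .falsum, fun v => Iff.rfl⟩
  | verum => exact ⟨_, .verum, fun v => by simp⟩
  | lt i j => exact ⟨_, .lt (g i) (g j), fun v => by simp⟩
  | zero i => exact ⟨_, .zero (g i), fun v => by simp⟩
  | succ i j => exact ⟨_, .succ (g i) (g j), fun v => by simp⟩
  | add i j l => exact ⟨_, .add (g i) (g j) (g l), fun v => by simp⟩
  | mul i j l => exact ⟨_, .mul (g i) (g j) (g l), fun v => by simp⟩
  | not _ ih =>
    obtain ⟨ε, h, he⟩ := ih g
    exact ⟨_, h.not, fun v => by simp [-Pi.default_def, he]⟩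
  | and _ _ ih1 ih2 =>
    obtain ⟨ε, h, he⟩ := ih1 g
    obtain ⟨ε', h', he'⟩ := ih2 g
    exact ⟨_, h.and h', fun v => by simp [-Pi.default_def, he, he']⟩
  | or _ _ ih1 ih2 =>
    obtain ⟨ε, h, he⟩ := ih1 g
    obtain ⟨ε', h', he'⟩ := ih2 g
    exact ⟨_, h.or h', fun v => by simp [-Pi.default_def, he, he']⟩
  | imp _ _ ih1 ih2 =>
    obtain ⟨ε, h, he⟩ := ih1 g
    obtain ⟨ε', h', he'⟩ := ih2 g
    exact ⟨_, h.imp h', fun v => by simp [-Pi.default_def, he, he']⟩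
  | allLt i _ ih =>
    obtain ⟨ε, h, he⟩ := ih (Fin.snoc (α := fun _ => Fin (m + 1)) (fun i => (g i).castSucc)
      (Fin.last m))
    exact ⟨_, h.allLt (g i), fun v => by simp [-Pi.default_def, he, hsn]⟩
  | exLt i _ ih =>
    obtain ⟨ε, h, he⟩ := ih (Fin.snoc (α := fun _ => Fin (m + 1)) (fun i => (g i).castSucc)
      (Fin.last m))
    exact ⟨_, h.exLt (g i), fun v => by simp [-Pi.default_def, he, hsn]⟩
  | allLe i _ ih =>
    obtain ⟨ε, h, he⟩ := ih (Fin.snoc (α := fun _ => Fin (m + 1)) (fun i => (g i).castSucc)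
      (Fin.last m))
    exact ⟨_, h.allLe (g i), fun v => by simp [-Pi.default_def, he, hsn]⟩
  | exLe i _ ih =>
    obtain ⟨ε, h, he⟩ := ih (Fin.snoc (α := fun _ => Fin (m + 1)) (fun i => (g i).castSucc)
      (Fin.last m))
    exact ⟨_, h.exLe (g i), fun v => by simp [-Pi.default_def, he, hsn]⟩

namespace D0

variable {k : ℕ}

theorem rename {P : (Fin k → ℕ) → Prop} (h : D0 P) {m : ℕ} (g : Fin k → Fin m) :
    D0 fun v : Fin m → ℕ => P fun i => v (g i) := by
  obtain ⟨δ, hδ, h⟩ := h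
  obtain ⟨ε, hε, h'⟩ := hδ.exists_rename g
  exact ⟨ε, hε, fun v => (h' v).trans (h _)⟩

theorem and {P Q : (Fin k → ℕ) → Prop} (hP : D0 P) (hQ : D0 Q) : D0 fun v => P v ∧ Q v := by
  obtain ⟨δ, hδ, h⟩ := hP
  obtain ⟨ε, hε, h'⟩ := hQ
  exact ⟨_, hδ.and hε, fun v => by simp [-Pi.default_def, h, h']⟩

theorem or {P Q : (Fin k → ℕ) → Prop} (hP : D0 P) (hQ : D0 Q) : D0 fun v => P v ∨ Q v := by
  obtain ⟨δ, hδ, h⟩ := hP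
  obtain ⟨ε, hε, h'⟩ := hQ
  exact ⟨_, hδ.or hε, fun v => by simp [-Pi.default_def, h, h']⟩

theorem exLe (i : Fin k) {P : (Fin k → ℕ) → ℕ → Prop}
    (h : D0 fun w : Fin (k + 1) → ℕ => P (fun i => w i.castSucc) (w (Fin.last k))) :
    D0 fun v => ∃ x ≤ v i, P v x := by
  obtain ⟨δ, hδ, h⟩ := h
  exact ⟨_, hδ.exLe i, fun v => by simp [-Pi.default_def, h, nat_Le]⟩

theorem allLt (i : Fin k) {P : (Fin k → ℕ) → ℕ → Prop}
    (h : D0 fun w : Fin (k + 1) → ℕ => P (fun i => w i.castSucc) (w (Fin.last k))) :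
    D0 fun v => ∀ x < v i, P v x := by
  obtain ⟨δ, hδ, h⟩ := h
  exact ⟨_, hδ.allLt i, fun v => by simp [-Pi.default_def, h, nat_Lt]⟩

end D0

namespace Sig

variable {k : ℕ}

theorem of_iff {P Q : (Fin k → ℕ) → Prop} (hP : Sig P) (h : ∀ v, Q v ↔ P v) : Sig Q := by
  obtain ⟨R, hR, e⟩ := hP
  exact ⟨R, hR, fun v => (h v).trans (e v)⟩

theorem of_D0 {P : (Fin k → ℕ) → Prop} (h : D0 P) : Sig P :=
  ⟨fun v _ => P v, h.rename Fin.castSucc, fun v => by simp⟩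

theorem rename {P : (Fin k → ℕ) → Prop} (h : Sig P) {m : ℕ} (g : Fin k → Fin m) :
    Sig fun v : Fin m → ℕ => P fun i => v (g i) := by
  obtain ⟨Q, hQ, e⟩ := h
  refine ⟨fun v b => Q (fun i => v (g i)) b, ?_, fun v => e _⟩
  have := hQ.rename (Fin.snoc (α := fun _ => Fin (m + 1)) (fun i => (g i).castSucc) (Fin.last m))
  simpa using this

theorem and {P Q : (Fin k → ℕ) → Prop} (hP : Sig P) (hQ : Sig Q) : Sig fun v => P v ∧ Q v := by
  obtain ⟨P', hP', eP⟩ := hP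
  obtain ⟨Q', hQ', eQ⟩ := hQ
  refine ⟨fun v b => (∃ c ≤ b, P' v c) ∧ ∃ c ≤ b, Q' v c, ?_, fun v => ?_⟩
  · have h1 := hP'.rename (m := k + 2)
      (Fin.snoc (α := fun _ => Fin (k + 2)) (fun i => i.castSucc.castSucc) (Fin.last _))
    have h2 := hQ'.rename (m := k + 2)
      (Fin.snoc (α := fun _ => Fin (k + 2)) (fun i => i.castSucc.castSucc) (Fin.last _))
    simp only [Fin.snoc_castSucc, Fin.snoc_last] at h1 h2
    exact (D0.exLe (Fin.last k) h1).and (D0.exLe (Fin.last k) h2)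
  · simp only [eP, eQ]
    constructor
    · rintro ⟨⟨a, ha⟩, ⟨b, hb⟩⟩
      exact ⟨max a b, ⟨a, le_max_left _ _, ha⟩, ⟨b, le_max_right _ _, hb⟩⟩
    · rintro ⟨_, ⟨a, _, ha⟩, ⟨b, _, hb⟩⟩
      exact ⟨⟨a, ha⟩, ⟨b, hb⟩⟩

theorem or {P Q : (Fin k → ℕ) → Prop} (hP : Sig P) (hQ : Sig Q) : Sig fun v => P v ∨ Q v := by
  obtain ⟨P', hP', eP⟩ := hP
  obtain ⟨Q', hQ', eQ⟩ := hQ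
  exact ⟨fun v b => P' v b ∨ Q' v b, hP'.or hQ', fun v => by simp only [eP, eQ, exists_or]⟩

/-- Both `x` and the witness for `P v x` are bounded by the one existential variable. -/
theorem ex {P : (Fin k → ℕ) → ℕ → Prop}
    (h : Sig fun w : Fin (k + 1) → ℕ => P (fun i => w i.castSucc) (w (Fin.last k))) :
    Sig fun v => ∃ x, P v x := by
  obtain ⟨Q, hQ, e⟩ := h
  refine ⟨fun v b => ∃ x ≤ b, ∃ c ≤ b, Q (Fin.snoc (α := fun _ => ℕ) v x) c, ?_, fun v => ?_⟩
  · have h1 := hQ.rename (m := k + 3) (Fin.snoc (α := fun _ => Fin (k + 3))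
      (Fin.snoc (α := fun _ => Fin (k + 3)) (fun i => i.castSucc.castSucc.castSucc)
        (Fin.last _).castSucc) (Fin.last _))
    simp only [Fin.snoc_castSucc, Fin.snoc_last] at h1
    have hs : ∀ w : Fin (k + 3) → ℕ, (fun i => w (Fin.snoc (α := fun _ => Fin (k + 3))
        (fun i => i.castSucc.castSucc.castSucc) (Fin.last _).castSucc i)) =
        Fin.snoc (α := fun _ => ℕ) (fun i => w (i.castSucc.castSucc.castSucc))
          (w (Fin.last _).castSucc) := by
      intro w; funext i
      refine Fin.lastCases ?_ (fun i => ?_) i <;> simp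
    simp only [hs] at h1
    exact D0.exLe (Fin.last k) (D0.exLe (Fin.last k).castSucc h1)
  · have : ∀ x, P v x ↔ ∃ c, Q (Fin.snoc (α := fun _ => ℕ) v x) c := by
      intro x; rw [← e]; simp
    simp only [this]
    constructor
    · rintro ⟨x, c, h⟩
      exact ⟨max x c, x, le_max_left _ _, c, le_max_right _ _, h⟩
    · rintro ⟨_, x, _, c, _, h⟩
      exact ⟨x, c, h⟩

/-- Collection: the witnesses for the finitely many `x < v j` have a common bound, so bounded
universal quantification does not lead out of `Sig`. -/
theorem ballLt (j : Fin k) {P : (Fin k → ℕ) → ℕ → Prop}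
    (h : Sig fun w : Fin (k + 1) → ℕ => P (fun i => w i.castSucc) (w (Fin.last k))) :
    Sig fun v => ∀ x < v j, P v x := by
  obtain ⟨Q, hQ, e⟩ := h
  refine ⟨fun v b => ∀ x < v j, ∃ c ≤ b, Q (Fin.snoc (α := fun _ => ℕ) v x) c, ?_, fun v => ?_⟩
  · have h1 := hQ.rename (m := k + 3) (Fin.snoc (α := fun _ => Fin (k + 3))
      (Fin.snoc (α := fun _ => Fin (k + 3)) (fun i => i.castSucc.castSucc.castSucc)
        (Fin.last _).castSucc) (Fin.last _))
    simp only [Fin.snoc_castSucc, Fin.snoc_last] at h1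
    have hs : ∀ w : Fin (k + 3) → ℕ, (fun i => w (Fin.snoc (α := fun _ => Fin (k + 3))
        (fun i => i.castSucc.castSucc.castSucc) (Fin.last _).castSucc i)) =
        Fin.snoc (α := fun _ => ℕ) (fun i => w (i.castSucc.castSucc.castSucc))
          (w (Fin.last _).castSucc) := by
      intro w; funext i
      refine Fin.lastCases ?_ (fun i => ?_) i <;> simp
    simp only [hs] at h1
    exact D0.allLt j.castSucc (D0.exLe (Fin.last k).castSucc h1)
  · have : ∀ x, P v x ↔ ∃ c, Q (Fin.snoc (α := fun _ => ℕ) v x) c := by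
      intro x; rw [← e]; simp
    simp only [this]
    constructor
    · intro H
      choose! c hc using H
      exact ⟨(Finset.range (v j)).sup c, fun x hx =>
        ⟨c x, Finset.le_sup (Finset.mem_range.2 hx), hc x hx⟩⟩
    · rintro ⟨b, H⟩ x hx
      obtain ⟨c, _, hc⟩ := H x hx
      exact ⟨c, hc⟩

theorem lt (a b : Fin k) : Sig fun v => v a < v b :=
  of_D0 ⟨_, .lt a b, fun v => by simp [nat_Lt]⟩

theorem not_lt (a b : Fin k) : Sig fun v => ¬v a < v b :=
  of_D0 ⟨_, (IsPureDelta0.lt a b).not, fun v => by simp [nat_Lt]⟩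

theorem zero (a : Fin k) : Sig fun v => 0 = v a :=
  of_D0 ⟨_, .zero a, fun v => by simp [nat_zr]⟩

theorem succ (a b : Fin k) : Sig fun v => v a + 1 = v b :=
  of_D0 ⟨_, .succ a b, fun v => by simp [nat_sc]⟩

theorem add (a b c : Fin k) : Sig fun v => v a + v b = v c :=
  of_D0 ⟨_, .add a b c, fun v => by simp [nat_ad]⟩

theorem mul (a b c : Fin k) : Sig fun v => v a * v b = v c :=
  of_D0 ⟨_, .mul a b c, fun v => by simp [nat_ml]⟩

/-- The graph of the pairing function. -/
theorem pair (a b c : Fin k) : Sig fun v => Nat.pair (v a) (v b) = v c := by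
  have h : Sig fun v : Fin k → ℕ =>
      (v a < v b ∧ ∃ s, v b * v b = s ∧ s + v a = v c) ∨
      (¬v a < v b ∧ ∃ s, v a * v a = s ∧ ∃ t, s + v a = t ∧ t + v b = v c) :=
    ((lt _ _).and (ex ((mul _ _ _).and (add _ _ _)))).or
      ((not_lt _ _).and (ex ((mul _ _ _).and (ex ((add _ _ _).and (add _ _ _))))))
  refine h.of_iff fun v => ?_
  rw [Nat.pair]
  split_ifs with h' <;> simp [h']

/-- The graph of the beta function. -/
theorem beta (p q i r : Fin k) : Sig fun v => Nat.beta (Nat.pair (v p) (v q)) (v i) = v r := by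
  have h : Sig fun v : Fin k → ℕ => ∃ j, v i + 1 = j ∧ ∃ t, j * v q = t ∧ ∃ m, t + 1 = m ∧
      v r < m ∧ ∃ s, ∃ u, s * m = u ∧ u + v r = v p :=
    ex ((succ _ _).and (ex ((mul _ _ _).and (ex ((succ _ _).and ((lt _ _).and
      (ex (ex ((mul _ _ _).and (add _ _ _))))))))))
  refine h.of_iff fun v => ?_
  simp only [Nat.beta, Nat.unpair_pair, exists_eq_left']
  constructor
  · intro e
    refine ⟨e ▸ Nat.mod_lt _ (Nat.succ_pos _), v p / ((v i + 1) * v q + 1), ?_⟩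
    rw [← e, mul_comm]; exact Nat.div_add_mod _ _
  · rintro ⟨hl, s, e⟩
    rw [← e, Nat.mul_add_mod_of_lt hl]

end Sig

/-! ### Recursively enumerable sets are `Σ₁`-definable -/

/-- A primitive recursion has the value `y` exactly when its course of values, coded by the beta
function, ends in `y`.  The intermediate values are named by variables so that the right-hand side
is built from the graphs in `Sig`. -/
theorem mem_rec_iff {f : Part ℕ} {g : ℕ → ℕ → Part ℕ} {n y : ℕ} :
    y ∈ (Nat.rec f (fun k IH => IH >>= g k) n : Part ℕ) ↔
      ∃ p q, (∃ o, 0 = o ∧ ∃ r, Nat.beta (Nat.pair p q) o = r ∧ r ∈ f) ∧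
        Nat.beta (Nat.pair p q) n = y ∧
        ∀ k < n, ∃ i, Nat.beta (Nat.pair p q) k = i ∧ ∃ k', k + 1 = k' ∧
          ∃ j, Nat.beta (Nat.pair p q) k' = j ∧ j ∈ g k i := by
  have h1 : y ∈ (Nat.rec f (fun k IH => IH >>= g k) n : Part ℕ) ↔
      ∃ s : ℕ → ℕ, s 0 ∈ f ∧ s n = y ∧ ∀ k < n, s (k + 1) ∈ g k (s k) := by
    induction n generalizing y with
    | zero =>
      exact ⟨fun h => ⟨fun _ => y, h, rfl, by simp⟩, fun ⟨s, h, e, _⟩ => e ▸ h⟩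
    | succ n ih =>
      simp only [Part.bind_eq_bind, Part.mem_bind_iff] at ih ⊢
      constructor
      · rintro ⟨a, ha, hy⟩
        obtain ⟨s, h0, rfl, hs⟩ := ih.1 ha
        refine ⟨fun k => if k = n + 1 then y else s k, by simpa using h0, by simp, fun k hk => ?_⟩
        rcases Nat.lt_succ_iff_lt_or_eq.1 hk with h | rfl
        · have e1 : k ≠ n := by omega
          have e2 : k ≠ n + 1 := by omega
          simpa [e1, e2] using hs k h
        · simpa using hy
      · rintro ⟨s, h0, rfl, hs⟩
        exact ⟨s n, ih.2 ⟨s, h0, rfl, fun k hk => hs k (by omega)⟩, hs n (by omega)⟩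
  rw [h1]
  simp only [exists_eq_left']
  constructor
  · rintro ⟨s, h0, rfl, hs⟩
    have hb : ∀ i ≤ n, Nat.beta (Nat.unbeta ((List.range (n + 1)).map s)) i = s i := by
      intro i hi
      have := Nat.beta_unbeta_coe ((List.range (n + 1)).map s) ⟨i, by simp; omega⟩
      simpa using this
    refine ⟨(Nat.unbeta ((List.range (n + 1)).map s)).unpair.1,
      (Nat.unbeta ((List.range (n + 1)).map s)).unpair.2, ?_⟩
    rw [Nat.pair_unpair]
    refine ⟨by rw [hb 0 (by omega)]; exact h0, hb n le_rfl, fun k hk => ?_⟩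
    rw [hb k (by omega), hb (k + 1) (by omega)]
    exact hs k hk
  · rintro ⟨p, q, h0, h2, h3⟩
    exact ⟨fun i => Nat.beta (Nat.pair p q) i, h0, h2, h3⟩

/-- The graph of a partial recursive function is `Σ₁`. -/
theorem sig_of_partrec {f : ℕ →. ℕ} (hf : Nat.Partrec f) :
    Sig fun v : Fin 2 → ℕ => v 1 ∈ f (v 0) := by
  have app : ∀ {f : ℕ →. ℕ}, (Sig fun v : Fin 2 → ℕ => v 1 ∈ f (v 0)) →
      ∀ {k : ℕ} (i j : Fin k), Sig fun v : Fin k → ℕ => v j ∈ f (v i) :=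
    fun h k i j => h.rename ![i, j]
  induction hf with
  | zero => exact (Sig.zero 1).of_iff fun v => by simp [pure, PFun.pure, eq_comm]
  | succ => exact (Sig.succ 0 1).of_iff fun v => by simp [eq_comm]
  | left =>
    have h : Sig fun v : Fin 2 → ℕ => ∃ b, Nat.pair (v 1) b = v 0 := .ex (.pair _ _ _)
    refine h.of_iff fun v => ?_
    constructor
    · intro h
      have h : v 1 = (v 0).unpair.1 := by simpa using h
      exact ⟨(v 0).unpair.2, by rw [h, Nat.pair_unpair]⟩
    · rintro ⟨b, h⟩
      rw [← h]; simp
  | right =>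
    have h : Sig fun v : Fin 2 → ℕ => ∃ b, Nat.pair b (v 1) = v 0 := .ex (.pair _ _ _)
    refine h.of_iff fun v => ?_
    constructor
    · intro h
      have h : v 1 = (v 0).unpair.2 := by simpa using h
      exact ⟨(v 0).unpair.1, by rw [h, Nat.pair_unpair]⟩
    · rintro ⟨b, h⟩
      rw [← h]; simp
  | @pair f g _ _ ihf ihg =>
    have h : Sig fun v : Fin 2 → ℕ => ∃ a, a ∈ f (v 0) ∧ ∃ b, b ∈ g (v 0) ∧ Nat.pair a b = v 1 :=
      .ex ((app ihf _ _).and (.ex ((app ihg _ _).and (.pair _ _ _))))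
    refine h.of_iff fun v => ?_
    simp [Seq.seq]
  | @comp f g _ _ ihf ihg =>
    have h : Sig fun v : Fin 2 → ℕ => ∃ a, a ∈ g (v 0) ∧ v 1 ∈ f a :=
      .ex ((app ihg _ _).and (app ihf _ _))
    exact h.of_iff fun v => Part.mem_bind_iff
  | @prec f g _ _ ihf ihg =>
    have h : Sig fun v : Fin 2 → ℕ => ∃ a n, Nat.pair a n = v 0 ∧ ∃ p q,
        (∃ o, 0 = o ∧ ∃ r, Nat.beta (Nat.pair p q) o = r ∧ r ∈ f a) ∧
        Nat.beta (Nat.pair p q) n = v 1 ∧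
        ∀ k < n, ∃ i, Nat.beta (Nat.pair p q) k = i ∧ ∃ k', k + 1 = k' ∧
          ∃ j, Nat.beta (Nat.pair p q) k' = j ∧
            ∃ s, Nat.pair k i = s ∧ ∃ t, Nat.pair a s = t ∧ j ∈ g t :=
      .ex (.ex ((Sig.pair _ _ _).and (.ex (.ex ((Sig.ex ((Sig.zero _).and
        (.ex ((Sig.beta _ _ _ _).and (app ihf _ _))))).and ((Sig.beta _ _ _ _).and
        (Sig.ballLt _ (.ex ((Sig.beta _ _ _ _).and (.ex ((Sig.succ _ _).and
          (.ex ((Sig.beta _ _ _ _).and (.ex ((Sig.pair _ _ _).and (.ex ((Sig.pair _ _ _).and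
            (app ihg _ _))))))))))))))))))
    refine h.of_iff fun v => ?_
    have := mem_rec_iff (f := f (v 0).unpair.1) (n := (v 0).unpair.2) (y := v 1)
      (g := fun k i => g (Nat.pair (v 0).unpair.1 (Nat.pair k i)))
    refine this.trans ?_
    simp only [exists_eq_left']
    constructor
    · intro h
      exact ⟨_, _, Nat.pair_unpair _, h⟩
    · rintro ⟨a, n, e, h⟩
      rw [← e]
      simpa using h
  | @rfind f _ ihf =>
    have h : Sig fun v : Fin 2 → ℕ =>
        (∃ s, Nat.pair (v 0) (v 1) = s ∧ ∃ o, 0 = o ∧ o ∈ f s) ∧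
        ∀ m < v 1, ∃ s, Nat.pair (v 0) m = s ∧ ∃ y, y ∈ f s ∧ ∃ y', y' + 1 = y :=
      (Sig.ex ((Sig.pair _ _ _).and (.ex ((Sig.zero _).and (app ihf _ _))))).and
        (Sig.ballLt _ (.ex ((Sig.pair _ _ _).and (.ex ((app ihf _ _).and (.ex (.succ _ _)))))))
    refine h.of_iff fun v => ?_
    refine Nat.mem_rfind.trans ?_
    simp only [exists_eq_left']
    refine and_congr ?_ (forall_congr' fun m => forall_congr' fun _ => ?_)
    · simp
    · simp only [Part.map_eq_map, Part.mem_map_iff]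
      refine exists_congr fun y => and_congr_right fun _ => ?_
      cases y <;> simp

/-- Every recursively enumerable set of natural numbers is defined by a pure `Σ₁`-formula. -/
theorem exists_delta0_of_re {A : ℕ → Prop} (hA : REPred A) :
    ∃ δ : arith.BoundedFormula Empty 2, IsPureDelta0 δ ∧
      ∀ n, A n ↔ ∃ b : ℕ, δ.Realize default ![n, b] := by
  let f : ℕ →. ℕ := fun n => (Part.assert (A n) fun _ => Part.some ()).map fun _ => 0
  have hf : Nat.Partrec f := Partrec.nat_iff.1 (Partrec.map hA (Computable.const 0).to₂)
  have h : Sig fun v : Fin 1 → ℕ => ∃ y, y ∈ f (v 0) :=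
    .ex ((sig_of_partrec hf).rename ![(0 : Fin 1).castSucc, Fin.last 1])
  obtain ⟨Q, ⟨δ, hδ, hQ⟩, e⟩ := h
  refine ⟨δ, hδ, fun n => ?_⟩
  have := e ![n]
  have h2 : A n ↔ ∃ b, Q ![n] b := by
    rw [← this]; simp [f]
  rw [h2]
  refine exists_congr fun b => ?_
  rw [hQ]
  refine iff_of_eq ?_
  congr 1
  funext i; fin_cases i; rfl

/-! ### Unsatisfiability of clause sets -/

theorem rePred_exists {α : Type} [Primcodable α] {W : α → ℕ → Prop} (hW : PrimrecRel W) :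
    REPred fun a => ∃ N, W a N := by
  obtain ⟨hd, h⟩ := hW
  have hc : Computable₂ fun a N => @decide (W a N) (hd (a, N)) := h.to_comp
  refine (Partrec.dom_re (Partrec.rfind hc.partrec₂)).of_eq fun a => ?_
  rw [Nat.rfind_dom]
  simp

theorem exists_bound {X : Type} (f : X → ℕ) (L : List X) : ∃ B, ∀ l ∈ L, f l < B := by
  induction L with
  | nil => exact ⟨0, by simp⟩
  | cons a L ih =>
    obtain ⟨B, hB⟩ := ih
    refine ⟨max B (f a + 1), fun l hl => ?_⟩
    rcases List.mem_cons.1 hl with rfl | hl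
    · exact lt_max_of_lt_right (Nat.lt_succ_self _)
    · exact lt_max_of_lt_left (hB l hl)

section

variable {X : Type} [Primcodable X]

/-- Propositional compactness, effectively: it is recursively enumerable in `n` that a set of
clauses `C n`, listed in blocks `C n p`, is unsatisfiable. A literal is an atom with the truth
value that makes it true. The set is unsatisfiable exactly when, for some `N`, each of the `2 ^ N`
valuations of the atoms with codes below `N` refutes a clause in one of the first `N` blocks. -/
theorem rePred_unsat {C : ℕ → ℕ → List (List (X × Bool))} (hC : Primrec₂ C) :
    REPred fun n => ¬∃ v : X → Bool, ∀ p, ∀ cl ∈ C n p, ∃ l ∈ cl, v l.1 = l.2 := by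
  let W : ℕ → ℕ → Prop := fun n N => ∀ b < 2 ^ N, ∃ p < N, ∃ cl ∈ C n p, ∀ l ∈ cl,
    Encodable.encode l.1 < N ∧ (b / 2 ^ Encodable.encode l.1 % 2 = 1 ↔ l.2 = false)
  have hpow : Primrec₂ ((· ^ ·) : ℕ → ℕ → ℕ) := Primrec₂.unpaired'.1 Nat.Primrec.pow
  have hW : PrimrecRel W := by
    have henc : Primrec fun z : (X × Bool) × (ℕ × ℕ) => Encodable.encode z.1.1 :=
      Primrec.encode.comp (Primrec.fst.comp Primrec.fst)
    have h4 : PrimrecRel fun (l : X × Bool) (y : ℕ × ℕ) => Encodable.encode l.1 < y.2 ∧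
        (y.1 / 2 ^ Encodable.encode l.1 % 2 = 1 ↔ l.2 = false) := by
      have ha : PrimrecPred fun z : (X × Bool) × (ℕ × ℕ) => Encodable.encode z.1.1 < z.2.2 :=
        Primrec.nat_lt.comp henc (Primrec.snd.comp Primrec.snd)
      have hb : PrimrecPred fun z : (X × Bool) × (ℕ × ℕ) =>
          z.2.1 / 2 ^ Encodable.encode z.1.1 % 2 = 1 :=
        Primrec.eq.comp (Primrec.nat_mod.comp (Primrec.nat_div.comp
          (Primrec.fst.comp Primrec.snd) (hpow.comp (Primrec.const 2) henc)) (Primrec.const 2))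
          (Primrec.const 1)
      have hc : PrimrecPred fun z : (X × Bool) × (ℕ × ℕ) => z.1.2 = false :=
        Primrec.eq.comp (Primrec.snd.comp Primrec.fst) (Primrec.const false)
      refine (ha.and ((hb.and hc).or (hb.not.and hc.not))).of_eq fun z => ?_
      tauto
    have h2 := h4.forall_mem_list.exists_mem_list
    have h1 : PrimrecRel fun (p : ℕ) (y : ℕ × ℕ × ℕ) => ∃ cl ∈ C y.2.1 p, ∀ l ∈ cl,
        Encodable.encode l.1 < y.2.2 ∧
          (y.1 / 2 ^ Encodable.encode l.1 % 2 = 1 ↔ l.2 = false) :=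
      h2.comp (hC.comp (Primrec.fst.comp (Primrec.snd.comp Primrec.snd)) Primrec.fst)
        (Primrec.pair (Primrec.fst.comp Primrec.snd)
          (Primrec.snd.comp (Primrec.snd.comp Primrec.snd)))
    have h0 : PrimrecRel fun (b : ℕ) (y : ℕ × ℕ) => ∃ p < y.2, ∃ cl ∈ C y.1 p, ∀ l ∈ cl,
        Encodable.encode l.1 < y.2 ∧ (b / 2 ^ Encodable.encode l.1 % 2 = 1 ↔ l.2 = false) :=
      (h1.exists_mem_list.comp (Primrec.list_range.comp (Primrec.snd.comp Primrec.snd))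
        Primrec.id).of_eq fun z => by simp
    exact (h0.forall_mem_list.comp (Primrec.list_range.comp
      (hpow.comp (Primrec.const 2) Primrec.snd)) Primrec.id).of_eq fun z => by simp [W]
  refine (rePred_exists hW).of_eq fun n => ?_
  rw [← not_iff_not, not_not]
  constructor
  · intro H
    -- The sets of valuations that satisfy the first `N` blocks are non-empty, closed and decreasing
    -- in the Cantor space, hence have a common element.
    let K : ℕ → Set (X → Bool) := fun N => {v | ∀ p < N, ∀ cl ∈ C n p, ∃ l ∈ cl, v l.1 = l.2}
    have hcl : ∀ N, IsClosed (K N) := by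
      intro N
      simp only [K, Set.ofPred_forall]
      refine isClosed_iInter fun p => isClosed_iInter fun _ => isClosed_iInter fun cl =>
        isClosed_iInter fun _ => ?_
      have : {v : X → Bool | ∃ l ∈ cl, v l.1 = l.2} = ⋃ l ∈ {l | l ∈ cl}, {v | v l.1 = l.2} := by
        ext v; simp
      rw [this]
      exact Set.Finite.isClosed_biUnion (List.finite_toSet cl) fun l _ =>
        isClosed_eq (continuous_apply _) continuous_const
    have hne : ∀ N, (K N).Nonempty := by
      intro N
      obtain ⟨B, hB⟩ := exists_bound (fun l : X × Bool => Encodable.encode l.1)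
        (((List.range N).flatMap (C n)).flatten)
      have hN := not_exists.1 H (max N B)
      simp only [W, not_forall, not_exists, not_and] at hN
      obtain ⟨b, -, hb⟩ := hN
      refine ⟨fun x => decide (b / 2 ^ Encodable.encode x % 2 = 1), fun p hp cl hcl => ?_⟩
      obtain ⟨l, hl, hx⟩ := hb p (lt_max_of_lt_left hp) cl hcl
      refine ⟨l, hl, ?_⟩
      have hlt : Encodable.encode l.1 < max N B := lt_max_of_lt_right (hB l (by
        simp only [List.mem_flatten, List.mem_flatMap, List.mem_range]
        exact ⟨cl, ⟨p, hp, hcl⟩, hl⟩))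
      have := hx hlt
      cases h : l.2 <;> simp_all
    obtain ⟨v, hv⟩ := IsCompact.nonempty_iInter_of_sequence_nonempty_isCompact_isClosed K
      (fun N v hv p hp => hv p (by omega)) hne (hcl 0).isCompact hcl
    exact ⟨v, fun p => Set.mem_iInter.1 hv (p + 1) p (by omega)⟩
  · rintro ⟨v, hv⟩ ⟨N, hN⟩
    -- The binary digits of `Nat.ofBits g` are the values of `v` at the atoms with codes below `N`.
    let g : Fin N → Bool := fun i => ((Encodable.decode (i : ℕ) : Option X).map v).getD false
    obtain ⟨p, -, cl, hcl, h⟩ := hN (Nat.ofBits g) (Nat.ofBits_lt_two_pow g)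
    obtain ⟨l, hl, e⟩ := hv p cl hcl
    obtain ⟨hlt, hb⟩ := h l hl
    have h1 : (Nat.ofBits g).testBit (Encodable.encode l.1) = v l.1 := by
      rw [Nat.testBit_ofBits_lt g _ hlt]
      simp [g]
    rw [Nat.testBit_eq_decide_div_mod_eq, e] at h1
    cases h2 : l.2 <;> simp_all

end

/-! ### Truth in terms of Gödel numbers -/

/-- The first entry of the list with code `l`. -/
def arg₁ (l : ℕ) : ℕ := (l - 1).unpair.1
/-- The second entry of the list with code `l`. -/
def arg₂ (l : ℕ) : ℕ := arg₁ (l - 1).unpair.2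

theorem arg₁_le (l : ℕ) : arg₁ l ≤ l := (Nat.unpair_left_le _).trans (Nat.sub_le _ _)
theorem arg₂_le (l : ℕ) : arg₂ l ≤ l :=
  (arg₁_le _).trans ((Nat.unpair_right_le _).trans (Nat.sub_le _ _))

/-- The code of the list `[t]`. -/
def listCode₁ (t : ℕ) : ℕ := Nat.pair t 0 + 1
/-- The code of the list `[t, s]`. -/
def listCode₂ (t s : ℕ) : ℕ := Nat.pair t (listCode₁ s) + 1
/-- The operations on Gödel numbers that correspond to the formation of terms and formulas,
beginning with the code of the variable `&i`. -/
def varCode (i : ℕ) : ℕ := 2 * (2 * i + 1)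
def zeroCode : ℕ := 2 * Nat.pair 0 0 + 1
def succCode (t : ℕ) : ℕ := 2 * Nat.pair 1 (listCode₁ t) + 1
def addCode (t s : ℕ) : ℕ := 2 * Nat.pair 2 (listCode₂ t s) + 1
def mulCode (t s : ℕ) : ℕ := 2 * Nat.pair 3 (listCode₂ t s) + 1
def eqCode (t s : ℕ) : ℕ := 4 * Nat.pair t s + 1
def ltCode (t s : ℕ) : ℕ := 4 * Nat.pair 0 (listCode₂ t s) + 2
def impCode (a b : ℕ) : ℕ := 4 * Nat.pair a b + 3
def allCode (a : ℕ) : ℕ := 4 * a + 4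

@[simp] theorem arg₁_listCode₁ (t : ℕ) : arg₁ (listCode₁ t) = t := by simp [arg₁, listCode₁]
@[simp] theorem arg₁_listCode₂ (t s : ℕ) : arg₁ (listCode₂ t s) = t := by simp [arg₁, listCode₂]
@[simp] theorem arg₂_listCode₂ (t s : ℕ) : arg₂ (listCode₂ t s) = s := by simp [arg₂, listCode₂]

section Eval

variable {M : Type} [arith.Structure M]

/-- The value of the term with code `t` under the assignment of the entries of `e` to the
variables. -/
def evalT (t : ℕ) (e : List M) : M :=
  if t % 2 = 0 then e.getD (t / 4) (zr M)
  else match (t / 2).unpair.1 with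
    | 0 => zr M
    | 1 => sc (evalT (arg₁ (t / 2).unpair.2) e)
    | 2 => ad (evalT (arg₁ (t / 2).unpair.2) e) (evalT (arg₂ (t / 2).unpair.2) e)
    | 3 => ml (evalT (arg₁ (t / 2).unpair.2) e) (evalT (arg₂ (t / 2).unpair.2) e)
    | _ => zr M
termination_by t
decreasing_by
  all_goals
    have h1 := arg₁_le (t / 2).unpair.2
    have h2 := arg₂_le (t / 2).unpair.2
    have h3 := Nat.unpair_right_le (t / 2)
    omega

@[simp] theorem evalT_var (i : ℕ) (e : List M) : evalT (varCode i) e = e.getD i (zr M) := by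
  rw [evalT, varCode, if_pos (by omega), show 2 * (2 * i + 1) / 4 = i by omega]

theorem evalT_odd (q : ℕ) (e : List M) : evalT (2 * q + 1) e = match q.unpair.1 with
    | 0 => zr M
    | 1 => sc (evalT (arg₁ q.unpair.2) e)
    | 2 => ad (evalT (arg₁ q.unpair.2) e) (evalT (arg₂ q.unpair.2) e)
    | 3 => ml (evalT (arg₁ q.unpair.2) e) (evalT (arg₂ q.unpair.2) e)
    | _ => zr M := by
  rw [evalT, if_neg (by omega), show (2 * q + 1) / 2 = q by omega]

@[simp] theorem evalT_zero (e : List M) : evalT zeroCode e = zr M := by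
  rw [zeroCode, evalT_odd, Nat.unpair_pair]; simp

@[simp] theorem evalT_succ (t : ℕ) (e : List M) : evalT (succCode t) e = sc (evalT t e) := by
  rw [succCode, evalT_odd, Nat.unpair_pair]; simp

@[simp] theorem evalT_add (t s : ℕ) (e : List M) :
    evalT (addCode t s) e = ad (evalT t e) (evalT s e) := by
  rw [addCode, evalT_odd, Nat.unpair_pair]; simp

@[simp] theorem evalT_mul (t s : ℕ) (e : List M) :
    evalT (mulCode t s) e = ml (evalT t e) (evalT s e) := by
  rw [mulCode, evalT_odd, Nat.unpair_pair]; simp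

/-- The truth of the formula with a given code under an assignment; the last entry is the value of
the newest variable. -/
def evalC : ℕ → List M → Prop
  | 0, _ => False
  | c + 1, e =>
    match c % 4 with
    | 0 => evalT (c / 4).unpair.1 e = evalT (c / 4).unpair.2 e
    | 1 => Lt (evalT (arg₁ (c / 4).unpair.2) e) (evalT (arg₂ (c / 4).unpair.2) e)
    | 2 => evalC (c / 4).unpair.1 e → evalC (c / 4).unpair.2 e
    | _ => ∀ x, evalC (c / 4) (e ++ [x])
termination_by c => c
decreasing_by
  all_goals
    have h1 := Nat.unpair_left_le (c / 4)
    have h2 := Nat.unpair_right_le (c / 4)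
    omega

@[simp] theorem evalC_zero (e : List M) : evalC 0 e ↔ False := by rw [evalC]

@[simp] theorem evalC_eq (t s : ℕ) (e : List M) :
    evalC (eqCode t s) e ↔ evalT t e = evalT s e := by
  rw [eqCode, evalC, show 4 * Nat.pair t s % 4 = 0 by omega,
    show 4 * Nat.pair t s / 4 = Nat.pair t s by omega, Nat.unpair_pair]
  simp

@[simp] theorem evalC_lt (t s : ℕ) (e : List M) :
    evalC (ltCode t s) e ↔ Lt (evalT t e) (evalT s e) := by
  rw [ltCode, evalC, show (4 * Nat.pair 0 (listCode₂ t s) + 1) % 4 = 1 by omega,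
    show (4 * Nat.pair 0 (listCode₂ t s) + 1) / 4 = Nat.pair 0 (listCode₂ t s) by omega,
    Nat.unpair_pair]
  simp

@[simp] theorem evalC_imp (a b : ℕ) (e : List M) :
    evalC (impCode a b) e ↔ (evalC a e → evalC b e) := by
  rw [impCode, evalC, show (4 * Nat.pair a b + 2) % 4 = 2 by omega,
    show (4 * Nat.pair a b + 2) / 4 = Nat.pair a b by omega, Nat.unpair_pair]
  simp

@[simp] theorem evalC_all (a : ℕ) (e : List M) :
    evalC (allCode a) e ↔ ∀ x, evalC a (e ++ [x]) := by
  rw [allCode, evalC, show (4 * a + 3) % 4 = 3 by omega, show (4 * a + 3) / 4 = a by omega]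
  simp

end Eval

section Codes

variable {n : ℕ}

theorem termCode_var (i : Fin n) :
    termCode (L := arith) (.var (.inr i) : arith.Term (Empty ⊕ Fin n)) = varCode i.1 := by
  rw [termCode, Encodable.encode_inr]; rfl

theorem termCode_zero (ts : Fin 0 → arith.Term (Empty ⊕ Fin n)) :
    termCode (L := arith) (.func ArithFunc.zero ts) = zeroCode := by
  rw [termCode, List.ofFn_zero]; rfl

theorem termCode_succ (ts : Fin 1 → arith.Term (Empty ⊕ Fin n)) :
    termCode (L := arith) (.func ArithFunc.succ ts) = succCode (termCode (ts 0)) := by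
  rw [termCode, List.ofFn_succ, List.ofFn_zero, Encodable.encode_list_cons]; rfl

theorem termCode_add (ts : Fin 2 → arith.Term (Empty ⊕ Fin n)) :
    termCode (L := arith) (.func ArithFunc.add ts) =
      addCode (termCode (ts 0)) (termCode (ts 1)) := by
  rw [termCode, List.ofFn_succ, List.ofFn_succ, List.ofFn_zero, Encodable.encode_list_cons,
    Encodable.encode_list_cons]; rfl

theorem termCode_mul (ts : Fin 2 → arith.Term (Empty ⊕ Fin n)) :
    termCode (L := arith) (.func ArithFunc.mul ts) =
      mulCode (termCode (ts 0)) (termCode (ts 1)) := by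
  rw [termCode, List.ofFn_succ, List.ofFn_succ, List.ofFn_zero, Encodable.encode_list_cons,
    Encodable.encode_list_cons]; rfl

theorem formulaCode_equal (t s : arith.Term (Empty ⊕ Fin n)) :
    formulaCode (BoundedFormula.equal t s) = eqCode (termCode t) (termCode s) := by
  rw [formulaCode, eqCode]

theorem formulaCode_rel (ts : Fin 2 → arith.Term (Empty ⊕ Fin n)) :
    formulaCode (L := arith) (α := Empty) (.rel ArithRel.lt ts) =
      ltCode (termCode (ts 0)) (termCode (ts 1)) := by
  rw [formulaCode, List.ofFn_succ, List.ofFn_succ, List.ofFn_zero, Encodable.encode_list_cons,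
    Encodable.encode_list_cons]; rfl

variable {M : Type} [arith.Structure M]

theorem evalT_termCode (t : arith.Term (Empty ⊕ Fin n)) (xs : Fin n → M) :
    evalT (termCode t) (List.ofFn xs) = t.realize (Sum.elim default xs) := by
  induction t with
  | var x =>
    rcases x with x | i
    · exact x.elim
    · rw [termCode_var, evalT_var]; simp
  | func f ts ih =>
    cases f with
    | zero =>
      rw [termCode_zero, evalT_zero, Term.realize_func, zr]
      congr 1
      exact Subsingleton.elim _ _
    | succ =>
      rw [termCode_succ, evalT_succ, ih, Term.realize_func, sc]
      congr 1; funext i; fin_cases i; rfl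
    | add =>
      rw [termCode_add, evalT_add, ih, ih, Term.realize_func, ad]
      congr 1; funext i; fin_cases i <;> rfl
    | mul =>
      rw [termCode_mul, evalT_mul, ih, ih, Term.realize_func, ml]
      congr 1; funext i; fin_cases i <;> rfl

theorem evalC_formulaCode (φ : arith.BoundedFormula Empty n) (xs : Fin n → M) :
    evalC (formulaCode φ) (List.ofFn xs) ↔ φ.Realize default xs := by
  induction φ with
  | falsum => rw [formulaCode, evalC_zero]; rfl
  | equal t s => rw [formulaCode_equal, evalC_eq, evalT_termCode, evalT_termCode]; rfl
  | rel R ts =>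
    cases R
    rw [formulaCode_rel, evalC_lt, evalT_termCode, evalT_termCode, Lt]
    refine iff_of_eq (congrArg _ ?_)
    funext i; fin_cases i <;> rfl
  | imp φ ψ ih1 ih2 =>
    rw [formulaCode, ← impCode, evalC_imp, ih1, ih2]; rfl
  | all φ ih =>
    rw [formulaCode, ← allCode, evalC_all, BoundedFormula.realize_all]
    refine forall_congr' fun x => ?_
    rw [← ih, List.ofFn_succ']
    simp [List.concat_eq_append]

end Codes

/-! ### Henkin constants -/

/-- Natural numbers serve as closed terms.  The tags `0, …, 3` stand for the arithmetical function
symbols; the tag `c + 4` with a list `l` of names stands for a Henkin constant for the formula with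
code `c`, in which the names `l` are substituted for all variables but the last. -/
def mkName (k : ℕ) (l : List ℕ) : ℕ := Encodable.encode (k, l)

/-- The subterms of a name have smaller codes. -/
theorem lt_encode_of_mem {x : ℕ} {l : List ℕ} (h : x ∈ l) : x < Encodable.encode l := by
  induction l with
  | nil => simp at h
  | cons a l ih =>
    rw [Encodable.encode_list_cons, Nat.lt_succ_iff]
    rcases List.mem_cons.1 h with rfl | h
    · exact Nat.left_le_pair _ _
    · exact (ih h).le.trans (Nat.right_le_pair _ _)

section Interp

variable (M : Type) [arith.Structure M]

open Classical in
/-- The value of a name with tag `k`, given the values of its arguments. A Henkin constant denotes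
a counterexample to the generalisation of its formula, if there is one. -/
noncomputable def node (k : ℕ) (e : List M) : M :=
  match k with
  | 0 => zr M
  | 1 => sc (e.getD 0 (zr M))
  | 2 => ad (e.getD 0 (zr M)) (e.getD 1 (zr M))
  | 3 => ml (e.getD 0 (zr M)) (e.getD 1 (zr M))
  | c + 4 => if h : ∃ x, ¬evalC c (e ++ [x]) then h.choose else zr M

/-- The value of a name in `M`. -/
noncomputable def interp (a : ℕ) : M :=
  node M a.unpair.1 ((Denumerable.ofNat (List ℕ) a.unpair.2).attach.map fun x => interp x.1)
termination_by a
decreasing_by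
  have h := lt_encode_of_mem x.2
  rw [Denumerable.encode_ofNat] at h
  exact lt_of_lt_of_le h (Nat.unpair_right_le a)

theorem interp_mkName (k : ℕ) (l : List ℕ) :
    interp M (mkName k l) = node M k (l.map (interp M)) := by
  rw [interp, mkName, Encodable.encode_prod_val, Nat.unpair_pair, Encodable.encode_nat,
    Denumerable.ofNat_encode]
  congr 1
  conv_rhs => rw [← List.attach_map_subtype_val l, List.map_map]
  rfl

end Interp

/-! ### The clauses describing a Henkin model -/

/-- Propositional atoms.  They are of the four forms `holdsA`, `valueA`, `eqA` and `ltA`. -/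
abbrev Atom : Type := ℕ × List ℕ

/-- The formula with code `c` holds when the names `e` are assigned to its variables. -/
def holdsA (c : ℕ) (e : List ℕ) : Atom := (0, c :: e)
/-- The name `a` is a value of the term with code `t` when the names `e` are assigned to its
variables. -/
def valueA (t : ℕ) (e : List ℕ) (a : ℕ) : Atom := (1, t :: a :: e)
/-- The names `a` and `b` denote the same object. -/
def eqA (a b : ℕ) : Atom := (2, [a, b])
/-- The object named by `a` is below the object named by `b`. -/
def ltA (a b : ℕ) : Atom := (3, [a, b])

/-- The name of a natural number. -/
def numName : ℕ → ℕ := fun n => Nat.rec (mkName 0 []) (fun _ a => mkName 1 [a]) n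

/-- The block of clauses with parameters `t s a b e`. `D t s` expresses that `s` verifies that `t`
is the code of an axiom, and the last clause says that the formula with code `θ` holds of the
numeral of `n`. The clauses are explained by `IsHenkin`. -/
def clauseList (D : ℕ → ℕ → Bool) (θ n t s a b : ℕ) (e : List ℕ) : List (List (Atom × Bool)) :=
    [ [(valueA (varCode t) e (e.getD t 0), true)],
      [(valueA zeroCode e (mkName 0 []), true)],
      [(valueA t e a, false), (valueA (succCode t) e (mkName 1 [a]), true)],
      [(valueA t e a, false), (valueA s e b, false),
        (valueA (addCode t s) e (mkName 2 [a, b]), true)],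
      [(valueA t e a, false), (valueA s e b, false),
        (valueA (mulCode t s) e (mkName 3 [a, b]), true)],
      [(valueA t e a, false), (valueA s e b, false), (holdsA (eqCode t s) e, false),
        (eqA a b, true)],
      [(valueA t e a, false), (valueA s e b, false), (holdsA (eqCode t s) e, true),
        (eqA a b, false)],
      [(valueA t e a, false), (valueA s e b, false), (holdsA (ltCode t s) e, false),
        (ltA a b, true)],
      [(valueA t e a, false), (valueA s e b, false), (holdsA (ltCode t s) e, true),
        (ltA a b, false)],
      [(eqA a a, true)],
      [(eqA a b, false), (eqA b a, true)],
      [(eqA a b, false), (eqA b t, false), (eqA a t, true)],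
      [(eqA a b, false), (eqA (mkName 1 [a]) (mkName 1 [b]), true)],
      [(eqA a t, false), (eqA b s, false), (eqA (mkName 2 [a, b]) (mkName 2 [t, s]), true)],
      [(eqA a t, false), (eqA b s, false), (eqA (mkName 3 [a, b]) (mkName 3 [t, s]), true)],
      [(eqA a t, false), (eqA b s, false), (ltA a b, false), (ltA t s, true)],
      [(holdsA 0 e, false)],
      [(holdsA (impCode t s) e, false), (holdsA t e, false), (holdsA s e, true)],
      [(holdsA (impCode t s) e, true), (holdsA t e, true)],
      [(holdsA (impCode t s) e, true), (holdsA s e, false)],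
      [(holdsA (allCode t) e, false), (holdsA t (e ++ [a]), true)],
      [(holdsA (allCode t) e, true), (holdsA t (e ++ [mkName (t + 4) e]), false)],
      if D t s then [(holdsA t [], true)] else [(holdsA 0 [], false)],
      [(holdsA θ [numName n], true)] ]

/-- The blocks of `clauseList`, indexed by their parameters. -/
def clauses (D : ℕ → ℕ → Bool) (θ n : ℕ) (p : ℕ × ℕ × ℕ × ℕ × List ℕ) :
    List (List (Atom × Bool)) :=
  clauseList D θ n p.1 p.2.1 p.2.2.1 p.2.2.2.1 p.2.2.2.2

theorem primrec_clauses {D : ℕ → ℕ → Bool} (hD : Primrec₂ D) (θ : ℕ) :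
    Primrec₂ (clauses D θ) := by
  let Z := ℕ × ℕ × ℕ × ℕ × ℕ × List ℕ
  have ht : Primrec fun z : Z => z.2.1 := Primrec.fst.comp Primrec.snd
  have hs : Primrec fun z : Z => z.2.2.1 :=
    Primrec.fst.comp (Primrec.snd.comp Primrec.snd)
  have ha : Primrec fun z : Z => z.2.2.2.1 :=
    Primrec.fst.comp (Primrec.snd.comp (Primrec.snd.comp Primrec.snd))
  have hb : Primrec fun z : Z => z.2.2.2.2.1 :=
    Primrec.fst.comp (Primrec.snd.comp (Primrec.snd.comp (Primrec.snd.comp Primrec.snd)))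
  have he : Primrec fun z : Z => z.2.2.2.2.2 :=
    Primrec.snd.comp (Primrec.snd.comp (Primrec.snd.comp (Primrec.snd.comp Primrec.snd)))
  have cons : ∀ {α β : Type} [Primcodable α] [Primcodable β] {f : α → β} {g : α → List β},
      Primrec f → Primrec g → Primrec fun z => f z :: g z :=
    fun hf hg => Primrec.list_cons.comp hf hg
  have nil : ∀ {α β : Type} [Primcodable α] [Primcodable β], Primrec fun _ : α => ([] : List β) :=
    Primrec.const []
  have name : ∀ {α : Type} [Primcodable α] {f : α → ℕ} {g : α → List ℕ}, Primrec f → Primrec g →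
      Primrec fun z => mkName (f z) (g z) := fun hf hg => Primrec.encode.comp (hf.pair hg)
  have hholds : ∀ {f : Z → ℕ} {g : Z → List ℕ}, Primrec f → Primrec g →
      Primrec fun z => holdsA (f z) (g z) := fun hf hg => (Primrec.const 0).pair (cons hf hg)
  have hval : ∀ {f : Z → ℕ} {g : Z → List ℕ} {h : Z → ℕ}, Primrec f → Primrec g → Primrec h →
      Primrec fun z => valueA (f z) (g z) (h z) :=
    fun hf hg hh => (Primrec.const 1).pair (cons hf (cons hh hg))
  have heq : ∀ {f h : Z → ℕ}, Primrec f → Primrec h → Primrec fun z => eqA (f z) (h z) :=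
    fun hf hh => (Primrec.const 2).pair (cons hf (cons hh nil))
  have hlt : ∀ {f h : Z → ℕ}, Primrec f → Primrec h → Primrec fun z => ltA (f z) (h z) :=
    fun hf hh => (Primrec.const 3).pair (cons hf (cons hh nil))
  have pos : ∀ {f : Z → Atom}, Primrec f → Primrec fun z => (f z, true) :=
    fun hf => hf.pair (Primrec.const true)
  have neg : ∀ {f : Z → Atom}, Primrec f → Primrec fun z => (f z, false) :=
    fun hf => hf.pair (Primrec.const false)
  have lin : ∀ (k c : ℕ) {f : Z → ℕ}, Primrec f → Primrec fun z => k * f z + c :=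
    fun k c _ hf => Primrec.nat_add.comp (Primrec.nat_mul.comp (Primrec.const k) hf)
      (Primrec.const c)
  have hl1 : ∀ {f : Z → ℕ}, Primrec f → Primrec fun z => listCode₁ (f z) :=
    fun hf => Primrec.succ.comp (Primrec₂.natPair.comp hf (Primrec.const 0))
  have hl2 : ∀ {f g : Z → ℕ}, Primrec f → Primrec g → Primrec fun z => listCode₂ (f z) (g z) :=
    fun hf hg => Primrec.succ.comp (Primrec₂.natPair.comp hf (hl1 hg))
  have hvar : Primrec fun z : Z => varCode z.2.1 :=
    Primrec.nat_mul.comp (Primrec.const 2) (lin 2 1 ht)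
  have hsucc : Primrec fun z : Z => succCode z.2.1 :=
    lin 2 1 (Primrec₂.natPair.comp (Primrec.const 1) (hl1 ht))
  have hadd : Primrec fun z : Z => addCode z.2.1 z.2.2.1 :=
    lin 2 1 (Primrec₂.natPair.comp (Primrec.const 2) (hl2 ht hs))
  have hmul : Primrec fun z : Z => mulCode z.2.1 z.2.2.1 :=
    lin 2 1 (Primrec₂.natPair.comp (Primrec.const 3) (hl2 ht hs))
  have hceq : Primrec fun z : Z => eqCode z.2.1 z.2.2.1 := lin 4 1 (Primrec₂.natPair.comp ht hs)
  have hclt : Primrec fun z : Z => ltCode z.2.1 z.2.2.1 :=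
    lin 4 2 (Primrec₂.natPair.comp (Primrec.const 0) (hl2 ht hs))
  have himp : Primrec fun z : Z => impCode z.2.1 z.2.2.1 := lin 4 3 (Primrec₂.natPair.comp ht hs)
  have hall : Primrec fun z : Z => allCode z.2.1 := lin 4 4 ht
  have hn1 : ∀ {f : Z → ℕ}, Primrec f → Primrec fun z => mkName 1 [f z] :=
    fun hf => name (Primrec.const 1) (cons hf nil)
  have hn2 : ∀ (k : ℕ) {f g : Z → ℕ}, Primrec f → Primrec g →
      Primrec fun z => mkName k [f z, g z] :=
    fun k _ _ hf hg => name (Primrec.const k) (cons hf (cons hg nil))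
  have hget : Primrec fun z : Z => z.2.2.2.2.2.getD z.2.1 0 := (Primrec.list_getD 0).comp he ht
  have hnum : Primrec numName :=
    Primrec.nat_rec₁ _ ((name (Primrec.const 1) (cons Primrec.snd nil)).to₂)
  have hwit : Primrec fun z : Z => mkName (z.2.1 + 4) z.2.2.2.2.2 :=
    name (Primrec.nat_add.comp ht (Primrec.const 4)) he
  have happ : ∀ {f : Z → ℕ}, Primrec f → Primrec fun z => z.2.2.2.2.2 ++ [f z] :=
    fun hf => Primrec.list_append.comp he (cons hf nil)
  have hT := hval ht he ha
  have hS := hval hs he hb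
  have hax : Primrec fun z : Z => if D z.2.1 z.2.2.1 then [(holdsA z.2.1 [], true)]
      else [(holdsA 0 [], false)] :=
    Primrec.ite (Primrec.eq.comp (hD.comp ht hs) (Primrec.const true))
      (cons (pos (hholds ht nil)) nil) (cons (neg (hholds (Primrec.const 0) nil)) nil)
  have hnn : Primrec fun z : Z => numName z.1 := hnum.comp Primrec.fst
  exact cons (cons (pos (hval hvar he hget)) nil)
    (cons (cons (pos (hval (Primrec.const _) he (Primrec.const _))) nil)
    (cons (cons (neg hT) (cons (pos (hval hsucc he (hn1 ha))) nil))
    (cons (cons (neg hT) (cons (neg hS) (cons (pos (hval hadd he (hn2 2 ha hb))) nil)))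
    (cons (cons (neg hT) (cons (neg hS) (cons (pos (hval hmul he (hn2 3 ha hb))) nil)))
    (cons (cons (neg hT) (cons (neg hS) (cons (neg (hholds hceq he)) (cons (pos (heq ha hb)) nil))))
    (cons (cons (neg hT) (cons (neg hS) (cons (pos (hholds hceq he)) (cons (neg (heq ha hb)) nil))))
    (cons (cons (neg hT) (cons (neg hS) (cons (neg (hholds hclt he)) (cons (pos (hlt ha hb)) nil))))
    (cons (cons (neg hT) (cons (neg hS) (cons (pos (hholds hclt he)) (cons (neg (hlt ha hb)) nil))))
    (cons (cons (pos (heq ha ha)) nil)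
    (cons (cons (neg (heq ha hb)) (cons (pos (heq hb ha)) nil))
    (cons (cons (neg (heq ha hb)) (cons (neg (heq hb ht)) (cons (pos (heq ha ht)) nil)))
    (cons (cons (neg (heq ha hb)) (cons (pos (heq (hn1 ha) (hn1 hb))) nil))
    (cons (cons (neg (heq ha ht)) (cons (neg (heq hb hs))
      (cons (pos (heq (hn2 2 ha hb) (hn2 2 ht hs))) nil)))
    (cons (cons (neg (heq ha ht)) (cons (neg (heq hb hs))
      (cons (pos (heq (hn2 3 ha hb) (hn2 3 ht hs))) nil)))
    (cons (cons (neg (heq ha ht)) (cons (neg (heq hb hs)) (cons (neg (hlt ha hb))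
      (cons (pos (hlt ht hs)) nil))))
    (cons (cons (neg (hholds (Primrec.const 0) he)) nil)
    (cons (cons (neg (hholds himp he)) (cons (neg (hholds ht he)) (cons (pos (hholds hs he)) nil)))
    (cons (cons (pos (hholds himp he)) (cons (pos (hholds ht he)) nil))
    (cons (cons (pos (hholds himp he)) (cons (neg (hholds hs he)) nil))
    (cons (cons (neg (hholds hall he)) (cons (pos (hholds ht (happ ha))) nil))
    (cons (cons (pos (hholds hall he)) (cons (neg (hholds ht (happ hwit))) nil))
    (cons hax
    (cons (cons (pos (hholds (Primrec.const θ) (cons hnn nil))) nil) nil)))))))))))))))))))))))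

/-! ### Henkin models -/

/-- The set `P` of atoms describes a Henkin model of the axioms enumerated by `D`, in which the
formula with code `θ` holds of the numeral of `n`. -/
structure IsHenkin (P : Atom → Prop) (D : ℕ → ℕ → Bool) (θ n : ℕ) : Prop where
  var : ∀ t e, P (valueA (varCode t) e (e.getD t 0))
  zero : ∀ e, P (valueA zeroCode e (mkName 0 []))
  succ : ∀ t a e, P (valueA t e a) → P (valueA (succCode t) e (mkName 1 [a]))
  add : ∀ t s a b e, P (valueA t e a) → P (valueA s e b) →
    P (valueA (addCode t s) e (mkName 2 [a, b]))
  mul : ∀ t s a b e, P (valueA t e a) → P (valueA s e b) →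
    P (valueA (mulCode t s) e (mkName 3 [a, b]))
  eq : ∀ t s a b e, P (valueA t e a) → P (valueA s e b) →
    (P (holdsA (eqCode t s) e) ↔ P (eqA a b))
  lt : ∀ t s a b e, P (valueA t e a) → P (valueA s e b) →
    (P (holdsA (ltCode t s) e) ↔ P (ltA a b))
  eq_refl : ∀ a, P (eqA a a)
  eq_symm : ∀ a b, P (eqA a b) → P (eqA b a)
  eq_trans : ∀ a b t, P (eqA a b) → P (eqA b t) → P (eqA a t)
  succ_congr : ∀ a b, P (eqA a b) → P (eqA (mkName 1 [a]) (mkName 1 [b]))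
  add_congr : ∀ t s a b, P (eqA a t) → P (eqA b s) → P (eqA (mkName 2 [a, b]) (mkName 2 [t, s]))
  mul_congr : ∀ t s a b, P (eqA a t) → P (eqA b s) → P (eqA (mkName 3 [a, b]) (mkName 3 [t, s]))
  lt_congr : ∀ t s a b, P (eqA a t) → P (eqA b s) → P (ltA a b) → P (ltA t s)
  falsum : ∀ e, ¬P (holdsA 0 e)
  imp : ∀ t s e, P (holdsA (impCode t s) e) ↔ (P (holdsA t e) → P (holdsA s e))
  all : ∀ t a e, P (holdsA (allCode t) e) → P (holdsA t (e ++ [a]))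
  henkin : ∀ t e, P (holdsA t (e ++ [mkName (t + 4) e])) → P (holdsA (allCode t) e)
  ax : ∀ t s, D t s = true → P (holdsA t [])
  thm : P (holdsA θ [numName n])

theorem forall_clauseList_iff (v : Atom → Bool) (D : ℕ → ℕ → Bool) (θ n : ℕ) :
    (∀ t s a b e, ∀ cl ∈ clauseList D θ n t s a b e, ∃ l ∈ cl, v l.1 = l.2) ↔
      IsHenkin (fun x => v x = true) D θ n := by
  simp only [clauseList, List.forall_mem_cons, List.exists_mem_cons_iff, List.not_mem_nil,
    false_and, exists_false, or_false, ← Bool.not_eq_true]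
  constructor
  · intro h
    simp only [forall_and] at h
    obtain ⟨h1, h2, h3, h4, h5, h6, h7, h8, h9, h10, h11, h12, h13, h14, h15, h16, h17, h18, h19,
      h20, h21, h22, h23, h24, -⟩ := h
    exact {
      var := fun t e => h1 t 0 0 0 e
      zero := fun e => h2 0 0 0 0 e
      succ := fun t a e => imp_iff_not_or.2 (h3 t 0 a 0 e)
      add := fun t s a b e p q => ((h4 t s a b e).resolve_left (not_not.2 p)).resolve_left
        (not_not.2 q)
      mul := fun t s a b e p q => ((h5 t s a b e).resolve_left (not_not.2 p)).resolve_left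
        (not_not.2 q)
      eq := fun t s a b e p q => by have := h6 t s a b e; have := h7 t s a b e; tauto
      lt := fun t s a b e p q => by have := h8 t s a b e; have := h9 t s a b e; tauto
      eq_refl := fun a => h10 0 0 a 0 []
      eq_symm := fun a b => imp_iff_not_or.2 (h11 0 0 a b [])
      eq_trans := fun a b t p q => ((h12 t 0 a b []).resolve_left (not_not.2 p)).resolve_left
        (not_not.2 q)
      succ_congr := fun a b => imp_iff_not_or.2 (h13 0 0 a b [])
      add_congr := fun t s a b p q => ((h14 t s a b []).resolve_left (not_not.2 p)).resolve_left
        (not_not.2 q)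
      mul_congr := fun t s a b p q => ((h15 t s a b []).resolve_left (not_not.2 p)).resolve_left
        (not_not.2 q)
      lt_congr := fun t s a b p q => by have := h16 t s a b []; tauto
      falsum := fun e => h17 0 0 0 0 e
      imp := fun t s e => by
        have := h18 t s 0 0 e; have := h19 t s 0 0 e; have := h20 t s 0 0 e; tauto
      all := fun t a e => imp_iff_not_or.2 (h21 t 0 a 0 e)
      henkin := fun t e => imp_iff_or_not.2 (h22 t 0 0 0 e)
      ax := fun t s hD => by simpa [hD] using h23 t s 0 0 []
      thm := h24 0 0 0 0 [] }
  · intro h t s a b e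
    have h6 := h.eq t s a b e
    have h8 := h.lt t s a b e
    have himp := h.imp t s e
    refine ⟨h.var t e, h.zero e, imp_iff_not_or.1 (h.succ t a e), ?_, ?_, by tauto, by tauto,
      by tauto, by tauto, h.eq_refl a, imp_iff_not_or.1 (h.eq_symm a b), ?_,
      imp_iff_not_or.1 (h.succ_congr a b), ?_, ?_, ?_, h.falsum e, by tauto, by tauto, by tauto,
      imp_iff_not_or.1 (h.all t a e), imp_iff_or_not.1 (h.henkin t e), ?_, h.thm, by simp⟩
    · have := h.add t s a b e; tauto
    · have := h.mul t s a b e; tauto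
    · have := h.eq_trans a b t; tauto
    · have := h.add_congr t s a b; tauto
    · have := h.mul_congr t s a b; tauto
    · have := h.lt_congr t s a b; tauto
    · by_cases hD : D t s = true
      · simpa [hD] using h.ax t s hD
      · simpa [hD] using h.falsum []

section Soundness

variable (M : Type) [arith.Structure M]

/-- The truth of an atom in `M`, names being interpreted by `interp M`. -/
def atomTrue : Atom → Prop
  | (0, c :: e) => evalC c (e.map (interp M))
  | (1, t :: a :: e) => evalT t (e.map (interp M)) = interp M a
  | (2, [a, b]) => interp M a = interp M b
  | (3, [a, b]) => Lt (interp M a) (interp M b)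
  | _ => False

@[simp] theorem atomTrue_holdsA (c : ℕ) (e : List ℕ) :
    atomTrue M (holdsA c e) ↔ evalC c (e.map (interp M)) := Iff.rfl
@[simp] theorem atomTrue_valueA (t : ℕ) (e : List ℕ) (a : ℕ) :
    atomTrue M (valueA t e a) ↔ evalT t (e.map (interp M)) = interp M a := Iff.rfl
@[simp] theorem atomTrue_eqA (a b : ℕ) : atomTrue M (eqA a b) ↔ interp M a = interp M b := Iff.rfl
@[simp] theorem atomTrue_ltA (a b : ℕ) : atomTrue M (ltA a b) ↔ Lt (interp M a) (interp M b) :=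
  Iff.rfl

theorem interp_zero : interp M (mkName 0 []) = zr M := by simp [interp_mkName, node]
theorem interp_succ (a : ℕ) : interp M (mkName 1 [a]) = sc (interp M a) := by
  simp [interp_mkName, node]
theorem interp_add (a b : ℕ) : interp M (mkName 2 [a, b]) = ad (interp M a) (interp M b) := by
  simp [interp_mkName, node]
theorem interp_mul (a b : ℕ) : interp M (mkName 3 [a, b]) = ml (interp M a) (interp M b) := by
  simp [interp_mkName, node]

theorem interp_numName (n : ℕ) : interp M (numName n) = nm M n := by
  induction n with
  | zero => exact interp_zero M
  | succ n ih => rw [nm, ← ih]; exact interp_succ M _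

theorem evalC_of_henkin (t : ℕ) (e : List ℕ)
    (h : evalC t (e.map (interp M) ++ [interp M (mkName (t + 4) e)])) (x : M) :
    evalC t (e.map (interp M) ++ [x]) := by
  by_contra hx
  have hex : ∃ x, ¬evalC t (e.map (interp M) ++ [x]) := ⟨x, hx⟩
  rw [interp_mkName, node, dif_pos hex] at h
  exact hex.choose_spec h

/-- The true atoms of a model describe a Henkin model. -/
theorem isHenkin_atomTrue {D : ℕ → ℕ → Bool} {θ n : ℕ}
    (hD : ∀ t s, D t s = true → evalC t ([] : List M)) (hθ : evalC θ [nm M n]) :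
    IsHenkin (atomTrue M) D θ n where
  var t e := by
    simp only [atomTrue_valueA, evalT_var]
    rw [← interp_zero M, List.getD_map]
    rfl
  zero e := by simp [interp_zero]
  succ t a e h := by simp_all [interp_succ]
  add t s a b e h h' := by simp_all [interp_add]
  mul t s a b e h h' := by simp_all [interp_mul]
  eq t s a b e h h' := by simp_all
  lt t s a b e h h' := by simp_all
  eq_refl a := rfl
  eq_symm a b h := Eq.symm h
  eq_trans a b t h h' := Eq.trans h h'
  succ_congr a b h := by simp_all [interp_succ]
  add_congr t s a b h h' := by simp_all [interp_add]
  mul_congr t s a b h h' := by simp_all [interp_mul]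
  lt_congr t s a b h h' := by simp_all
  falsum e := by simp
  imp t s e := by simp
  all t a e h := by simp_all
  henkin t e h := by
    rw [atomTrue_holdsA, evalC_all]
    exact evalC_of_henkin M t e (by simpa using h)
  ax t s h := hD t s h
  thm := by simpa [interp_numName] using hθ

end Soundness

section Completeness

variable {P : Atom → Prop} {D : ℕ → ℕ → Bool} {θ n : ℕ} (h : IsHenkin P D θ n)

namespace IsHenkin

include h

/-- Equality of names according to `P`. -/
def setoid : Setoid ℕ where
  r a b := P (eqA a b)
  iseqv := ⟨h.eq_refl, fun {_ _} => h.eq_symm _ _, fun {_ _ _} => h.eq_trans _ _ _⟩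

/-- The Henkin model described by `P`: the names modulo equality. -/
def Model : Type := Quotient h.setoid

/-- The object with a given name. -/
def cls (a : ℕ) : h.Model := Quotient.mk h.setoid a

theorem cls_eq_iff (a b : ℕ) : h.cls a = h.cls b ↔ P (eqA a b) :=
  ⟨fun e => Quotient.exact e, fun e => Quotient.sound (s := h.setoid) e⟩

instance : arith.Structure h.Model :=
  mkStructure (h.cls (mkName 0 []))
    (Quotient.map (sa := h.setoid) (sb := h.setoid) (fun a => mkName 1 [a])
      fun _ _ => h.succ_congr _ _)
    (Quotient.map₂ (sa := h.setoid) (sb := h.setoid) (sc := h.setoid) (fun a b => mkName 2 [a, b])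
      fun _ _ p _ _ q => h.add_congr _ _ _ _ p q)
    (Quotient.map₂ (sa := h.setoid) (sb := h.setoid) (sc := h.setoid) (fun a b => mkName 3 [a, b])
      fun _ _ p _ _ q => h.mul_congr _ _ _ _ p q)
    (Quotient.lift₂ (s₁ := h.setoid) (s₂ := h.setoid) (fun a b => P (ltA a b))
      fun _ _ _ _ p q => propext ⟨h.lt_congr _ _ _ _ p q,
        h.lt_congr _ _ _ _ (h.eq_symm _ _ p) (h.eq_symm _ _ q)⟩)

theorem sc_cls (a : ℕ) : sc (h.cls a) = h.cls (mkName 1 [a]) := rfl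
theorem ad_cls (a b : ℕ) : ad (h.cls a) (h.cls b) = h.cls (mkName 2 [a, b]) := rfl
theorem ml_cls (a b : ℕ) : ml (h.cls a) (h.cls b) = h.cls (mkName 3 [a, b]) := rfl
theorem lt_cls (a b : ℕ) : Lt (h.cls a) (h.cls b) ↔ P (ltA a b) := Iff.rfl

theorem cls_numName (k : ℕ) : h.cls (numName k) = nm h.Model k := by
  induction k with
  | zero => rfl
  | succ k ih => rw [nm, ← ih]; rfl

variable {k : ℕ}

theorem exists_value (t : arith.Term (Empty ⊕ Fin k)) (e : List ℕ) :
    ∃ a, P (valueA (termCode t) e a) ∧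
      t.realize (Sum.elim default fun i : Fin k => h.cls (e.getD i 0)) = h.cls a := by
  induction t with
  | var x =>
    rcases x with x | i
    · exact x.elim
    · exact ⟨_, by rw [termCode_var]; exact h.var _ _, rfl⟩
  | func f ts ih =>
    cases f with
    | zero => exact ⟨_, by rw [termCode_zero]; exact h.zero e, rfl⟩
    | succ =>
      obtain ⟨a, ha, ea⟩ := ih 0
      refine ⟨_, by rw [termCode_succ]; exact h.succ _ a e ha, ?_⟩
      rw [← sc_cls, ← ea]; rfl
    | add =>
      obtain ⟨a, ha, ea⟩ := ih 0
      obtain ⟨b, hb, eb⟩ := ih 1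
      refine ⟨_, by rw [termCode_add]; exact h.add _ _ a b e ha hb, ?_⟩
      rw [← ad_cls, ← ea, ← eb]; rfl
    | mul =>
      obtain ⟨a, ha, ea⟩ := ih 0
      obtain ⟨b, hb, eb⟩ := ih 1
      refine ⟨_, by rw [termCode_mul]; exact h.mul _ _ a b e ha hb, ?_⟩
      rw [← ml_cls, ← ea, ← eb]; rfl

/-- The truth lemma of Henkin's completeness proof. -/
theorem truth (φ : arith.BoundedFormula Empty k) (e : List ℕ) (he : e.length = k) :
    P (holdsA (formulaCode φ) e) ↔ φ.Realize default fun i : Fin k => h.cls (e.getD i 0) := by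
  induction φ generalizing e with
  | falsum => rw [formulaCode]; exact iff_of_false (h.falsum e) id
  | equal t s =>
    obtain ⟨a, ha, ea⟩ := h.exists_value t e
    obtain ⟨b, hb, eb⟩ := h.exists_value s e
    rw [formulaCode_equal, h.eq _ _ a b e ha hb, ← cls_eq_iff h, ← ea, ← eb]
    rfl
  | rel R ts =>
    cases R
    obtain ⟨a, ha, ea⟩ := h.exists_value (ts 0) e
    obtain ⟨b, hb, eb⟩ := h.exists_value (ts 1) e
    rw [formulaCode_rel, h.lt _ _ a b e ha hb, ← lt_cls h, ← ea, ← eb]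
    rfl
  | imp φ ψ ih1 ih2 =>
    rw [formulaCode, ← impCode, h.imp, ih1 e he, ih2 e he]; rfl
  | @all m φ ih =>
    have key : ∀ a, P (holdsA (formulaCode φ) (e ++ [a])) ↔
        φ.Realize default (Fin.snoc (fun i : Fin m => h.cls (e.getD i 0)) (h.cls a)) := by
      intro a
      rw [ih (e ++ [a]) (by simp [he])]
      refine iff_of_eq (congrArg _ (funext fun i => ?_))
      refine Fin.lastCases ?_ (fun i => ?_) i
      · simp [← he]
      · have : (i : ℕ) < e.length := he ▸ i.2
        simp [List.getElem?_append_left this, this]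
    rw [formulaCode, ← allCode, BoundedFormula.realize_all]
    constructor
    · intro H x
      obtain ⟨a, rfl⟩ := Quotient.exists_rep x
      exact (key a).1 (h.all _ a e H)
    · intro H
      exact h.henkin _ e ((key _).2 (H _))

end IsHenkin

end Completeness

/-! ### Effective completeness -/

/-- Recursively enumerable predicates are projections of primitive recursive ones. -/
theorem exists_primrec_of_rePred {p : ℕ → Prop} (hp : REPred p) :
    ∃ D : ℕ → ℕ → Bool, Primrec₂ D ∧ ∀ c, p c ↔ ∃ k, D c k = true := by
  obtain ⟨c, hc⟩ := Nat.Partrec.Code.exists_code.1 (Partrec.nat_iff.1 (hp.map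
    ((Computable.const 0).to₂ : Computable₂ fun (_ : ℕ) (_ : Unit) => (0 : ℕ))))
  refine ⟨fun a k => (Nat.Partrec.Code.evaln k c a).isSome, ?_, fun a => ?_⟩
  · exact Primrec.option_isSome.comp (Nat.Partrec.Code.primrec_evaln.comp
      ((Primrec.snd.pair (Primrec.const c)).pair Primrec.fst))
  · have h1 : p a ↔ (c.eval a).Dom := by rw [hc]; simp [Part.assert]
    rw [h1, Part.dom_iff_mem]
    simp only [Option.isSome_iff_exists, Nat.Partrec.Code.evaln_complete, Option.mem_def]
    exact exists_comm

/-- By completeness, consistency of `θ(n)` with a recursively enumerable theory is co-recursively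
enumerable in `n`. -/
theorem rePred_not_exists_model {U : arith.Theory} (hU : IsRE U)
    (θ : arith.BoundedFormula Empty 1) :
    REPred fun n => ¬∃ (M : Type) (_ : arith.Structure M) (_ : Nonempty M),
      M ⊨ U ∧ θ.Realize default ![nm M n] := by
  obtain ⟨D, hD, hDU⟩ := exists_primrec_of_rePred hU
  refine (rePred_unsat (C := fun n p => clauses D (formulaCode θ) n (Denumerable.ofNat _ p))
    ((primrec_clauses hD _).comp Primrec.fst ((Primrec.ofNat _).comp Primrec.snd))).of_eq
    fun n => not_congr ?_
  have key : ∀ v : Atom → Bool, (∀ p, ∀ cl ∈ clauses D (formulaCode θ) n (Denumerable.ofNat _ p),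
      ∃ l ∈ cl, v l.1 = l.2) ↔ IsHenkin (fun x => v x = true) D (formulaCode θ) n := by
    intro v
    rw [← forall_clauseList_iff]
    constructor
    · intro h t s a b e
      simpa [clauses] using h (Encodable.encode (t, s, a, b, e))
    · intro h p
      exact h _ _ _ _ _
  simp only [key]
  constructor
  · rintro ⟨v, h⟩
    refine ⟨h.Model, inferInstance, ⟨h.cls 0⟩, ⟨⟨fun φ hφ => ?_⟩, ?_⟩⟩
    · obtain ⟨s, hs⟩ := (hDU _).1 ⟨φ, hφ, rfl⟩
      have := (h.truth φ [] rfl).1 (h.ax _ s hs)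
      rw [Sentence.Realize, Formula.Realize]
      convert this
    · convert (h.truth θ [numName n] rfl).1 h.thm with i
      rw [Subsingleton.elim i 0]
      exact (h.cls_numName n).symm
  · rintro ⟨M, _, _, hM, hθ⟩
    classical
    refine ⟨fun x => decide (atomTrue M x), ?_⟩
    simp only [decide_eq_true_eq]
    refine isHenkin_atomTrue M (fun t s hs => ?_) ?_
    · obtain ⟨φ, hφ, rfl⟩ := (hDU t).2 ⟨s, hs⟩
      have := hM.realize_of_mem φ hφ
      rw [Sentence.Realize, Formula.Realize] at this
      have h2 := (evalC_formulaCode φ (default : Fin 0 → M)).2 this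
      rwa [List.ofFn_zero] at h2
    · have h2 := (evalC_formulaCode θ ![nm M n]).2 hθ
      simpa using h2

/-! ### Lax interpretability of `R` and `S` -/

/-- The pure `Δ₀`-formula that says that the variable `&i` has the value `n`. -/
def valF : ∀ (_ : ℕ) {k : ℕ} (_ : Fin k), arith.BoundedFormula Empty k
  | 0, _, i => zeroT =' &i
  | n + 1, k, i => ∃' (ltF (&(Fin.last k)) (&i.castSucc) ⊓
      ((succT (&(Fin.last k)) =' &i.castSucc) ⊓ valF n (Fin.last k)))

theorem isPureDelta0_valF (n : ℕ) {k : ℕ} (i : Fin k) : IsPureDelta0 (valF n i) := by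
  induction n generalizing k with
  | zero => exact .zero i
  | succ n ih => exact .exLt i (.and (.succ _ _) (ih _))

theorem realize_valF_nat (n : ℕ) {k : ℕ} (i : Fin k) (xs : Fin k → ℕ) :
    (valF n i).Realize default xs ↔ xs i = n := by
  induction n generalizing k with
  | zero => simp [-Pi.default_def, valF, nat_zr, eq_comm]
  | succ n ih =>
    simp only [valF, BoundedFormula.realize_ex, BoundedFormula.realize_inf, realize_ltF,
      BoundedFormula.realize_bdEqual, realize_succT, Term.realize_var, Sum.elim_inr, Function.comp,
      Fin.snoc_last, Fin.snoc_castSucc, ih, nat_Lt, nat_sc]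
    constructor
    · rintro ⟨a, -, e, rfl⟩; exact e.symm
    · intro e; exact ⟨n, by omega, by omega, rfl⟩

section

variable {M : Type} [arith.Structure M]

/-- In a model of `R`, the formula `valF n` is correct in the segment below any `z` above the
numeral of `n`, even if that segment is nonstandard. -/
theorem IsR.realize_valF (h : IsR M) {z : M} (n : ℕ) (hz : Lt (nm M n) z) {k : ℕ} (i : Fin k)
    (xs : Fin k → Cut M z) (hi : (xs i).1 = nm M n) : (valF n i).Realize default xs := by
  induction n generalizing k with
  | zero =>
    simp only [valF, BoundedFormula.realize_bdEqual, realize_zeroT]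
    rw [cut_zr]
    exact (cutAt_eq_iff (xs i).2).2 (Or.inl ⟨Or.inl hz, hi⟩)
  | succ n ih =>
    have hn : Lt (nm M n) z := h.nm_lt_of_lt n.le_succ hz
    simp only [valF, BoundedFormula.realize_ex, BoundedFormula.realize_inf, realize_ltF,
      BoundedFormula.realize_bdEqual, realize_succT, Term.realize_var, Sum.elim_inr, Function.comp,
      Fin.snoc_last, Fin.snoc_castSucc]
    refine ⟨⟨nm M n, Or.inl hn⟩, ?_, ?_, ih hn _ _ (by simp)⟩
    · rw [cut_Lt, hi]; exact h.lt_iff.2 n.lt_succ_self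
    · rw [cut_sc]
      exact (cutAt_eq_iff (xs i).2).2 (Or.inl ⟨Or.inl hz, hi⟩)

/-- The formula `∃ z (x < z ∧ z ⊨ (TN ∧ χ(x)))`. -/
noncomputable def boundedWitF (χ : arith.BoundedFormula Empty 1) : arith.Formula (Fin 1) :=
  Formula.iExs (Fin 1) ((satAt TN).relabel Sum.inr ⊓
    (ltF (.var (.inl (.inl 0))) (.var (.inl (.inr 0))) ⊓
      (cutTr.tr χ fun _ => 0).relabel (Sum.elim (fun _ => .inr 0) fun _ => .inl 0)))

theorem realize_boundedWitF (χ : arith.BoundedFormula Empty 1) (x : M) :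
    ((boundedWitF χ).Realize fun _ => x) ↔ ∃ z, Le (zr M) z ∧ IsTN (Cut M z) ∧ Lt x z ∧
      χ.Realize default fun _ => cutAt z x := by
  have h1 : ∀ w : Fin 1 → M, ((satAt TN).relabel (Sum.inr : Fin 1 → Fin 1 ⊕ Fin 1)).Realize
      (Sum.elim (fun _ => x) w) ↔ Le (zr M) (w 0) ∧ IsTN (Cut M (w 0)) := by
    intro w
    rw [Formula.realize_relabel, ← realize_satAt_TN]
    refine iff_of_eq (congrArg _ ?_)
    funext i; fin_cases i; rfl
  have h2 : ∀ w : Fin 1 → M, Le (zr M) (w 0) → Lt x (w 0) →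
      (((cutTr.tr χ fun _ => 0).relabel (Sum.elim (fun _ => .inr 0) fun _ => .inl 0) :
        arith.Formula (Fin 1 ⊕ Fin 1)).Realize (Sum.elim (fun _ => x) w) ↔
          χ.Realize default fun _ => cutAt (w 0) x) := by
    intro w h0 hx
    rw [Formula.realize_relabel]
    have hle : Le x (w 0) := Or.inl hx
    have := (cutTr_represents h0).realize_tr χ (fun _ => 0) (fun _ _ => x)
      (fun _ => by simpa [Formula.Realize] using hle)
    refine Iff.trans (iff_of_eq (congrArg _ ?_)) (this.trans (iff_of_eq ?_))
    · funext i; rcases i with i | i <;> rfl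
    · congr 1; exact Subsingleton.elim _ _
  rw [boundedWitF, Formula.realize_iExs]
  simp only [Formula.realize_inf, h1]
  constructor
  · rintro ⟨w, ⟨h0, hT⟩, hl, h⟩
    have hl' : Lt x (w 0) := by simpa [Formula.Realize] using hl
    exact ⟨w 0, h0, hT, hl', (h2 w h0 hl').1 h⟩
  · rintro ⟨z, h0, hT, hl, h⟩
    exact ⟨fun _ => z, ⟨h0, hT⟩, by simpa [Formula.Realize] using hl, (h2 _ h0 hl).2 h⟩

/-- The formula `∃ y (δ(x, y) ∧ S x ≠ x ∧ S y ≠ y)`. -/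
def witF (δ : arith.BoundedFormula Empty 2) : arith.BoundedFormula Empty 1 :=
  ∃' (δ ⊓ (∼(succT (&0) =' &0) ⊓ ∼(succT (&1) =' &1)))

theorem realize_witF {N : Type} [arith.Structure N] (δ : arith.BoundedFormula Empty 2) (x : N) :
    ((witF δ).Realize default fun _ => x) ↔
      ∃ y, δ.Realize default ![x, y] ∧ sc x ≠ x ∧ sc y ≠ y := by
  have : (fun _ : Fin 1 => x) = ![x] := by funext i; fin_cases i; rfl
  rw [this, witF, BoundedFormula.realize_ex]
  refine exists_congr fun y => ?_
  rw [snoc2]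
  simp [-Pi.default_def]

/-- A true instance of the `Σ₁`-formula `∃ y δ(x, y)` is verified, in every model of `R`, below a
numeral that exceeds the argument and the witness. -/
theorem IsR.exists_wit (h : IsR M) {δ : arith.BoundedFormula Empty 2} (hδ : IsPureDelta0 δ)
    {n b : ℕ} (hb : δ.Realize default ![n, b]) :
    (boundedWitF (witF δ)).Realize fun _ => nm M n := by
  rw [realize_boundedWitF]
  obtain ⟨N, hn, hbN⟩ : ∃ N, n < N ∧ b < N :=
    ⟨max n b + 1, Nat.lt_succ_of_le (le_max_left _ _), Nat.lt_succ_of_le (le_max_right _ _)⟩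
  obtain ⟨e, he⟩ := h.exists_equiv N
  refine ⟨nm M N, h.le_iff.2 (Nat.zero_le N), ?_, h.lt_iff.2 hn, ?_⟩
  · exact realize_TN.1 ((StrongHomClass.realize_sentence e TN).1 (realize_TN.2 (isTN_cutNat N)))
  · let x : Cut ℕ N := ⟨n, (nat_Le _ _).2 hn.le⟩
    let y : Cut ℕ N := ⟨b, (nat_Le _ _).2 hbN.le⟩
    have hx : e x = cutAt (nm M N) (nm M n) := by
      rw [cutAt_pos (h.le_iff.2 hn.le)]; exact Cut.ext (he x)
    have hne : ∀ x : Cut ℕ N, x.1 < N → sc x ≠ x := by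
      intro x hx hs
      have := congrArg Cut.val hs
      rw [cut_sc, cutNat_cutAt, nat_sc] at this
      omega
    have key : (witF δ).Realize default fun _ => x := by
      refine (realize_witF δ x).2 ⟨y, ?_, hne x hn, hne y hbN⟩
      rw [hδ.realize_cutNat ![x, y] (by intro i; fin_cases i <;> assumption)]
      convert hb using 1
      funext i; fin_cases i <;> rfl
    rw [← StrongHomClass.realize_boundedFormula e] at key
    rw [← hx]
    convert key
    rfl

/-- If a model of `R` verifies the instance at `n` of `∃ y δ(x, y)` in some segment, then it
satisfies `σ^q` for the pure `Σ₁`-sentence `σ` that expresses this instance without mentioning the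
numeral. -/
theorem IsR.realize_sigmaQ (h : IsR M) {δ : arith.BoundedFormula Empty 2} {n : ℕ}
    (hw : (boundedWitF (witF δ)).Realize fun _ => nm M n) : M ⊨ sigmaQ (valF n 0 ⊓ δ) := by
  obtain ⟨z, h0, hT, hl, hw⟩ := (realize_boundedWitF _ _).1 hw
  obtain ⟨y, hδ, hx, hy⟩ := (realize_witF _ _).1 hw
  refine (LaxInterp.realize_sigmaQ _).2 ⟨z, h0, hT, ![cutAt z (nm M n), y], ?_, ?_⟩
  · refine BoundedFormula.realize_inf.2 ⟨h.realize_valF n hl _ _ ?_, hδ⟩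
    rw [Matrix.cons_val_zero, cutAt_pos (Or.inl hl)]
  · intro i; fin_cases i <;> assumption

end

/-- The halting problem, as a set of natural numbers. -/
theorem exists_re_not_co_re : ∃ A : ℕ → Prop, REPred A ∧ ¬REPred fun n => ¬A n := by
  refine ⟨fun n => ((Denumerable.ofNat Nat.Partrec.Code n).eval 0).Dom, ?_, fun h => ?_⟩
  · exact Partrec.dom_re (Nat.Partrec.Code.eval_part.comp (Computable.ofNat _) (Computable.const 0))
  · refine ComputablePred.halting_problem_not_re 0 ?_
    refine REPred.of_eq (p := fun c : Nat.Partrec.Code =>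
      ¬((Denumerable.ofNat Nat.Partrec.Code (Encodable.encode c)).eval 0).Dom)
      (Partrec.comp h Computable.encode) fun c => ?_
    rw [Denumerable.ofNat_encode]

theorem IsRE.union_singleton {U : arith.Theory} (hU : IsRE U) (σ : arith.Sentence) :
    IsRE (U ∪ {σ}) := by
  obtain ⟨D, hD, hDU⟩ := exists_primrec_of_rePred hU
  have hW : PrimrecRel fun c k => D c k = true ∨ c = formulaCode σ :=
    PrimrecPred.or (Primrec.eq.comp hD (Primrec.const true))
      (Primrec.eq.comp Primrec.fst (Primrec.const _))
  refine (rePred_exists hW).of_eq fun c => ?_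
  rw [exists_or, ← hDU, exists_const]
  constructor
  · rintro (⟨φ, hφ, e⟩ | e)
    · exact ⟨φ, Or.inl hφ, e⟩
    · exact ⟨σ, Or.inr rfl, e.symm⟩
  · rintro ⟨φ, hφ | rfl, e⟩
    · exact Or.inl ⟨φ, hφ, e⟩
    · exact Or.inr e.symm

theorem Extends.model {L : FirstOrder.Language.{0, 0}} {V U : L.Theory} (h : Extends V U)
    {M : Type} [L.Structure M] [Nonempty M] (hM : M ⊨ V) : M ⊨ U :=
  (Theory.model_iff _).2 fun φ hφ => (h φ (Theory.models_sentence_of_mem hφ)).realize_sentence M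

/-- The set of those `n` that are refuted by `U` as arguments of the verification formula is
recursively enumerable and disjoint from the set `A`; as the complement of `A` is not recursively
enumerable, some `n` belongs to neither set. -/
theorem essentiallyTolerates_R_S (F : Features) : EssentiallyTolerates F {R} S := by
  rintro _ rfl U hU hsat hext
  obtain ⟨A, hA, hnA⟩ := exists_re_not_co_re
  obtain ⟨δ, hδ, hAδ⟩ := exists_delta0_of_re hA
  let θ : arith.BoundedFormula Empty 1 :=
    BoundedFormula.relabel (Sum.inr : Fin 1 → Empty ⊕ Fin 1) (boundedWitF (witF δ))
  have hθ : ∀ (M : Type) [arith.Structure M] (n : ℕ), θ.Realize default ![nm M n] ↔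
      (boundedWitF (witF δ)).Realize fun _ => nm M n := by
    intro M _ n
    refine BoundedFormula.realize_relabel.trans (iff_of_eq ?_)
    rw [Formula.Realize]
    congr 1
    · funext i; fin_cases i; rfl
    · exact Subsingleton.elim _ _
  have hB := rePred_not_exists_model hU θ
  -- If there were no such `n`, the complement of `A` would be the set enumerated in `hB`.
  obtain ⟨n, hn, M, _, _, hM, hnθ⟩ : ∃ n, ¬A n ∧
      ∃ (M : Type) (_ : arith.Structure M) (_ : Nonempty M),
        M ⊨ U ∧ θ.Realize default ![nm M n] := by
    by_contra hc
    push Not at hc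
    refine hnA (hB.of_eq fun n => ⟨fun h hAn => ?_, fun h => ?_⟩)
    · obtain ⟨b, hb⟩ := (hAδ n).1 hAn
      obtain ⟨M⟩ := hsat
      have hR : IsR M := isR_iff.1 (hext.model M.is_model)
      exact h ⟨M, inferInstance, inferInstance, M.is_model, (hθ _ n).2 (hR.exists_wit hδ hb)⟩
    · rintro ⟨M, hS, hN, hM, hM'⟩
      exact hc n h M hS hN hM hM'
  have hR : IsR M := isR_iff.1 (hext.model hM)
  have hσ := hR.realize_sigmaQ ((hθ _ n).1 hnθ)
  have hM' : M ⊨ (U ∪ {sigmaQ (valF n 0 ⊓ δ)} : arith.Theory) :=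
    hM.union (Theory.model_singleton_iff.2 hσ)
  have hsat' : (U ∪ {sigmaQ (valF n 0 ⊓ δ)} : arith.Theory).IsSatisfiable :=
    Theory.Model.isSatisfiable M
  refine ⟨_, hU.union_singleton _, hsat', fun φ hφ => Theory.models_of_models_theory
    (fun ψ hψ => Theory.models_sentence_of_mem (Or.inl hψ)) hφ, {sigmaQ (valF n 0 ⊓ δ)},
    ⟨2, _, (isPureDelta0_valF n 0).and hδ, ?_, rfl, hsat'.mono Set.subset_union_right⟩,
    interprets_self F fun φ hφ => Or.inr hφ⟩
  rw [Sentence.Realize, BoundedFormula.realize_exs]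
  rintro ⟨xs, h⟩
  obtain ⟨h1, h2⟩ := BoundedFormula.realize_inf.1 h
  have h1 := (realize_valF_nat n 0 xs).1 (by convert h1)
  refine hn ((hAδ n).2 ⟨xs 1, ?_⟩)
  convert h2 using 1
  funext i; fin_cases i
  · exact h1.symm
  · rfl

/-- No further extension is needed: an interpretation of `R` in a theory is one in every
extension. -/
theorem essentiallyTolerates_S_R (F : Features) : EssentiallyTolerates F S {R} := by
  intro T hT U hU hsat hext
  obtain ⟨τ, hadm, hdom, hτ⟩ := interprets_R_of_mem_S F hT
  exact ⟨U, hU, hsat, fun _ h => h, R, rfl, τ, hadm, hext _ hdom, fun φ hφ => hext _ (hτ φ hφ)⟩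

end LaxInterp

theorem mainTheorem4 (F : LaxInterp.Features) :
    LaxInterp.EssentiallyTolerates F {LaxInterp.R} LaxInterp.S ∧
      LaxInterp.EssentiallyTolerates F LaxInterp.S {LaxInterp.R} ∧
      ∀ T ∈ LaxInterp.S, LaxInterp.Interprets F T LaxInterp.R :=
  ⟨LaxInterp.essentiallyTolerates_R_S F, LaxInterp.essentiallyTolerates_S_R F,
    fun _ hT => LaxInterp.interprets_R_of_mem_S F hT⟩
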